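/- Let $m\ge 1$, let $e_1,\dots,e_m$ be the generators of the (complexified) Clifford algebra with $e_je_k+e_ke_j=-2\delta_{jk}$, and write $\underline{x}=\sum_j x_je_j$, $r=|\underline{x}|$, $\underline\omega=\underline{x}/r$ for $\underline{x}\in\mathbb{R}^m$, and $\underline\partial=\sum_j e_j\partial_{x_j}$, so that $\underline\partial^2=-\Delta_m$. Let $T_\lambda=\mathrm{Fp}\,r^\lambda$ and $U_\lambda=\mathrm{Fp}\,r^\lambda\underline\omega$ (Hadamard finite parts), and let $$T^*_\lambda=\pi^{\frac{\lambda+m}{2}}\frac{T_\lambda}{\Gamma(\frac{\lambda+m}{2})}\ (\lambda\ne -m-2l),\qquad T^*_{-m-2l}=\frac{\pi^{\frac m2-l}}{2^{2l}\,\Gamma(\frac m2+l)}(-\Delta_m)^l\delta,$$ $$U^*_\lambda=\pi^{\frac{\lambda+m+1}{2}}\frac{U_\lambda}{\Gamma(\frac{\lambda+m+1}{2})}\ (\lambda\ne -m-2l-1),\qquad U^*_{-m-2l-1}=-\frac{\pi^{\frac m2-l}}{2^{2l+1}\,\Gamma(\frac m2+l+1)}\,\underline\partial^{2l+1}\delta,$$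 with $l\in\{0,1,2,\dots\}$. Convolutions of members of these families are those given by the convolution integral for $\mathrm{Re}\,\alpha,\mathrm{Re}\,\beta>-m$, $\mathrm{Re}(\alpha+\beta)<-m$ ($\alpha,\beta$ being the two parameters), extended by analytic continuation in $(\alpha,\beta)$ to $\alpha+\beta+m\notin\{0,1,2,\dots\}$, and bilinearly to linear combinations. Put $$\underline\partial^\mu\delta=\frac{1+e^{i\pi\mu}}{2}\,\frac{2^\mu\Gamma(\frac{m+\mu}{2})}{\pi^{\frac{m-\mu}{2}}}\,T^*_{-m-\mu}-\frac{1-e^{i\pi\mu}}{2}\,\frac{2^\mu\Gamma(\frac{m+\mu+1}{2})}{\pi^{\frac{m-\mu+1}{2}}}\,U^*_{-m-\mu}\qquad(\mu\ne -m,-m-1,\dots),$$ and define the new kernels by $$\underline\partial^\mu H=\frac{1-e^{i\pi\mu}}{2}\,\frac{2^\mu\Gamma(\frac{m+\mu}{2})}{\pi^{\frac{m-\mu}{2}}}\,T^*_{-m-\mu}-\frac{1+e^{i\pi\mu}}{2}\,\frac{2^\mu\Gamma(\frac{m+\mu+1}{2})}{\pi^{\frac{m-\mu+1}{2}}}\,U^*_{-m-\mu}$$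 for all $\mu\in\mathbb{C}$ when $m$ is even (a summand whose factor $1\mp e^{i\pi\mu}$ vanishes is omitted, also where its Gamma function has a pole), and for $\mu\ne -m,-m-1,\dots$ when $m$ is odd. **Proposition.** Let $\mu,\nu\in\mathbb{C}$ with $\mu+\nu\notin\{-m,-m-1,-m-2,\dots\}$ and, when $m$ is odd, also $\mu,\nu\notin\{-m,-m-1,-m-2,\dots\}$. Then the convolution $\underline\partial^\mu H*\underline\partial^\nu H$ exists and $$\underline\partial^\mu H*\underline\partial^\nu H=\underline\partial^{\mu+\nu}\delta .$$ -/

import Mathlib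

open MeasureTheory
open scoped SchwartzMap Laplacian LineDeriv

noncomputable section

namespace CliffordKernels

/-- Euclidean space `ℝ^m`. -/
abbrev E (m : ℕ) : Type := EuclideanSpace ℝ (Fin m)

/-- The complex Clifford algebra with generators `e₁, …, e_m` and the relations
`e_j e_k + e_k e_j = -2 δ_{jk}`, i.e. the complexification of `ℝ_{0,m}`. -/
abbrev Cl (m : ℕ) : Type :=
  CliffordAlgebra (QuadraticMap.weightedSumSquares ℂ (fun _ : Fin m => (-1 : ℂ)))

/-- The Clifford vector `x = x₁ e₁ + ⋯ + x_m e_m` of a point `x ∈ ℝ^m`. -/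
def vec {m : ℕ} (x : E m) : Cl m :=
  CliffordAlgebra.ι (QuadraticMap.weightedSumSquares ℂ (fun _ : Fin m => (-1 : ℂ)))
    (fun i => (x i : ℂ))

/-- The generator `e_j`. -/
def gen {m : ℕ} (j : Fin m) : Cl m := vec (EuclideanSpace.single j (1 : ℝ))

/-- Clifford algebra valued distributions, given by their values on scalar Schwartz test
functions. -/
abbrev CliffordFunctional (m : ℕ) : Type := 𝓢(E m, ℂ) → Cl m

/-! ### The finite part distribution on the half line -/

/-- Hadamard's finite part of `∫₀^∞ r^s f(r) dr`, for `f` smooth on `ℝ` and rapidly decreasing at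
`+∞`: the Taylor polynomial of `f` at `0`, of a degree that makes the integral over `(0,1)`
converge, is subtracted, and its terms are integrated as `fp ∫₀¹ r^(s+k) dr = 1 / (s+k+1)`,
which is `0` for `s + k + 1 = 0` (there `∫_ε^1 r^(s+k) dr = - log ε` has finite part `0`, in
accordance with `1 / 0 = 0`). -/
def finitePart (s : ℂ) (f : ℝ → ℂ) : ℂ :=
  let N : ℕ := ⌊-s.re⌋₊
  (∫ r in Set.Ioc (0 : ℝ) 1,
      (r : ℂ) ^ s *
        (f r - ∑ k ∈ Finset.range N, iteratedDeriv k f 0 / (k.factorial : ℂ) * (r : ℂ) ^ k))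
    + (∫ r in Set.Ioi (1 : ℝ), (r : ℂ) ^ s * f r)
    + ∑ k ∈ Finset.range N, iteratedDeriv k f 0 / (k.factorial : ℂ) * (1 / (s + k + 1))

/-- The spherical mean `σ_m Σ⁽⁰⁾[φ](r) = ∫_{S^{m-1}} φ(r ω) dS(ω)`. -/
def sphMean {m : ℕ} (φ : 𝓢(E m, ℂ)) (r : ℝ) : ℂ :=
  ∫ ω : Metric.sphere (0 : E m) 1, φ (r • (ω : E m)) ∂((volume : Measure (E m)).toSphere)

/-- The `e_j`-component `∫_{S^{m-1}} ω_j φ(r ω) dS(ω)` of the vector valued spherical mean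
`σ_m Σ⁽¹⁾[φ](r) = ∫_{S^{m-1}} ω φ(r ω) dS(ω)`. -/
def sphMeanVec {m : ℕ} (j : Fin m) (φ : 𝓢(E m, ℂ)) (r : ℝ) : ℂ :=
  ∫ ω : Metric.sphere (0 : E m) 1, ((ω : E m) j : ℂ) * φ (r • (ω : E m))
    ∂((volume : Measure (E m)).toSphere)

/-! ### The families `T`, `U` and their normalizations -/

/-- `T_lam = Fp r^lam`. -/
def T (m : ℕ) (lam : ℂ) : CliffordFunctional m := fun φ =>
  algebraMap ℂ (Cl m) (finitePart (lam + m - 1) (sphMean φ))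

/-- `U_lam = Fp r^lam ω`, where `ω = x / |x|`. -/
def U (m : ℕ) (lam : ℂ) : CliffordFunctional m := fun φ =>
  ∑ j : Fin m, finitePart (lam + m - 1) (sphMeanVec j φ) • gen j

/-- The delta distribution. -/
def delta (m : ℕ) : CliffordFunctional m := fun φ => algebraMap ℂ (Cl m) (φ 0)

/-- The Dirac operator `∂ = ∑ e_j ∂_{x_j}` on distributions. -/
def diracOp {m : ℕ} (S : CliffordFunctional m) : CliffordFunctional m := fun φ =>
  -∑ j : Fin m, gen j * S (∂_{EuclideanSpace.single j (1 : ℝ)} φ)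

/-- The operator `-Δ` on distributions. -/
def negLaplacian {m : ℕ} (S : CliffordFunctional m) : CliffordFunctional m := fun φ => S (-Δ φ)

open Classical in
/-- The normalized distributions `T*_lam`. -/
def Tstar (m : ℕ) (lam : ℂ) : CliffordFunctional m :=
  if h : ∃ l : ℕ, lam = -m - 2 * l then
    ((Real.pi : ℂ) ^ ((m : ℂ) / 2 - h.choose) /
        (2 ^ (2 * h.choose) * Complex.Gamma ((m : ℂ) / 2 + h.choose))) •
      (negLaplacian^[h.choose] (delta m))
  else
    ((Real.pi : ℂ) ^ ((lam + m) / 2) / Complex.Gamma ((lam + m) / 2)) • T m lam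

open Classical in
/-- The normalized distributions `U*_lam`. -/
def Ustar (m : ℕ) (lam : ℂ) : CliffordFunctional m :=
  if h : ∃ l : ℕ, lam = -m - 2 * l - 1 then
    (-((Real.pi : ℂ) ^ ((m : ℂ) / 2 - h.choose) /
        (2 ^ (2 * h.choose + 1) * Complex.Gamma ((m : ℂ) / 2 + h.choose + 1)))) •
      (diracOp^[2 * h.choose + 1] (delta m))
  else
    ((Real.pi : ℂ) ^ ((lam + m + 1) / 2) / Complex.Gamma ((lam + m + 1) / 2)) • U m lam

/-! ### Convolution -/

/-- The locally integrable function which `T*_lam` is for `Re lam > -m`. -/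
def TstarFun (m : ℕ) (lam : ℂ) (x : E m) : Cl m :=
  algebraMap ℂ (Cl m)
    ((Real.pi : ℂ) ^ ((lam + m) / 2) / Complex.Gamma ((lam + m) / 2) * (‖x‖ : ℂ) ^ lam)

/-- The locally integrable function which `U*_lam` is for `Re lam > -m`. -/
def UstarFun (m : ℕ) (lam : ℂ) (x : E m) : Cl m :=
  ((Real.pi : ℂ) ^ ((lam + m + 1) / 2) / Complex.Gamma ((lam + m + 1) / 2) * (‖x‖ : ℂ) ^ lam) •
    vec (‖x‖⁻¹ • x)

/-- `F α β` is the convolution `s_α ∗ r_β` of two holomorphic families of homogeneous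
distributions of degrees `α`, `β`, which for `Re α, Re β > -m` are the locally integrable functions
`s α`, `r β`.  For `Re α, Re β > -m`, `Re (α + β) < -m` the defining integral
`⟨s_α ∗ r_β, φ⟩ = ∬ s_α(x) r_β(y) φ(x + y) dx dy` converges absolutely, and it is extended by
analytic continuation in `(α, β)` to the connected domain `α + β + m ∉ {0, 1, 2, …}` of `ℂ²`
(so that `F` is unique).  Integrals and analyticity in the finite dimensional
algebra `Cl m` are understood after applying an arbitrary linear form. -/
def IsFamilyConvolution {m : ℕ} (s r : ℂ → E m → Cl m) (F : ℂ → ℂ → CliffordFunctional m) :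
    Prop :=
  ∀ (φ : 𝓢(E m, ℂ)) (L : Cl m →ₗ[ℂ] ℂ),
    AnalyticOnNhd ℂ (fun p : ℂ × ℂ => L (F p.1 p.2 φ))
        {p : ℂ × ℂ | ∀ n : ℕ, p.1 + p.2 + m ≠ n} ∧
    ∀ α β : ℂ, -(m : ℝ) < α.re → -(m : ℝ) < β.re → (α + β).re < -(m : ℝ) →
      Integrable (fun z : E m × E m => L (s α z.1 * r β z.2) * φ (z.1 + z.2)) ∧
      L (F α β φ) = ∫ z : E m × E m, L (s α z.1 * r β z.2) * φ (z.1 + z.2)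

/-- `S ∗ R = W` for combinations `S = a T*_α + b U*_α`, `R = c T*_β + d U*_β` with
`α + β + m ∉ {0, 1, 2, …}`: the convolution exists and is bilinear in the convolutions
of the families `T*`, `U*`. -/
def HasConvolution {m : ℕ} (S R W : CliffordFunctional m) : Prop :=
  ∃ (α β a b c d : ℂ) (TT TU UT UU : ℂ → ℂ → CliffordFunctional m),
    (∀ n : ℕ, α + β + m ≠ n) ∧
    S = a • Tstar m α + b • Ustar m α ∧
    R = c • Tstar m β + d • Ustar m β ∧
    IsFamilyConvolution (TstarFun m) (TstarFun m) TT ∧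
    IsFamilyConvolution (TstarFun m) (UstarFun m) TU ∧
    IsFamilyConvolution (UstarFun m) (TstarFun m) UT ∧
    IsFamilyConvolution (UstarFun m) (UstarFun m) UU ∧
    W = (a * c) • TT α β + (a * d) • TU α β + (b * c) • UT α β + (b * d) • UU α β

/-! ### The kernels -/

/-- `2^μ Γ((m+μ)/2) / π^((m-μ)/2)`. -/
def coeffT (m : ℕ) (μ : ℂ) : ℂ :=
  2 ^ μ * Complex.Gamma ((m + μ) / 2) / (Real.pi : ℂ) ^ ((m - μ) / 2)

/-- `2^μ Γ((m+μ+1)/2) / π^((m-μ+1)/2)`. -/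
def coeffU (m : ℕ) (μ : ℂ) : ℂ :=
  2 ^ μ * Complex.Gamma ((m + μ + 1) / 2) / (Real.pi : ℂ) ^ ((m - μ + 1) / 2)

/-- The kernel `∂^μ δ` of the complex power `∂^μ` of the Dirac operator. -/
def diracKernel (m : ℕ) (μ : ℂ) : CliffordFunctional m :=
  ((1 + Complex.exp (Complex.I * Real.pi * μ)) / 2 * coeffT m μ) • Tstar m (-m - μ)
    - ((1 - Complex.exp (Complex.I * Real.pi * μ)) / 2 * coeffU m μ) • Ustar m (-m - μ)

/-- The kernel `∂^μ H`, for all `μ` if `m` is even and for `μ ≠ -m, -m-1, …` if `m` is odd.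
If `m` is even and `μ = -m-n`, the factor `1 ∓ exp (iπμ)` of the summand whose Gamma function has
a pole vanishes, and that summand is absent. -/
def hilbertKernel (m : ℕ) (μ : ℂ) : CliffordFunctional m :=
  ((1 - Complex.exp (Complex.I * Real.pi * μ)) / 2 * coeffT m μ) • Tstar m (-m - μ)
    - ((1 + Complex.exp (Complex.I * Real.pi * μ)) / 2 * coeffU m μ) • Ustar m (-m - μ)

end CliffordKernels

end

namespace CliffordKernels

/-! ### Gamma and Beta integrals on the half line -/

section

open Set Filter

/-! The two families are closed under convolution: `T*_α ∗ T*_β` and `U*_α ∗ U*_β` are multiples of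
`T*_{α+β+m}`, and the mixed products are multiples of `U*_{α+β+m}`. For `α = -m-μ`, `β = -m-ν` the
index `α+β+m` is `-m-(μ+ν)`, the one occurring in `∂^{μ+ν} δ`, so the proposition reduces to two
scalar identities. With `e = exp(iπμ)` and `f = exp(iπν)`, once the Gamma factors and powers of `π`
have cancelled, they are `(1-e)(1-f) + (1+e)(1+f) = 2(1+ef)` and `(1-e)(1+f) + (1+e)(1-f) =
2(1-ef)`; see `coeff_scalar` and `coeff_vector`.

The multiples come from the region where the convolution integral converges. There the convolution
is a function of `z`, given by an integral of `P(x) ‖x‖^(-2a) ‖z-x‖^(-2b)` with `P` constant, a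
linear form in `x`, or a bilinear form in `(x, z-x)`. Feynman's parametrization (`integral_feynman`)
merges the two powers into one power of a quadratic polynomial, completing the square makes that
power radial (`feynman_denominator`), and the remaining parameter integral is a Beta integral. In
the `U* ∗ U*` case the Clifford relation `x² = -‖x‖²` makes the answer scalar.

The continuation in `(α, β)` needs explicit right-hand sides analytic off `α+β+m ∈ ℕ`. Their
coefficients have poles only there, and `T*_λ`, `U*_λ` tested against `φ` are entire in `λ`: the
finite part is a Mellin transform plus a sum of simple fractions, and parity of the spherical means
leaves only poles that `1/Γ` cancels (`RapidSmooth.normalizedFinitePart_eq`). That the limits at the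
cancelled poles are the prescribed derivatives of `δ` follows from two first order recursions,
`tVal_lineDeriv` and `sum_uVal_lineDeriv`, which step down from `T*_{-m}` (`tVal_neg`, `uVal_neg`).
-/

theorem continuousAt_ofReal_cpow_pos {x : ℝ} (hx : 0 < x) {a : ℂ} :
    ContinuousAt (fun t : ℝ => (t : ℂ) ^ a) x :=
  ContinuousAt.cpow (by fun_prop) continuousAt_const (Or.inl (by simpa using hx))

theorem one_div_ofReal_cpow {x : ℝ} (hx : 0 < x) (a : ℂ) : (1 / (x : ℂ)) ^ a = (x : ℂ) ^ (-a) := by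
  rw [one_div, Complex.inv_cpow _ _ (by
    rw [Complex.arg_ofReal_of_nonneg hx.le]; exact Real.pi_pos.ne), Complex.cpow_neg]

theorem integrableOn_cpow_mul_exp {a : ℂ} {r : ℝ} (ha : 0 < a.re) (hr : 0 < r) :
    IntegrableOn (fun t : ℝ => (t : ℂ) ^ (a - 1) * Complex.exp (-(r * t))) (Ioi 0) := by
  have h := integrableOn_rpow_mul_exp_neg_mul_rpow (s := a.re - 1) (p := 1) (b := r)
    (by linarith) one_pos hr
  refine Integrable.mono' h ?_ ?_
  · refine ContinuousOn.aestronglyMeasurable (fun t ht => ?_) measurableSet_Ioi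
    have ht' : (0 : ℝ) < t := ht
    refine ContinuousAt.continuousWithinAt ?_
    refine ContinuousAt.mul ?_ (by fun_prop)
    exact continuousAt_ofReal_cpow_pos ht'
  · filter_upwards [ae_restrict_mem measurableSet_Ioi] with t ht
    have ht' : (0 : ℝ) < t := ht
    rw [norm_mul, Complex.norm_cpow_eq_rpow_re_of_pos ht', Complex.norm_exp]
    simp

/-- Write `Γ(a+b) p^(-(a+b))` with `p = A + C v` as a Gamma integral in `t` and exchange the order:
the exponential factors, and both the `v`-integral and then the `t`-integral are Gamma integrals. -/
theorem beta_half_line {a b : ℂ} (ha : 0 < a.re) (hb : 0 < b.re) {A C : ℝ} (hA : 0 < A)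
    (hC : 0 < C) :
    IntegrableOn (fun v : ℝ => (v : ℂ) ^ (b - 1) * ((A + C * v : ℝ) : ℂ) ^ (-(a + b))) (Ioi 0) ∧
    ∫ v in Ioi (0 : ℝ), (v : ℂ) ^ (b - 1) * ((A + C * v : ℝ) : ℂ) ^ (-(a + b)) =
      (A : ℂ) ^ (-a) * (C : ℂ) ^ (-b) * (Complex.Gamma a * Complex.Gamma b / Complex.Gamma (a + b))
      := by
  have hab : 0 < (a + b).re := by simpa using add_pos ha hb
  set F : ℝ → ℝ → ℂ := fun t v =>
    (t : ℂ) ^ (a + b - 1) * ((v : ℂ) ^ (b - 1) * Complex.exp (-((A + C * v : ℝ) * t : ℂ))) with hF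
  have hFm : AEStronglyMeasurable (Function.uncurry F)
      ((volume.restrict (Ioi (0 : ℝ))).prod (volume.restrict (Ioi (0 : ℝ)))) := by
    rw [Measure.prod_restrict]
    refine ContinuousOn.aestronglyMeasurable (fun p hp => ?_)
      (measurableSet_Ioi.prod measurableSet_Ioi)
    have h1 : (0 : ℝ) < p.1 := hp.1
    have h2 : (0 : ℝ) < p.2 := hp.2
    refine ContinuousAt.continuousWithinAt ?_
    refine ContinuousAt.mul (ContinuousAt.cpow (by fun_prop) continuousAt_const (Or.inl ?_))
      (ContinuousAt.mul (ContinuousAt.cpow (by fun_prop) continuousAt_const (Or.inl ?_)) (by fun_prop))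
    · simpa using h1
    · simpa using h2
  have hsplit : ∀ t v : ℝ, F t v = ((t : ℂ) ^ (a + b - 1) * Complex.exp (-(A * t))) *
      ((v : ℂ) ^ (b - 1) * Complex.exp (-((C * t : ℝ) * v))) := by
    intro t v
    have : Complex.exp (-((A + C * v : ℝ) * t : ℂ)) =
      Complex.exp (-(A * t)) * Complex.exp (-((C * t : ℝ) * v)) := by
      rw [← Complex.exp_add]; congr 1; push_cast; ring
    simp only [hF, this]; ring
  have hinner : ∀ t ∈ Ioi (0 : ℝ), ∫ v in Ioi (0 : ℝ), F t v =
      (C : ℂ) ^ (-b) * Complex.Gamma b * ((t : ℂ) ^ (a - 1) * Complex.exp (-(A * t))) := by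
    intro t ht
    have ht' : (0 : ℝ) < t := ht
    simp_rw [hsplit]
    rw [integral_const_mul, Complex.integral_cpow_mul_exp_neg_mul_Ioi hb (by simpa using mul_pos hC ht')]
    rw [one_div_ofReal_cpow (by positivity), Complex.ofReal_mul, Complex.mul_cpow_ofReal_nonneg hC.le ht'.le]
    have : (t : ℂ) ^ (a + b - 1) * (t : ℂ) ^ (-b) = (t : ℂ) ^ (a - 1) := by
      rw [← Complex.cpow_add _ _ (by exact_mod_cast ht'.ne')]; congr 1; ring
    linear_combination (Complex.exp (-(A * t)) * (C : ℂ) ^ (-b) * Complex.Gamma b) * this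
  have hnorm : ∀ t ∈ Ioi (0 : ℝ), ∀ v ∈ Ioi (0 : ℝ), ‖F t v‖ =
      (t ^ (a.re + b.re - 1) * Real.exp (-(A * t))) * (v ^ (b.re - 1) * Real.exp (-((C * t) * v)))
      := by
    intro t ht v hv
    have ht' : (0 : ℝ) < t := ht
    have hv' : (0 : ℝ) < v := hv
    rw [hsplit, norm_mul, norm_mul, norm_mul, Complex.norm_cpow_eq_rpow_re_of_pos ht',
      Complex.norm_cpow_eq_rpow_re_of_pos hv', Complex.norm_exp, Complex.norm_exp]
    simp
  -- The modulus of `F` is the same expression at the real parts of the exponents, so the same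
  -- computation, now with real Gamma integrals, proves absolute integrability.
  have hint : Integrable (Function.uncurry F)
      ((volume.restrict (Ioi (0 : ℝ))).prod (volume.restrict (Ioi (0 : ℝ)))) := by
    rw [integrable_prod_iff hFm]
    constructor
    · filter_upwards [ae_restrict_mem measurableSet_Ioi] with t ht
      have ht' : (0 : ℝ) < t := ht
      simp only [Function.uncurry_apply_pair, hsplit]
      exact (integrableOn_cpow_mul_exp hb (by positivity)).const_mul _
    · have h1 : IntegrableOn (fun t : ℝ => ((1 / C) ^ b.re * Real.Gamma b.re) *
          (t ^ (a.re - 1) * Real.exp (-A * t ^ (1 : ℝ)))) (Ioi 0) :=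
        (integrableOn_rpow_mul_exp_neg_mul_rpow (s := a.re - 1) (p := 1) (b := A)
          (by linarith) one_pos hA).const_mul _
      refine h1.congr_fun (fun t ht => ?_) measurableSet_Ioi
      have ht' : (0 : ℝ) < t := ht
      simp only [Function.uncurry_apply_pair]
      rw [setIntegral_congr_fun measurableSet_Ioi (fun v hv => hnorm t ht v hv),
        integral_const_mul, Real.integral_rpow_mul_exp_neg_mul_Ioi hb (by positivity)]
      rw [Real.rpow_one, one_div, one_div, Real.inv_rpow (by positivity),
        Real.inv_rpow (by positivity), Real.mul_rpow hC.le ht'.le]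
      have : t ^ (a.re + b.re - 1) = t ^ (a.re - 1) * t ^ b.re := by
        rw [← Real.rpow_add ht']; congr 1; ring
      have h2 : t ^ b.re ≠ 0 := (Real.rpow_pos_of_pos ht' _).ne'
      have h3 : C ^ b.re ≠ 0 := (Real.rpow_pos_of_pos hC _).ne'
      rw [this, neg_mul]
      field_simp
  have hG : Complex.Gamma (a + b) ≠ 0 := Complex.Gamma_ne_zero_of_re_pos hab
  have hinner2 : ∀ v ∈ Ioi (0 : ℝ), ∫ t in Ioi (0 : ℝ), F t v =
      Complex.Gamma (a + b) * ((v : ℂ) ^ (b - 1) * ((A + C * v : ℝ) : ℂ) ^ (-(a + b))) := by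
    intro v hv
    have hv' : (0 : ℝ) < v := hv
    have hp : 0 < A + C * v := by positivity
    have : ∀ t : ℝ, F t v = (v : ℂ) ^ (b - 1) *
        ((t : ℂ) ^ (a + b - 1) * Complex.exp (-((A + C * v : ℝ) * t : ℂ))) := fun t => by
      simp only [hF]; ring
    simp_rw [this]
    rw [integral_const_mul, Complex.integral_cpow_mul_exp_neg_mul_Ioi hab (by exact_mod_cast hp),
      one_div_ofReal_cpow hp]
    ring
  constructor
  · have := (hint.integral_prod_right).const_mul (Complex.Gamma (a + b))⁻¹
    refine IntegrableOn.congr_fun (f := fun v => (Complex.Gamma (a + b))⁻¹ *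
      ∫ t in Ioi (0 : ℝ), F t v) this (fun v hv => ?_) measurableSet_Ioi
    simp only
    rw [hinner2 v hv, inv_mul_cancel_left₀ hG]
  · have h1 := integral_integral_swap hint
    rw [setIntegral_congr_fun measurableSet_Ioi hinner,
      setIntegral_congr_fun measurableSet_Ioi hinner2, integral_const_mul, integral_const_mul,
      Complex.integral_cpow_mul_exp_neg_mul_Ioi ha (by exact_mod_cast hA),
      one_div_ofReal_cpow hA] at h1
    field_simp
    linear_combination -h1

end

/-! ### Radial integrals over Euclidean space -/

section

open Set Filter

theorem pi_sqrt_pow (m : ℕ) : ((Real.sqrt Real.pi ^ m : ℝ) : ℂ) = (Real.pi : ℂ) ^ ((m : ℂ) / 2) := by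
  rw [Real.sqrt_eq_rpow, ← Real.rpow_natCast, ← Real.rpow_mul Real.pi_pos.le,
    Complex.ofReal_cpow Real.pi_pos.le]
  congr 1; push_cast; ring

theorem toSphere_real_univ (m : ℕ) [NeZero m] :
    (((volume : Measure (E m)).toSphere.real univ : ℝ) : ℂ) =
      2 * (Real.pi : ℂ) ^ ((m : ℂ) / 2) / Complex.Gamma ((m : ℂ) / 2) := by
  have hm : (m : ℝ) ≠ 0 := by exact_mod_cast NeZero.ne m
  have hm0 : (0 : ℝ) < m := by exact_mod_cast Nat.pos_of_ne_zero (NeZero.ne m)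
  have hmc : (m : ℂ) ≠ 0 := by exact_mod_cast NeZero.ne m
  rw [Measure.toSphere_real_apply_univ, measureReal_def, EuclideanSpace.volume_ball]
  have hG : 0 < Real.Gamma ((m : ℝ) / 2) := Real.Gamma_pos_of_pos (by positivity)
  have hGc : Complex.Gamma ((m : ℂ) / 2) ≠ 0 :=
    Complex.Gamma_ne_zero_of_re_pos (by simpa using hm0)
  have h1 : Real.Gamma ((m : ℝ) / 2 + 1) = m / 2 * Real.Gamma ((m : ℝ) / 2) :=
    Real.Gamma_add_one (by positivity)
  simp only [Fintype.card_fin, finrank_euclideanSpace, ENNReal.ofReal_one, one_pow, one_mul]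
  rw [ENNReal.toReal_ofReal (by rw [h1]; positivity), h1]
  push_cast [← Complex.Gamma_ofReal]
  rw [← Complex.ofReal_pow, pi_sqrt_pow]
  field_simp

theorem integral_fun_norm {m : ℕ} [NeZero m] (f : ℝ → ℂ) :
    ∫ x : E m, f ‖x‖ = 2 * (Real.pi : ℂ) ^ ((m : ℂ) / 2) / Complex.Gamma ((m : ℂ) / 2) *
      ∫ y in Ioi (0 : ℝ), ((y : ℂ) ^ (m - 1)) * f y := by
  rw [integral_fun_norm_addHaar, ← toSphere_real_univ, Measure.toSphere_real_apply_univ]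
  simp [mul_assoc]

/-- Polar coordinates and the substitution `v = r²` give a Beta integral with second parameter
`(m+j)/2`. The moments `j = 0, 1, 2` are those that arise from constant, linear and bilinear
weights. -/
theorem integrable_radial {m : ℕ} [NeZero m] (j : ℕ) {n : ℂ} (hn : ((m : ℝ) + j) / 2 < n.re)
    {p q : ℝ} (hp : 0 < p) (hq : 0 < q) :
    Integrable (fun w : E m => (‖w‖ : ℂ) ^ j * ((q + p * ‖w‖ ^ 2 : ℝ) : ℂ) ^ (-n)) ∧
    ∫ w : E m, (‖w‖ : ℂ) ^ j * ((q + p * ‖w‖ ^ 2 : ℝ) : ℂ) ^ (-n) =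
      (Real.pi : ℂ) ^ ((m : ℂ) / 2) / Complex.Gamma ((m : ℂ) / 2) *
      ((q : ℂ) ^ (((m : ℂ) + j) / 2 - n) * (p : ℂ) ^ (-(((m : ℂ) + j) / 2)) *
        (Complex.Gamma (((m : ℂ) + j) / 2) * Complex.Gamma (n - ((m : ℂ) + j) / 2) /
          Complex.Gamma n)) := by
  have hm0 : (0 : ℝ) < m := by exact_mod_cast Nat.pos_of_ne_zero (NeZero.ne m)
  have hm1 : 1 ≤ m := Nat.one_le_iff_ne_zero.mpr (NeZero.ne m)
  have hb : 0 < (((m : ℂ) + j) / 2).re := by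
    simp only [Complex.div_ofNat_re, Complex.add_re, Complex.natCast_re]; positivity
  have ha : 0 < (n - ((m : ℂ) + j) / 2).re := by
    simpa using hn
  obtain ⟨h1, h2⟩ := beta_half_line ha hb hq hp
  set g : ℝ → ℂ := fun v => (v : ℂ) ^ (((m : ℂ) + j) / 2 - 1) * ((q + p * v : ℝ) : ℂ) ^
    (-(n - ((m : ℂ) + j) / 2 + ((m : ℂ) + j) / 2)) with hg
  set f : ℝ → ℂ := fun r => (r : ℂ) ^ j * ((q + p * r ^ 2 : ℝ) : ℂ) ^ (-n) with hf
  have hfg : ∀ x ∈ Ioi (0 : ℝ), x ^ ((2 : ℝ) - 1) • g (x ^ (2 : ℝ)) = x ^ (m - 1) • f x := by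
    intro x hx
    have hx' : (0 : ℝ) < x := hx
    have e1 : ((x ^ 2 : ℝ) : ℂ) ^ (((m : ℂ) + j) / 2 - 1) = (x : ℂ) ^ ((m : ℂ) + j - 2) := by
      rw [Complex.ofReal_pow, ← Complex.cpow_nat_mul']
      · congr 1; push_cast; ring
      · rw [Complex.arg_ofReal_of_nonneg hx'.le]; simpa using Real.pi_pos
      · rw [Complex.arg_ofReal_of_nonneg hx'.le]; simpa using Real.pi_pos.le
    have e2 : (x : ℂ) * (x : ℂ) ^ ((m : ℂ) + j - 2) = (x : ℂ) ^ (m - 1) * (x : ℂ) ^ j := by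
      rw [← pow_add, ← Complex.cpow_natCast]
      nth_rw 1 [← Complex.cpow_one (x : ℂ)]
      rw [← Complex.cpow_add _ _ (by exact_mod_cast hx'.ne')]
      congr 1; push_cast [Nat.cast_sub hm1]; ring
    simp only [hg, hf, Real.rpow_two, sub_add_cancel, e1, Complex.real_smul]
    norm_num
    rw [← mul_assoc, e2, mul_assoc]
  constructor
  · change Integrable (fun w : E m => f ‖w‖)
    rw [integrable_fun_norm_addHaar, finrank_euclideanSpace, Fintype.card_fin]
    have := (integrableOn_Ioi_comp_rpow_iff' g (p := 2) (by norm_num)).mpr h1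
    exact this.congr_fun hfg measurableSet_Ioi
  · change ∫ w : E m, f ‖w‖ = _
    rw [integral_fun_norm]
    have h3 := integral_comp_rpow_Ioi_of_pos (g := g) (p := 2) (by norm_num)
    have h4 : ∀ x ∈ Ioi (0 : ℝ), ((2 : ℝ) * x ^ ((2 : ℝ) - 1)) • g (x ^ (2 : ℝ)) =
        2 * ((x : ℂ) ^ (m - 1) * f x) := by
      intro x hx
      rw [mul_smul, hfg x hx]; simp
    rw [setIntegral_congr_fun measurableSet_Ioi h4, integral_const_mul, h2] at h3
    simp only [sub_add_cancel, neg_sub] at h3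
    linear_combination (Real.pi : ℂ) ^ ((m : ℂ) / 2) / Complex.Gamma ((m : ℂ) / 2) * h3

end

/-! ### Feynman parametrization of a product of two powers -/

section

open Set Filter

/-- The integrand of the Feynman parametrization of `‖x‖ ^ (-2 a) * ‖y‖ ^ (-2 b)`. -/
noncomputable def feynman {m : ℕ} (a b : ℂ) (x y : E m) (v : ℝ) : ℂ :=
  (v : ℂ) ^ (b - 1) * ((‖x‖ ^ 2 + ‖y‖ ^ 2 * v : ℝ) : ℂ) ^ (-(a + b))

theorem ofReal_sq_cpow {r : ℝ} (hr : 0 < r) (a : ℂ) : ((r ^ 2 : ℝ) : ℂ) ^ a = (r : ℂ) ^ (2 * a) := by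
  rw [Complex.ofReal_pow, ← Complex.cpow_nat_mul']
  · norm_num
  · rw [Complex.arg_ofReal_of_nonneg hr.le]; simpa using Real.pi_pos
  · rw [Complex.arg_ofReal_of_nonneg hr.le]; simpa using Real.pi_pos.le

/-- Since `x` and `y` do not both vanish, the base of the second power is positive, and taking the
modulus only replaces exponents by their real parts. Absolute convergence can thus be read off from
the exact formulas at real exponents. -/
theorem norm_feynman {m : ℕ} (a b : ℂ) {x y : E m} (hxy : x ≠ 0 ∨ y ≠ 0) {v : ℝ} (hv : 0 < v) :
    ‖feynman a b x y v‖ = (feynman a.re b.re x y v).re := by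
  have hp : 0 < ‖x‖ ^ 2 + ‖y‖ ^ 2 * v := by
    rcases hxy with h | h
    · have := norm_pos_iff.mpr h
      positivity
    · have := norm_pos_iff.mpr h
      positivity
  rw [feynman, norm_mul, Complex.norm_cpow_eq_rpow_re_of_pos hv,
    Complex.norm_cpow_eq_rpow_re_of_pos hp, feynman]
  have h1 : (v : ℂ) ^ ((b.re : ℂ) - 1) = ((v ^ (b.re - 1) : ℝ) : ℂ) := by
    rw [Complex.ofReal_cpow hv.le]; push_cast; rfl
  have h2 : ((‖x‖ ^ 2 + ‖y‖ ^ 2 * v : ℝ) : ℂ) ^ (-((a.re : ℂ) + b.re)) =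
      (((‖x‖ ^ 2 + ‖y‖ ^ 2 * v) ^ (-(a.re + b.re)) : ℝ) : ℂ) := by
    rw [Complex.ofReal_cpow hp.le]; push_cast; rfl
  rw [h1, h2, ← Complex.ofReal_mul, Complex.ofReal_re]
  simp

theorem integral_feynman {m : ℕ} {a b : ℂ} (ha : 0 < a.re) (hb : 0 < b.re) {x y : E m}
    (hx : x ≠ 0) (hy : y ≠ 0) :
    IntegrableOn (feynman a b x y) (Ioi 0) ∧ ∫ v in Ioi (0 : ℝ), feynman a b x y v =
      (‖x‖ : ℂ) ^ (-2 * a) * (‖y‖ : ℂ) ^ (-2 * b) *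
        (Complex.Gamma a * Complex.Gamma b / Complex.Gamma (a + b)) := by
  have hx' := norm_pos_iff.mpr hx
  have hy' := norm_pos_iff.mpr hy
  have := beta_half_line ha hb (A := ‖x‖ ^ 2) (C := ‖y‖ ^ 2) (by positivity) (by positivity)
  refine ⟨this.1, this.2.trans ?_⟩
  rw [ofReal_sq_cpow hx', ofReal_sq_cpow hy']
  ring_nf

theorem measurable_feynman {m : ℕ} (a b : ℂ) (z : E m) :
    Measurable fun p : ℝ × E m => feynman a b p.2 (z - p.2) p.1 := by
  unfold feynman
  fun_prop

theorem ae_ne_ne {m : ℕ} [NeZero m] (z : E m) : ∀ᵐ x : E m, x ≠ 0 ∧ z - x ≠ 0 := by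
  have h0 : ∀ᵐ x : E m, x ≠ 0 := by simp [ae_iff]
  have hz : ∀ᵐ x : E m, x ≠ z := by simp [ae_iff]
  filter_upwards [h0, hz] with x hx hxz
  exact ⟨hx, sub_ne_zero.mpr hxz.symm⟩

/-- Fubini for the parametrized product: the `x`-integral moves inside the `v`-integral, where the
integrand has a single quadratic base. -/
theorem integral_mul_norm_cpow {m : ℕ} [NeZero m] {a b : ℂ} (ha : 0 < a.re) (hb : 0 < b.re)
    (z : E m) {P : E m → ℂ} (hPm : Measurable P)
    (hP : Integrable fun x => P x * ((‖x‖ : ℂ) ^ (-2 * a) * (‖z - x‖ : ℂ) ^ (-2 * b))) :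
    ∫ x, P x * ((‖x‖ : ℂ) ^ (-2 * a) * (‖z - x‖ : ℂ) ^ (-2 * b)) =
      Complex.Gamma (a + b) / (Complex.Gamma a * Complex.Gamma b) *
        ∫ v in Ioi (0 : ℝ), ∫ x, P x * feynman a b x (z - x) v := by
  have hGa := Complex.Gamma_ne_zero_of_re_pos ha
  have hGb := Complex.Gamma_ne_zero_of_re_pos hb
  have hGab : Complex.Gamma (a + b) ≠ 0 :=
    Complex.Gamma_ne_zero_of_re_pos (by simpa using add_pos ha hb)
  -- Integrating the modulus over `v` first returns, up to a Gamma constant, the modulus of the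
  -- integrand of `hP`.
  have hint : Integrable (Function.uncurry fun v x => P x * feynman a b x (z - x) v)
      ((volume.restrict (Ioi (0 : ℝ))).prod (volume : Measure (E m))) := by
    rw [integrable_prod_iff']
    · constructor
      · filter_upwards [ae_ne_ne z] with x hx
        exact (integral_feynman ha hb hx.1 hx.2).1.const_mul (P x)
      · refine (hP.norm.mul_const
          (Complex.Gamma a.re * Complex.Gamma b.re / Complex.Gamma (a.re + b.re)).re).congr ?_
        filter_upwards [ae_ne_ne z] with x hx
        have h1 : ∀ v ∈ Ioi (0 : ℝ), ‖P x * feynman a b x (z - x) v‖ =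
            ‖P x‖ * (feynman a.re b.re x (z - x) v).re := fun v hv => by
          rw [norm_mul, norm_feynman a b (Or.inl hx.1) hv]
        simp only [Function.uncurry_apply_pair]
        rw [setIntegral_congr_fun measurableSet_Ioi h1, integral_const_mul]
        have h2 := integral_feynman (a := a.re) (b := b.re) (by simpa) (by simpa) hx.1 hx.2
        have h3 := integral_re (𝕜 := ℂ) h2.1
        simp only [RCLike.re_to_complex] at h3
        rw [h3, h2.2, norm_mul, norm_mul,
          Complex.norm_cpow_eq_rpow_re_of_pos (norm_pos_iff.mpr hx.1),
          Complex.norm_cpow_eq_rpow_re_of_pos (norm_pos_iff.mpr hx.2)]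
        have e1 : (‖x‖ : ℂ) ^ (-2 * (a.re : ℂ)) = ((‖x‖ ^ (-2 * a).re : ℝ) : ℂ) := by
          rw [Complex.ofReal_cpow (norm_nonneg _)]; simp
        have e2 : (‖z - x‖ : ℂ) ^ (-2 * (b.re : ℂ)) = ((‖z - x‖ ^ (-2 * b).re : ℝ) : ℂ) := by
          rw [Complex.ofReal_cpow (norm_nonneg _)]; simp
        rw [e1, e2, ← Complex.ofReal_mul, Complex.re_ofReal_mul]
        ring
    · have : Measurable (Function.uncurry fun v x => P x * feynman a b x (z - x) v) :=
        (hPm.comp measurable_snd).mul (measurable_feynman a b z)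
      exact this.aestronglyMeasurable
  rw [integral_integral_swap hint, ← integral_const_mul]
  refine integral_congr_ae ?_
  filter_upwards [ae_ne_ne z] with x hx
  rw [integral_const_mul, (integral_feynman ha hb hx.1 hx.2).2]
  field_simp

/-- Completing the square: the minimum of `‖x‖² + v ‖z-x‖²` lies at `x = (v/(1+v)) z`, so recentring
there removes the term linear in `w`. -/
theorem feynman_denominator {m : ℕ} (w z : E m) {v : ℝ} (hv : 0 < v) :
    ‖w + (v / (1 + v)) • z‖ ^ 2 + ‖z - (w + (v / (1 + v)) • z)‖ ^ 2 * v =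
      ‖z‖ ^ 2 * (v / (1 + v)) + (1 + v) * ‖w‖ ^ 2 := by
  have e : z - (w + (v / (1 + v)) • z) = (1 / (1 + v)) • z - w := by
    have : (1 / (1 + v)) = 1 - v / (1 + v) := by field_simp; ring
    rw [this, sub_smul, one_smul]; abel
  rw [e, norm_add_sq_real, norm_sub_sq_real, inner_smul_left, inner_smul_right, norm_smul,
    norm_smul, real_inner_comm]
  simp only [Real.norm_eq_abs, mul_pow, sq_abs, conj_trivial]
  field_simp
  ring

theorem integral_feynman_translate {m : ℕ} (a b : ℂ) (z : E m) (P : E m → ℂ) {v : ℝ} (hv : 0 < v) :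
    ∫ x, P x * feynman a b x (z - x) v = (v : ℂ) ^ (b - 1) *
      ∫ w, P (w + (v / (1 + v)) • z) *
        ((‖z‖ ^ 2 * (v / (1 + v)) + (1 + v) * ‖w‖ ^ 2 : ℝ) : ℂ) ^ (-(a + b)) := by
  rw [← integral_add_right_eq_self _ ((v / (1 + v)) • z), ← integral_const_mul]
  refine integral_congr_ae (Eventually.of_forall fun w => ?_)
  simp only [feynman, feynman_denominator w z hv]
  ring

theorem cpow_feynman_scale {r v : ℝ} (hr : 0 < r) (hv : 0 < v) (e : ℂ) :
    ((r ^ 2 * (v / (1 + v)) : ℝ) : ℂ) ^ e =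
      (r : ℂ) ^ (2 * e) * ((v : ℂ) ^ e * ((1 + v : ℝ) : ℂ) ^ (-e)) := by
  have h1 : 0 < 1 + v := by positivity
  rw [Complex.ofReal_mul, Complex.mul_cpow_ofReal_nonneg (by positivity) (by positivity),
    ofReal_sq_cpow hr, div_eq_mul_inv, Complex.ofReal_mul,
    Complex.mul_cpow_ofReal_nonneg hv.le (by positivity), ← one_div, Complex.ofReal_div,
    Complex.ofReal_one, one_div_ofReal_cpow h1]

theorem beta_one {a b : ℂ} (ha : 0 < a.re) (hb : 0 < b.re) :
    IntegrableOn (fun v : ℝ => (v : ℂ) ^ (b - 1) * ((1 + v : ℝ) : ℂ) ^ (-(a + b))) (Ioi 0) ∧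
    ∫ v in Ioi (0 : ℝ), (v : ℂ) ^ (b - 1) * ((1 + v : ℝ) : ℂ) ^ (-(a + b)) =
      Complex.Gamma a * Complex.Gamma b / Complex.Gamma (a + b) := by
  simpa using beta_half_line ha hb one_pos one_pos

theorem Gamma_half_dim_ne_zero (m : ℕ) [NeZero m] : Complex.Gamma ((m : ℂ) / 2) ≠ 0 := by
  have hm0 : (0 : ℝ) < m := by exact_mod_cast Nat.pos_of_ne_zero (NeZero.ne m)
  exact Complex.Gamma_ne_zero_of_re_pos (by simpa using hm0)

/-- The `x`-integral of the Feynman integrand against `‖w‖ ^ 0`. -/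
theorem integral_feynman_one {m : ℕ} [NeZero m] {a b : ℂ} (hab : (m : ℝ) / 2 < (a + b).re)
    {z : E m} (hz : z ≠ 0) {v : ℝ} (hv : 0 < v) :
    Integrable (fun w : E m =>
      ((‖z‖ ^ 2 * (v / (1 + v)) + (1 + v) * ‖w‖ ^ 2 : ℝ) : ℂ) ^ (-(a + b))) ∧
    (v : ℂ) ^ (b - 1) * ∫ w : E m,
        ((‖z‖ ^ 2 * (v / (1 + v)) + (1 + v) * ‖w‖ ^ 2 : ℝ) : ℂ) ^ (-(a + b)) =
      (Real.pi : ℂ) ^ ((m : ℂ) / 2) * (Complex.Gamma (a + b - m / 2) / Complex.Gamma (a + b)) *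
        (‖z‖ : ℂ) ^ (m - 2 * (a + b)) *
        ((v : ℂ) ^ ((m : ℂ) / 2 - a - 1) *
          ((1 + v : ℝ) : ℂ) ^ (-(((m : ℂ) / 2 - b) + ((m : ℂ) / 2 - a)))) := by
  have hz' := norm_pos_iff.mpr hz
  have h1 : 0 < 1 + v := by positivity
  have h := integrable_radial (m := m) 0 (n := a + b) (by simpa using hab) (p := 1 + v)
    (q := ‖z‖ ^ 2 * (v / (1 + v))) h1 (by positivity)
  simp only [pow_zero, one_mul, Nat.cast_zero, add_zero] at h
  refine ⟨h.1, ?_⟩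
  rw [h.2, cpow_feynman_scale hz' hv]
  have hG := Gamma_half_dim_ne_zero m
  have hv0 : (v : ℂ) ≠ 0 := by exact_mod_cast hv.ne'
  have h10 : ((1 + v : ℝ) : ℂ) ≠ 0 := by exact_mod_cast h1.ne'
  -- The powers of `v` and `1 + v` are regrouped into the integrand of `beta_one` with parameters
  -- `m/2 - b` and `m/2 - a`.
  have e1 : (v : ℂ) ^ ((m : ℂ) / 2 - a - 1) = (v : ℂ) ^ (b - 1) * (v : ℂ) ^ ((m : ℂ) / 2 - (a + b))
    := by rw [← Complex.cpow_add _ _ hv0]; congr 1; ring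
  have e2 : ((1 + v : ℝ) : ℂ) ^ (-(((m : ℂ) / 2 - b) + ((m : ℂ) / 2 - a))) =
      ((1 + v : ℝ) : ℂ) ^ (-((m : ℂ) / 2 - (a + b))) * ((1 + v : ℝ) : ℂ) ^ (-((m : ℂ) / 2)) := by
    rw [← Complex.cpow_add _ _ h10]; congr 1; ring
  have e3 : (2 : ℂ) * ((m : ℂ) / 2 - (a + b)) = m - 2 * (a + b) := by ring
  rw [e1, e2, e3]
  field_simp

theorem measurable_norm_cpow_mul {m : ℕ} (a b : ℂ) (z : E m) :
    Measurable fun x : E m => (‖x‖ : ℂ) ^ a * (‖z - x‖ : ℂ) ^ b := by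
  fun_prop

/-- Instead of estimating near `0`, near `z` and at infinity, the parametrized integrand is shown to
be jointly integrable by integrating over `x` first. The resulting Beta integral converges because
`a.re, b.re < m/2`; integrating over `v` then recovers the product of powers. -/
theorem integrable_norm_cpow_mul_norm_sub_cpow {m : ℕ} [NeZero m] {a b : ℂ} (ha : 0 < a.re)
    (hb : 0 < b.re) (ham : a.re < m / 2) (hbm : b.re < m / 2) (hab : (m : ℝ) / 2 < a.re + b.re)
    {z : E m} (hz : z ≠ 0) :
    Integrable fun x => (‖x‖ : ℂ) ^ (-2 * a) * (‖z - x‖ : ℂ) ^ (-2 * b) := by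
  have hxz : ∀ x : E m, x ≠ 0 ∨ z - x ≠ 0 := by
    intro x
    by_cases hx : x = 0
    · right; simpa [hx] using hz
    · exact Or.inl hx
  have hG : Complex.Gamma a * Complex.Gamma b / Complex.Gamma (a + b) ≠ 0 :=
    div_ne_zero (mul_ne_zero (Complex.Gamma_ne_zero_of_re_pos ha)
      (Complex.Gamma_ne_zero_of_re_pos hb))
      (Complex.Gamma_ne_zero_of_re_pos (by simpa using add_pos ha hb))
  -- Quantified afresh over the exponents: it is used both at `a, b` and at their real parts.
  have hinner : ∀ a b : ℂ, (m : ℝ) / 2 < (a + b).re → ∀ v ∈ Ioi (0 : ℝ),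
      Integrable fun x => feynman a b x (z - x) v := by
    intro a b hab v hv
    have h := ((integral_feynman_one hab hz hv).1.comp_sub_right ((v / (1 + v)) • z)).const_mul
      ((v : ℂ) ^ (b - 1))
    refine h.congr (Eventually.of_forall fun x => ?_)
    simp only [feynman, ← feynman_denominator _ z hv, sub_add_cancel]
  have hint : Integrable (Function.uncurry fun v x => feynman a b x (z - x) v)
      ((volume.restrict (Ioi (0 : ℝ))).prod (volume : Measure (E m))) := by
    have hms : Measurable (Function.uncurry fun v x => feynman a b x (z - x) v) :=
      measurable_feynman a b z
    rw [integrable_prod_iff hms.aestronglyMeasurable]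
    constructor
    · filter_upwards [ae_restrict_mem measurableSet_Ioi] with v hv
      exact hinner a b (by simpa using hab) v hv
    · have hB := (beta_one (a := (m : ℂ) / 2 - b.re) (b := (m : ℂ) / 2 - a.re)
        (by simpa using hbm) (by simpa using ham)).1.const_mul
        ((Real.pi : ℂ) ^ ((m : ℂ) / 2) * (Complex.Gamma (a.re + b.re - m / 2) /
          Complex.Gamma (a.re + b.re)) * (‖z‖ : ℂ) ^ (m - 2 * ((a.re : ℂ) + b.re)))
      refine IntegrableOn.congr_fun (hB.re) (fun v hv => ?_) measurableSet_Ioi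
      have h1 : ∀ x, ‖feynman a b x (z - x) v‖ = (feynman a.re b.re x (z - x) v).re := fun x =>
        norm_feynman a b (hxz x) hv
      have hab' : (m : ℝ) / 2 < ((a.re : ℂ) + b.re).re := by simpa using hab
      simp only [h1, Function.uncurry_apply_pair]
      have h3 := integral_re (𝕜 := ℂ) (hinner a.re b.re hab' v hv)
      simp only [RCLike.re_to_complex] at h3
      have h4 := integral_feynman_translate a.re b.re z (fun _ => 1) hv
      simp only [one_mul] at h4
      rw [h3, h4, (integral_feynman_one hab' hz hv).2]
      rfl
  have h := hint.integral_prod_right.mul_const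
    (Complex.Gamma a * Complex.Gamma b / Complex.Gamma (a + b))⁻¹
  refine h.congr ?_
  filter_upwards [ae_ne_ne z] with x hx
  simp only [Function.uncurry_apply_pair]
  rw [(integral_feynman ha hb hx.1 hx.2).2, mul_inv_cancel_right₀ hG]

end

/-! ### Riesz composition formulas with constant, linear and bilinear weights -/

section

open Set Filter

/-- A weight of size `‖x‖^i ‖z-x‖^j` only lowers `a` by `i/2` and `b` by `j/2`, so the unweighted
case applies to the shifted exponents. -/
theorem integrable_mul_norm_cpow {m : ℕ} [NeZero m] (i j : ℕ) {a b : ℂ} (ha : (i : ℝ) / 2 < a.re)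
    (hb : (j : ℝ) / 2 < b.re) (ham : a.re < (m + i) / 2) (hbm : b.re < (m + j) / 2)
    (hab : ((m : ℝ) + i + j) / 2 < a.re + b.re) {z : E m} (hz : z ≠ 0) {P : E m → ℂ}
    (hPm : Measurable P) {C : ℝ} (hP : ∀ x, ‖P x‖ ≤ C * (‖x‖ ^ i * ‖z - x‖ ^ j)) :
    Integrable fun x => P x * ((‖x‖ : ℂ) ^ (-2 * a) * (‖z - x‖ : ℂ) ^ (-2 * b)) := by
  have h := (integrable_norm_cpow_mul_norm_sub_cpow (a := a - i / 2) (b := b - j / 2)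
    (by simpa using ha) (by simpa using hb) (by simp; linarith) (by simp; linarith)
    (by simp; linarith) hz).norm.const_mul C
  refine Integrable.mono' h (hPm.mul (measurable_norm_cpow_mul _ _ z)).aestronglyMeasurable ?_
  filter_upwards [ae_ne_ne z] with x hx
  have hx1 := norm_pos_iff.mpr hx.1
  have hx2 := norm_pos_iff.mpr hx.2
  rw [norm_mul, norm_mul, norm_mul, Complex.norm_cpow_eq_rpow_re_of_pos hx1,
    Complex.norm_cpow_eq_rpow_re_of_pos hx1, Complex.norm_cpow_eq_rpow_re_of_pos hx2,
    Complex.norm_cpow_eq_rpow_re_of_pos hx2]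
  have e1 : ‖x‖ ^ (-2 * (a - i / 2)).re = ‖x‖ ^ i * ‖x‖ ^ (-2 * a).re := by
    rw [← Real.rpow_natCast, ← Real.rpow_add hx1]; congr 1; simp; ring
  have e2 : ‖z - x‖ ^ (-2 * (b - j / 2)).re = ‖z - x‖ ^ j * ‖z - x‖ ^ (-2 * b).re := by
    rw [← Real.rpow_natCast, ← Real.rpow_add hx2]; congr 1; simp; ring
  rw [e1, e2]
  calc _ ≤ (C * (‖x‖ ^ i * ‖z - x‖ ^ j)) * (‖x‖ ^ (-2 * a).re * ‖z - x‖ ^ (-2 * b).re) := by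
        gcongr; exact hP x
    _ = _ := by ring

theorem integral_norm_cpow_mul_norm_sub_cpow {m : ℕ} [NeZero m] {a b : ℂ} (ha : 0 < a.re)
    (hb : 0 < b.re) (ham : a.re < m / 2) (hbm : b.re < m / 2) (hab : (m : ℝ) / 2 < a.re + b.re)
    {z : E m} (hz : z ≠ 0) :
    ∫ x, (‖x‖ : ℂ) ^ (-2 * a) * (‖z - x‖ : ℂ) ^ (-2 * b) =
      (Real.pi : ℂ) ^ ((m : ℂ) / 2) * Complex.Gamma (a + b - m / 2) * Complex.Gamma (m / 2 - a) *
        Complex.Gamma (m / 2 - b) / (Complex.Gamma a * Complex.Gamma b * Complex.Gamma (m - a - b))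
        * (‖z‖ : ℂ) ^ (m - 2 * (a + b)) := by
  have h1 := integral_mul_norm_cpow ha hb z (P := fun _ => 1) (by fun_prop)
    (by simpa using integrable_norm_cpow_mul_norm_sub_cpow ha hb ham hbm hab hz)
  have h2 : ∀ v ∈ Ioi (0 : ℝ), ∫ x, 1 * feynman a b x (z - x) v = _ := fun v hv =>
    (integral_feynman_translate a b z (fun _ => 1) hv).trans (by
      simp only [one_mul]
      exact (integral_feynman_one (by simpa using hab) hz hv).2)
  have h3 := (beta_one (a := (m : ℂ) / 2 - b) (b := (m : ℂ) / 2 - a)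
        (by simpa using hbm) (by simpa using ham)).2
  rw [setIntegral_congr_fun measurableSet_Ioi h2] at h1
  simp only [one_mul] at h1
  rw [integral_const_mul, h3] at h1
  have hG : Complex.Gamma (a + b) ≠ 0 :=
    Complex.Gamma_ne_zero_of_re_pos (by simpa using add_pos ha hb)
  have e : (m : ℂ) / 2 - b + (m / 2 - a) = m - a - b := by ring
  rw [h1, e]
  field_simp

theorem integral_odd_eq_zero {m : ℕ} {f : E m → ℂ} (hf : ∀ x, f (-x) = -f x) : ∫ x, f x = 0 := by
  have h := integral_neg_eq_self f volume
  simp only [hf, integral_neg] at h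
  linear_combination (-1 / 2 : ℂ) * h

theorem linear_bound {m : ℕ} (ℓ : E m →ₗ[ℝ] ℂ) : ∃ C, ∀ x, ‖ℓ x‖ ≤ C * ‖x‖ :=
  ⟨‖LinearMap.toContinuousLinearMap ℓ‖, fun x => (LinearMap.toContinuousLinearMap ℓ).le_opNorm x⟩

theorem measurable_linear {m : ℕ} (ℓ : E m →ₗ[ℝ] ℂ) : Measurable ℓ :=
  (LinearMap.toContinuousLinearMap ℓ).continuous.measurable

theorem bilinear_bound {m : ℕ} (B : E m →ₗ[ℝ] E m →ₗ[ℝ] ℂ) :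
    ∃ C, ∀ x y, ‖B x y‖ ≤ C * (‖x‖ * ‖y‖) := by
  let B' : E m →L[ℝ] E m →L[ℝ] ℂ := LinearMap.toContinuousLinearMap
    ((LinearMap.toContinuousLinearMap : (E m →ₗ[ℝ] ℂ) ≃ₗ[ℝ] (E m →L[ℝ] ℂ)).toLinearMap ∘ₗ B)
  exact ⟨‖B'‖, fun x y => (B'.le_opNorm₂ x y).trans_eq (by ring)⟩

theorem measurable_bilinear_uncurry {m : ℕ} (B : E m →ₗ[ℝ] E m →ₗ[ℝ] ℂ) :
    Measurable fun p : E m × E m => B p.1 p.2 := by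
  let B' : E m →L[ℝ] E m →L[ℝ] ℂ := LinearMap.toContinuousLinearMap
    ((LinearMap.toContinuousLinearMap : (E m →ₗ[ℝ] ℂ) ≃ₗ[ℝ] (E m →L[ℝ] ℂ)).toLinearMap ∘ₗ B)
  have : Continuous fun p : E m × E m => B' p.1 p.2 := by fun_prop
  exact this.measurable

/-- After recentring, `ℓ (w + c z) = ℓ w + c ℓ z` with `c = v/(1+v)`. The first term is odd in `w`
and integrates to zero; the factor `c` of the second raises the Beta parameter `m/2 - a` by one. -/
theorem integral_linear_mul_norm_cpow {m : ℕ} [NeZero m] (ℓ : E m →ₗ[ℝ] ℂ) {a b : ℂ}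
    (ha : 1 / 2 < a.re)
    (hb : 0 < b.re) (ham : a.re < (m + 1) / 2) (hbm : b.re < m / 2)
    (hab : ((m : ℝ) + 1) / 2 < a.re + b.re) {z : E m} (hz : z ≠ 0) :
    ∫ x, ℓ x * ((‖x‖ : ℂ) ^ (-2 * a) * (‖z - x‖ : ℂ) ^ (-2 * b)) =
      (Real.pi : ℂ) ^ ((m : ℂ) / 2) * Complex.Gamma (a + b - m / 2) *
        Complex.Gamma (m / 2 - a + 1) * Complex.Gamma (m / 2 - b) /
        (Complex.Gamma a * Complex.Gamma b * Complex.Gamma (m - a - b + 1))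
        * ((‖z‖ : ℂ) ^ (m - 2 * (a + b)) * ℓ z) := by
  obtain ⟨C, hC⟩ := linear_bound ℓ
  have ha0 : 0 < a.re := by linarith
  have h1 := integral_mul_norm_cpow ha0 hb z (measurable_linear ℓ)
    (integrable_mul_norm_cpow 1 0 (by simpa using ha) (by simpa using hb) (by simpa using ham)
      (by simpa using hbm) (by simpa using hab) hz (measurable_linear ℓ) (by simpa using hC))
  have hab0 : (m : ℝ) / 2 < (a + b).re := by simp; linarith
  have h2 : ∀ v ∈ Ioi (0 : ℝ), ∫ x, ℓ x * feynman a b x (z - x) v =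
      (Real.pi : ℂ) ^ ((m : ℂ) / 2) * (Complex.Gamma (a + b - m / 2) / Complex.Gamma (a + b)) *
        (‖z‖ : ℂ) ^ (m - 2 * (a + b)) * ℓ z *
        ((v : ℂ) ^ ((m : ℂ) / 2 - a + 1 - 1) *
          ((1 + v : ℝ) : ℂ) ^ (-(((m : ℂ) / 2 - b) + ((m : ℂ) / 2 - a + 1)))) := by
    intro v hv
    have hv' : (0 : ℝ) < v := hv
    have hv0 : (v : ℂ) ≠ 0 := by exact_mod_cast hv'.ne'
    have h10 : ((1 + v : ℝ) : ℂ) ≠ 0 := by exact_mod_cast (by positivity : 0 < 1 + v).ne'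
    have h := integral_feynman_one (b := b) hab0 hz hv
    obtain ⟨hr, -⟩ := integrable_radial (m := m) 1 (n := a + b) (by simpa using hab) (p := 1 + v)
      (q := ‖z‖ ^ 2 * (v / (1 + v))) (by positivity)
      (by have := norm_pos_iff.mpr hz; positivity)
    rw [integral_feynman_translate a b z ℓ hv]
    set G : E m → ℂ := fun w =>
      ((‖z‖ ^ 2 * (v / (1 + v)) + (1 + v) * ‖w‖ ^ 2 : ℝ) : ℂ) ^ (-(a + b)) with hG
    have hGe : ∀ w, G (-w) = G w := fun w => by simp only [hG, norm_neg]
    have hGm : Measurable G := by fun_prop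
    have hodd : ∫ w, ℓ w * G w = 0 := integral_odd_eq_zero fun w => by
      rw [hGe, map_neg, neg_mul]
    have hoddi : Integrable fun w => ℓ w * G w := by
      refine Integrable.mono' (hr.norm.const_mul C)
        ((measurable_linear ℓ).mul hGm).aestronglyMeasurable (Eventually.of_forall fun w => ?_)
      rw [norm_mul, norm_mul, pow_one, Complex.norm_real, norm_norm, ← mul_assoc]
      gcongr
      exact hC w
    have e : ∀ w, ℓ (w + (v / (1 + v)) • z) * G w =
        ℓ w * G w + ((v / (1 + v) : ℝ) : ℂ) * ℓ z * G w := fun w => by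
      rw [map_add, map_smul, Complex.real_smul]; ring
    change (v : ℂ) ^ (b - 1) * ∫ w, ℓ (w + (v / (1 + v)) • z) * G w = _
    simp_rw [e]
    rw [integral_add hoddi (h.1.const_mul _), hodd, zero_add, integral_const_mul]
    have e1 : (v : ℂ) ^ ((m : ℂ) / 2 - a + 1 - 1) = (v : ℂ) * (v : ℂ) ^ ((m : ℂ) / 2 - a - 1) := by
      rw [show (m : ℂ) / 2 - a + 1 - 1 = 1 + ((m : ℂ) / 2 - a - 1) by ring,
        Complex.cpow_add _ _ hv0, Complex.cpow_one]
    have e2 : ((1 + v : ℝ) : ℂ) ^ (-(((m : ℂ) / 2 - b) + ((m : ℂ) / 2 - a + 1))) =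
        ((1 + v : ℝ) : ℂ) ^ (-(((m : ℂ) / 2 - b) + ((m : ℂ) / 2 - a))) / ((1 + v : ℝ) : ℂ) := by
      rw [show -(((m : ℂ) / 2 - b) + ((m : ℂ) / 2 - a + 1)) =
        -(((m : ℂ) / 2 - b) + ((m : ℂ) / 2 - a)) - 1 by ring, Complex.cpow_sub _ _ h10,
        Complex.cpow_one]
    rw [e1, e2]
    rw [Complex.ofReal_div]
    linear_combination (v : ℂ) / ((1 + v : ℝ) : ℂ) * ℓ z * h.2
  have h3 := (beta_one (a := (m : ℂ) / 2 - b) (b := (m : ℂ) / 2 - a + 1)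
        (by simpa using hbm) (by simp; linarith)).2
  rw [setIntegral_congr_fun measurableSet_Ioi h2, integral_const_mul, h3] at h1
  have hG : Complex.Gamma (a + b) ≠ 0 :=
    Complex.Gamma_ne_zero_of_re_pos (by simpa using add_pos ha0 hb)
  have e : (m : ℂ) / 2 - b + (m / 2 - a + 1) = m - a - b + 1 := by ring
  rw [h1, e]
  field_simp

/-- Recentring turns the weight into `B (w + c z) ((1-c) z - w)`. The mixed terms are odd in `w`, so
only the values of `B` on the diagonal survive. That is why the result depends on `B` through `κ`
alone; no symmetry of `B` is needed. -/
theorem integral_bilinear_mul_norm_cpow {m : ℕ} [NeZero m] (B : E m →ₗ[ℝ] E m →ₗ[ℝ] ℂ) {κ : ℂ}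
    (hB : ∀ x, B x x = -κ * ‖x‖ ^ 2) {a b : ℂ} (ha : 1 / 2 < a.re) (hb : 1 / 2 < b.re)
    (ham : a.re < (m + 1) / 2) (hbm : b.re < (m + 1) / 2)
    (hab : ((m : ℝ) + 2) / 2 < a.re + b.re) {z : E m} (hz : z ≠ 0) :
    ∫ x, B x (z - x) * ((‖x‖ : ℂ) ^ (-2 * a) * (‖z - x‖ : ℂ) ^ (-2 * b)) =
      κ * (Real.pi : ℂ) ^ ((m : ℂ) / 2) * Complex.Gamma (a + b - m / 2 - 1) *
        Complex.Gamma (m / 2 - a + 1) * Complex.Gamma (m / 2 - b + 1) /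
        (Complex.Gamma a * Complex.Gamma b * Complex.Gamma (m + 1 - a - b))
        * (‖z‖ : ℂ) ^ (m + 2 - 2 * (a + b)) := by
  obtain ⟨C, hC⟩ := bilinear_bound B
  have hz' := norm_pos_iff.mpr hz
  have hzc : (‖z‖ : ℂ) ≠ 0 := by exact_mod_cast hz'.ne'
  have hm0 : (0 : ℝ) < m := by exact_mod_cast Nat.pos_of_ne_zero (NeZero.ne m)
  have ha0 : 0 < a.re := by linarith
  have hb0 : 0 < b.re := by linarith
  have hPm : Measurable fun x => B x (z - x) :=
    (measurable_bilinear_uncurry B).comp (measurable_id.prodMk (measurable_const.sub measurable_id))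
  have h1 := integral_mul_norm_cpow ha0 hb0 z hPm
    (integrable_mul_norm_cpow 1 1 (by simpa using ha) (by simpa using hb) (by simpa using ham)
      (by simpa using hbm) (by push_cast; linarith) hz hPm (by simpa using fun x => hC x (z - x)))
  have hab0 : (m : ℝ) / 2 < (a + b).re := by simp; linarith
  have hGn : Complex.Gamma (a + b) ≠ 0 :=
    Complex.Gamma_ne_zero_of_re_pos (by simpa using add_pos ha0 hb0)
  have hGrec : Complex.Gamma (a + b - m / 2) =
      (a + b - m / 2 - 1) * Complex.Gamma (a + b - m / 2 - 1) := by
    rw [← Complex.Gamma_add_one]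
    · congr 1; ring
    · intro h0
      have := congrArg Complex.re h0
      simp at this
      linarith
  have hm2 : Complex.Gamma (((m : ℂ) + 2) / 2) = m / 2 * Complex.Gamma (m / 2) := by
    rw [← Complex.Gamma_add_one]
    · congr 1; ring
    · simpa using NeZero.ne m
  -- The surviving terms carry the same power `v/(1+v)²` relative to the unweighted case. The `‖w‖²`
  -- moment contributes `m/2` and the `B z z` term `-(a+b-m/2-1)`; their sum is the factor
  -- `m+1-a-b`, which later lowers `Γ(m+2-a-b)` to `Γ(m+1-a-b)`.
  have h2 : ∀ v ∈ Ioi (0 : ℝ), ∫ x, B x (z - x) * feynman a b x (z - x) v =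
      κ * (Real.pi : ℂ) ^ ((m : ℂ) / 2) * (Complex.Gamma (a + b - m / 2 - 1) /
        Complex.Gamma (a + b)) * (m + 1 - a - b) * (‖z‖ : ℂ) ^ (m + 2 - 2 * (a + b)) *
        ((v : ℂ) ^ ((m : ℂ) / 2 - a + 1 - 1) *
          ((1 + v : ℝ) : ℂ) ^ (-(((m : ℂ) / 2 - b + 1) + ((m : ℂ) / 2 - a + 1)))) := by
    intro v hv
    have hv' : (0 : ℝ) < v := hv
    have h1v : 0 < 1 + v := by positivity
    have hv0 : (v : ℂ) ≠ 0 := by exact_mod_cast hv'.ne'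
    have h10 : ((1 + v : ℝ) : ℂ) ≠ 0 := by exact_mod_cast h1v.ne'
    have h := integral_feynman_one (b := b) hab0 hz hv
    have hq : 0 < ‖z‖ ^ 2 * (v / (1 + v)) := by positivity
    obtain ⟨hr, -⟩ := integrable_radial (m := m) 1 (n := a + b) (by simp; linarith) h1v hq
    obtain ⟨hr2, hr2i⟩ := integrable_radial (m := m) 2 (n := a + b) (by simpa using hab) h1v hq
    rw [integral_feynman_translate a b z (fun x => B x (z - x)) hv]
    set G : E m → ℂ := fun w =>
      ((‖z‖ ^ 2 * (v / (1 + v)) + (1 + v) * ‖w‖ ^ 2 : ℝ) : ℂ) ^ (-(a + b)) with hG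
    have hGe : ∀ w, G (-w) = G w := fun w => by simp only [hG, norm_neg]
    have hGm : Measurable G := by fun_prop
    set c : ℝ := v / (1 + v) with hc
    -- All terms of first order in `w`, gathered into one linear form so that oddness disposes of
    -- them together.
    let ℓ : E m →ₗ[ℝ] ℂ := (1 - c) • B.flip z - c • B z
    obtain ⟨D, hD⟩ := linear_bound ℓ
    have hodd : ∫ w, ℓ w * G w = 0 := integral_odd_eq_zero fun w => by
      rw [hGe, map_neg, neg_mul]
    have hoddi : Integrable fun w => ℓ w * G w := by
      refine Integrable.mono' (hr.norm.const_mul D)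
        ((measurable_linear ℓ).mul hGm).aestronglyMeasurable (Eventually.of_forall fun w => ?_)
      rw [norm_mul, norm_mul, pow_one, Complex.norm_real, norm_norm, ← mul_assoc]
      gcongr
      exact hD w
    have e : ∀ w, B (w + c • z) (z - (w + c • z)) * G w =
        ℓ w * G w + (κ * ((‖w‖ : ℂ) ^ 2 * G w) -
          κ * ((c * (1 - c) : ℝ) : ℂ) * (‖z‖ : ℂ) ^ 2 * G w) := fun w => by
      have : z - (w + c • z) = (1 - c) • z - w := by rw [sub_smul, one_smul]; abel
      rw [this]
      simp only [map_add, map_sub, map_smul, LinearMap.add_apply, LinearMap.smul_apply, hB, ℓ,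
        LinearMap.sub_apply, LinearMap.flip_apply, Complex.real_smul]
      push_cast
      ring
    change (v : ℂ) ^ (b - 1) * ∫ w, B (w + c • z) (z - (w + c • z)) * G w = _
    simp_rw [e]
    have hr2' : Integrable fun w => κ * ((‖w‖ : ℂ) ^ 2 * G w) := hr2.const_mul κ
    have hr0' : Integrable fun w => κ * ((c * (1 - c) : ℝ) : ℂ) * (‖z‖ : ℂ) ^ 2 * G w :=
      h.1.const_mul _
    have hr20 : Integrable fun w => κ * ((‖w‖ : ℂ) ^ 2 * G w) -
      κ * ((c * (1 - c) : ℝ) : ℂ) * (‖z‖ : ℂ) ^ 2 * G w := hr2'.sub hr0'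
    rw [integral_add hoddi hr20, hodd, zero_add,
      integral_sub hr2' hr0', integral_const_mul, integral_const_mul,
      hr2i, cpow_feynman_scale hz' hv']
    have e1 : (v : ℂ) ^ ((m : ℂ) / 2 - a + 1 - 1) = (v : ℂ) * (v : ℂ) ^ ((m : ℂ) / 2 - a - 1) := by
      rw [show (m : ℂ) / 2 - a + 1 - 1 = 1 + ((m : ℂ) / 2 - a - 1) by ring,
        Complex.cpow_add _ _ hv0, Complex.cpow_one]
    have e2 : ((1 + v : ℝ) : ℂ) ^ (-(((m : ℂ) / 2 - b + 1) + ((m : ℂ) / 2 - a + 1))) =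
        ((1 + v : ℝ) : ℂ) ^ (-(((m : ℂ) / 2 - b) + ((m : ℂ) / 2 - a))) /
          ((1 + v : ℝ) : ℂ) ^ 2 := by
      rw [← Complex.cpow_natCast, ← Complex.cpow_sub _ _ h10]; congr 1; push_cast; ring
    have e3 : (v : ℂ) ^ (b - 1) * (v : ℂ) ^ (((m : ℂ) + (2 : ℕ)) / 2 - (a + b)) =
        (v : ℂ) * (v : ℂ) ^ ((m : ℂ) / 2 - a - 1) := by
      rw [← Complex.cpow_add _ _ hv0, ← e1]
      congr 1; push_cast; ring
    have e4 : ((1 + v : ℝ) : ℂ) ^ (-(((m : ℂ) + (2 : ℕ)) / 2 - (a + b))) *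
        ((1 + v : ℝ) : ℂ) ^ (-(((m : ℂ) + (2 : ℕ)) / 2)) =
        ((1 + v : ℝ) : ℂ) ^ (-(((m : ℂ) / 2 - b) + ((m : ℂ) / 2 - a))) /
          ((1 + v : ℝ) : ℂ) ^ 2 := by
      rw [← Complex.cpow_natCast, ← Complex.cpow_sub _ _ h10, ← Complex.cpow_add _ _ h10]; congr 1; push_cast; ring
    have e5 : (‖z‖ : ℂ) ^ ((m : ℂ) + 2 - 2 * (a + b)) =
        (‖z‖ : ℂ) ^ 2 * (‖z‖ : ℂ) ^ ((m : ℂ) - 2 * (a + b)) := by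
      rw [← Complex.cpow_natCast, ← Complex.cpow_add _ _ hzc]; congr 1; push_cast; ring
    have e6 : (2 : ℂ) * (((m : ℂ) + (2 : ℕ)) / 2 - (a + b)) = m + 2 - 2 * (a + b) := by
      push_cast; ring
    have hcc : ((c * (1 - c) : ℝ) : ℂ) = (v : ℂ) / ((1 + v : ℝ) : ℂ) ^ 2 := by
      have : c * (1 - c) = v / (1 + v) ^ 2 := by rw [hc]; field_simp; ring
      rw [this]; push_cast; ring
    have hGhalf := Gamma_half_dim_ne_zero m
    have e7 : (a + b - ((m : ℂ) + (2 : ℕ)) / 2) = a + b - m / 2 - 1 := by push_cast; ring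
    have e8 : ((m : ℂ) + (2 : ℕ)) / 2 = (m + 2) / 2 := by push_cast; ring
    have h22 := h.2
    rw [hGrec] at h22
    rw [e1, e2, e6, e7]
    set pv := ((1 + v : ℝ) : ℂ) ^ (-(((m : ℂ) / 2 - b) + ((m : ℂ) / 2 - a))) with hpv
    rw [hcc]
    calc _ = κ * ((Real.pi : ℂ) ^ ((m : ℂ) / 2) / Complex.Gamma (m / 2) *
          ((‖z‖ : ℂ) ^ ((m : ℂ) + 2 - 2 * (a + b)) *
          ((v : ℂ) ^ (b - 1) * (v : ℂ) ^ (((m : ℂ) + (2 : ℕ)) / 2 - (a + b))) *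
          (((1 + v : ℝ) : ℂ) ^ (-(((m : ℂ) + (2 : ℕ)) / 2 - (a + b))) *
            ((1 + v : ℝ) : ℂ) ^ (-(((m : ℂ) + (2 : ℕ)) / 2))) *
          (Complex.Gamma (((m : ℂ) + (2 : ℕ)) / 2) * Complex.Gamma (a + b - m / 2 - 1) /
            Complex.Gamma (a + b)))) - κ * ((v : ℂ) / ((1 + v : ℝ) : ℂ) ^ 2) * (‖z‖ : ℂ) ^ 2 *
          ((v : ℂ) ^ (b - 1) * ∫ w, G w) := by ring
      _ = _ := by
        rw [e3, e4, h22, e8, hm2, e5]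
        field_simp
        ring
  have h3 := (beta_one (a := (m : ℂ) / 2 - b + 1) (b := (m : ℂ) / 2 - a + 1)
        (by simp; linarith) (by simp; linarith)).2
  rw [setIntegral_congr_fun measurableSet_Ioi h2, integral_const_mul, h3] at h1
  have hne : (m : ℂ) + 1 - a - b ≠ 0 := by
    intro h0
    have := congrArg Complex.re h0
    simp at this
    linarith
  have e : (m : ℂ) / 2 - b + 1 + (m / 2 - a + 1) = m + 1 - a - b + 1 := by ring
  have hGl : Complex.Gamma ((m : ℂ) + 1 - a - b) ≠ 0 :=
    Complex.Gamma_ne_zero_of_re_pos (by simp; linarith)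
  rw [h1, e, Complex.Gamma_add_one _ hne]
  field_simp

end

/-! ### Weighted spherical means and polar coordinates -/

section

open Set Filter
open scoped Pointwise

/-- The surface measure of the unit sphere. -/
noncomputable abbrev sphereMeasure (m : ℕ) : Measure (Metric.sphere (0 : E m) 1) :=
  (volume : Measure (E m)).toSphere

/-- Spherical mean of `φ` with an angular weight `h`. -/
noncomputable def wMean {m : ℕ} (h : E m → ℂ) (φ : 𝓢(E m, ℂ)) (r : ℝ) : ℂ :=
  ∫ ω : Metric.sphere (0 : E m) 1, h ω * φ (r • (ω : E m)) ∂(sphereMeasure m)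

/-- The `j`-th coordinate as a complex valued function. -/
noncomputable def coord {m : ℕ} (j : Fin m) (x : E m) : ℂ := (x j : ℂ)

theorem sphMean_eq {m : ℕ} (φ : 𝓢(E m, ℂ)) : sphMean φ = wMean (fun _ => 1) φ := by
  ext r; simp [sphMean, wMean]

theorem sphMeanVec_eq {m : ℕ} (j : Fin m) (φ : 𝓢(E m, ℂ)) : sphMeanVec j φ = wMean (coord j) φ :=
  rfl

theorem continuous_coord {m : ℕ} (j : Fin m) : Continuous (coord j) := by
  unfold coord; fun_prop

theorem fderiv_eq_sum {m : ℕ} (φ : 𝓢(E m, ℂ)) (x v : E m) :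
    fderiv ℝ φ x v = ∑ j, coord j v * ∂_{EuclideanSpace.single j (1 : ℝ)} φ x := by
  conv_lhs => rw [← (EuclideanSpace.basisFun (Fin m) ℝ).sum_repr v]
  simp [SchwartzMap.lineDerivOp_apply_eq_fderiv, coord, Complex.real_smul]

theorem exists_weight_bound {m : ℕ} {h : E m → ℂ} (hh : Continuous h) :
    ∃ C, 0 ≤ C ∧ ∀ ω : Metric.sphere (0 : E m) 1, ‖h ω‖ ≤ C := by
  obtain ⟨C, hC⟩ := (isCompact_sphere (0 : E m) 1).exists_bound_of_continuousOn hh.continuousOn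
  exact ⟨max C 0, le_max_right _ _, fun ω => (hC ω ω.2).trans (le_max_left _ _)⟩

theorem integrable_wMean {m : ℕ} {h : E m → ℂ} (hh : Continuous h) (φ : 𝓢(E m, ℂ)) (r : ℝ) :
    Integrable (fun ω : Metric.sphere (0 : E m) 1 => h ω * φ (r • (ω : E m)))
      (sphereMeasure m) := by
  have hc : Continuous fun ω : Metric.sphere (0 : E m) 1 => h ω * φ (r • (ω : E m)) :=
    (hh.comp continuous_subtype_val).mul (φ.continuous.comp (by fun_prop))
  obtain ⟨C, hC0, hC⟩ := exists_weight_bound hh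
  obtain ⟨D, -, hD⟩ := φ.decay 0 0
  refine Integrable.of_bound hc.aestronglyMeasurable (C * D) (Eventually.of_forall fun ω => ?_)
  rw [norm_mul]
  have := hD (r • (ω : E m))
  simp only [pow_zero, norm_iteratedFDeriv_zero, one_mul] at this
  have h2 := hC ω
  gcongr

/-- Differentiation under the integral. The derivative is again a sum of weighted means, of partial
derivatives of `φ` with weights `h * coord j`; this closure is what lets smoothness be proved by
induction over all weights at once. -/
theorem hasDerivAt_wMean {m : ℕ} {h : E m → ℂ} (hh : Continuous h) (φ : 𝓢(E m, ℂ)) (r : ℝ) :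
    HasDerivAt (wMean h φ)
      (∑ j, wMean (fun x => h x * coord j x) (∂_{EuclideanSpace.single j (1 : ℝ)} φ) r) r := by
  obtain ⟨C, hC0, hC⟩ := exists_weight_bound hh
  obtain ⟨D, -, hD⟩ := φ.decay 0 1
  have hF'c : Continuous fun ω : Metric.sphere (0 : E m) 1 =>
      h ω * fderiv ℝ φ (r • (ω : E m)) ω := by
    have h1 : Continuous (fderiv ℝ φ) := (φ.smooth 1).continuous_fderiv (by norm_num)
    have h2 : Continuous fun ω : Metric.sphere (0 : E m) 1 => r • (ω : E m) := by fun_prop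
    exact (hh.comp continuous_subtype_val).mul ((h1.comp h2).clm_apply continuous_subtype_val)
  have key := hasDerivAt_integral_of_dominated_loc_of_deriv_le (μ := sphereMeasure m)
    (F := fun (r : ℝ) (ω : Metric.sphere (0 : E m) 1) => h ω * φ (r • (ω : E m)))
    (F' := fun r ω => h ω * fderiv ℝ φ (r • (ω : E m)) ω) (bound := fun _ => C * D)
    (x₀ := r) (s := univ) univ_mem
    (Eventually.of_forall fun r => (integrable_wMean hh φ r).aestronglyMeasurable)
    (integrable_wMean hh φ r) hF'c.aestronglyMeasurable
    (Eventually.of_forall fun ω x _ => by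
      have h1 := hD (x • (ω : E m))
      simp only [pow_zero, one_mul, norm_iteratedFDeriv_one] at h1
      have h2 : ‖fderiv ℝ φ (x • (ω : E m)) ω‖ ≤ D := by
        refine ((fderiv ℝ φ (x • (ω : E m))).le_opNorm _).trans ?_
        rw [norm_eq_of_mem_sphere, mul_one]
        exact h1
      rw [norm_mul]
      have h3 := hC ω
      gcongr)
    (integrable_const _)
    (Eventually.of_forall fun ω x _ => by
      have h1 : HasDerivAt (fun x : ℝ => x • (ω : E m)) (ω : E m) x := by
        simpa using (hasDerivAt_id x).smul_const (ω : E m)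
      exact ((φ.hasFDerivAt (x • (ω : E m))).comp_hasDerivAt x h1).const_mul (h ω))
  have e : ∫ ω : Metric.sphere (0 : E m) 1, h ω * fderiv ℝ φ (r • (ω : E m)) ω
      ∂(sphereMeasure m) =
      ∑ j, wMean (fun x => h x * coord j x) (∂_{EuclideanSpace.single j (1 : ℝ)} φ) r := by
    simp only [wMean]
    rw [← integral_finsetSum _ fun j _ => integrable_wMean (h := fun x => h x * coord j x)
      (hh.mul (continuous_coord j)) _ r]
    simp only [fderiv_eq_sum, Finset.mul_sum, mul_assoc]
  rw [← e]
  exact key.2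

theorem contDiff_wMean {m : ℕ} {h : E m → ℂ} (hh : Continuous h) (φ : 𝓢(E m, ℂ)) (n : ℕ) :
    ContDiff ℝ n (wMean h φ) := by
  induction n generalizing h φ with
  | zero =>
    simp only [Nat.cast_zero, contDiff_zero]
    exact continuous_iff_continuousAt.mpr fun r => (hasDerivAt_wMean hh φ r).continuousAt
  | succ n ih =>
    rw [Nat.cast_succ, contDiff_succ_iff_deriv]
    refine ⟨fun r => (hasDerivAt_wMean hh φ r).differentiableAt, by simp, ?_⟩
    have : deriv (wMean h φ) = fun r => ∑ j, wMean (fun x => h x * coord j x)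
        (∂_{EuclideanSpace.single j (1 : ℝ)} φ) r := by
      ext r; exact (hasDerivAt_wMean hh φ r).deriv
    rw [this]
    exact ContDiff.sum fun j _ => ih (hh.mul (continuous_coord j)) _

theorem wMean_decay {m : ℕ} {h : E m → ℂ} (hh : Continuous h) (φ : 𝓢(E m, ℂ)) (k : ℕ) :
    ∃ C, ∀ r, |r| ^ k * ‖wMean h φ r‖ ≤ C := by
  obtain ⟨C, hC0, hC⟩ := exists_weight_bound hh
  obtain ⟨D, -, hD⟩ := φ.decay k 0
  refine ⟨C * D * (sphereMeasure m).real univ, fun r => ?_⟩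
  have : (|r| ^ k : ℝ) * ‖wMean h φ r‖ = ‖∫ ω : Metric.sphere (0 : E m) 1,
      ((|r| ^ k : ℝ) : ℂ) * (h ω * φ (r • (ω : E m))) ∂(sphereMeasure m)‖ := by
    rw [integral_const_mul, norm_mul, wMean]; simp
  rw [this]
  refine norm_integral_le_of_norm_le_const (Eventually.of_forall fun ω => ?_)
  have h1 := hD (r • (ω : E m))
  rw [norm_iteratedFDeriv_zero, norm_smul, norm_eq_of_mem_sphere, mul_one, Real.norm_eq_abs] at h1
  have h2 := hC ω
  rw [norm_mul, norm_mul, Complex.norm_real, Real.norm_eq_abs, abs_of_nonneg (by positivity)]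
  calc |r| ^ k * (‖h ω‖ * ‖φ (r • (ω : E m))‖) = ‖h ω‖ * (|r| ^ k * ‖φ (r • (ω : E m))‖) := by ring
    _ ≤ C * D := by gcongr

/-- The surface measure of a set is a multiple of the volume of the cone over it, and volume is
invariant under negation. -/
theorem measurePreserving_neg_sphere (m : ℕ) :
    MeasurePreserving (fun ω : Metric.sphere (0 : E m) 1 => -ω) (sphereMeasure m)
      (sphereMeasure m) := by
  have hm : Measurable fun ω : Metric.sphere (0 : E m) 1 => -ω := by
    apply Continuous.measurable
    exact Continuous.subtype_mk (by fun_prop) _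
  refine ⟨hm, ?_⟩
  ext s hs
  rw [Measure.map_apply hm hs, Measure.toSphere_apply' _ (hm hs), Measure.toSphere_apply' _ hs]
  congr 1
  rw [← Measure.measure_neg volume (Ioo (0 : ℝ) 1 • (Subtype.val '' s : Set (E m)))]
  congr 1
  ext x
  simp only [Set.mem_smul, Set.mem_neg, Set.mem_image, Set.mem_preimage]
  constructor
  · rintro ⟨r, hr, _, ⟨y, hy, rfl⟩, rfl⟩
    exact ⟨r, hr, _, ⟨-y, hy, rfl⟩, by simp⟩
  · rintro ⟨r, hr, _, ⟨y, hy, rfl⟩, e⟩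
    exact ⟨r, hr, _, ⟨-y, by simpa using hy, rfl⟩, by simp [e]⟩

/-- The parity of the mean in `r` is the parity of its weight, whatever `φ` is. Hence the means for
`T` are even and those for `U` are odd. -/
theorem wMean_neg {m : ℕ} (h : E m → ℂ) (φ : 𝓢(E m, ℂ)) (r : ℝ) :
    wMean h φ (-r) = wMean (fun x => h (-x)) φ r := by
  have hemb : MeasurableEmbedding fun ω : Metric.sphere (0 : E m) 1 => -ω :=
    (Homeomorph.mk (Equiv.neg _) (Continuous.subtype_mk (by fun_prop) _)
      (Continuous.subtype_mk (by fun_prop) _)).measurableEmbedding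
  have := (measurePreserving_neg_sphere m).integral_comp hemb
    (fun ω : Metric.sphere (0 : E m) 1 => h ω * φ (-r • (ω : E m)))
  simp only [wMean, ← this]
  simp

theorem integral_polar {m : ℕ} [NeZero m] {F : E m → ℂ} (hF : Integrable F) :
    ∫ x, F x = ∫ r in Ioi (0 : ℝ), ((r : ℂ) ^ (m - 1)) *
      ∫ ω : Metric.sphere (0 : E m) 1, F (r • (ω : E m)) ∂(sphereMeasure m) := by
  have hmp := (volume : Measure (E m)).measurePreserving_homeomorphUnitSphereProd
  have hme := (homeomorphUnitSphereProd (E m)).measurableEmbedding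
  set G : Metric.sphere (0 : E m) 1 × Ioi (0 : ℝ) → ℂ := fun p => F ((p.2 : ℝ) • (p.1 : E m)) with hG
  have hcomp : ∀ x : ({0}ᶜ : Set (E m)), G (homeomorphUnitSphereProd (E m) x) = F x := by
    intro x
    have hx : ‖(x : E m)‖ ≠ 0 := norm_ne_zero_iff.mpr x.2
    simp [hG, smul_smul, hx]
  have hint : Integrable G ((sphereMeasure m).prod
      (Measure.volumeIoiPow (Module.finrank ℝ (E m) - 1))) := by
    rw [← hmp.integrable_comp_emb hme]
    have : Integrable (F ∘ (Subtype.val : ({0}ᶜ : Set (E m)) → E m)) (Measure.comap Subtype.val volume) := by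
      rw [← integrableOn_iff_comap_subtypeVal (f := F) (measurableSet_singleton _).compl]
      exact hF.integrableOn
    refine this.congr (Eventually.of_forall fun x => ?_)
    exact (hcomp x).symm
  calc ∫ x, F x = ∫ x : ({(0)}ᶜ : Set (E m)), F x ∂(Measure.comap Subtype.val volume) := by
        rw [integral_subtype_comap (measurableSet_singleton _).compl F,
          restrict_compl_singleton]
    _ = ∫ x : ({(0)}ᶜ : Set (E m)), G (homeomorphUnitSphereProd (E m) x)
        ∂(Measure.comap Subtype.val volume) := by simp_rw [hcomp]
    _ = ∫ r : Ioi (0 : ℝ), ∫ ω, G (ω, r) ∂(sphereMeasure m)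
        ∂(Measure.volumeIoiPow (Module.finrank ℝ (E m) - 1)) := by
      rw [hmp.integral_comp hme, integral_prod_symm _ hint]
    _ = _ := by
      simp only [Measure.volumeIoiPow, ENNReal.ofReal]
      rw [integral_withDensity_eq_integral_smul
        (measurable_subtype_coe.pow_const _).real_toNNReal,
        integral_subtype_comap measurableSet_Ioi fun a => Real.toNNReal
          (a ^ (Module.finrank ℝ (E m) - 1)) •
          ∫ ω : Metric.sphere (0 : E m) 1, F (a • (ω : E m)) ∂(sphereMeasure m)]
      refine setIntegral_congr_fun measurableSet_Ioi fun x hx => ?_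
      simp only [finrank_euclideanSpace, Fintype.card_fin]
      rw [NNReal.smul_def, Real.coe_toNNReal _ (pow_nonneg hx.out.le _), Complex.real_smul]
      push_cast
      rfl

/-- Rapid decay bounds the integrand by `‖x‖^(Re lam) (1+‖x‖)^(-(m + Re lam + 1))`, whose radial
integral is a Beta integral with parameters `1` and `m + Re lam`. -/
theorem integrable_norm_cpow_mul_schwartz {m : ℕ} [NeZero m] {lam : ℂ} (hl : -(m : ℝ) < lam.re)
    (φ : 𝓢(E m, ℂ)) : Integrable fun x => (‖x‖ : ℂ) ^ lam * φ x := by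
  have hm1 : 1 ≤ m := Nat.one_le_iff_ne_zero.mpr (NeZero.ne m)
  obtain ⟨k, hk⟩ := exists_nat_ge ((m : ℝ) + lam.re + 1)
  set C : ℝ := 2 ^ k * ((Finset.Iic (k, 0)).sup fun m_1 => SchwartzMap.seminorm ℝ m_1.1 m_1.2) φ
    with hC
  have hb : ∀ x : E m, (1 + ‖x‖) ^ k * ‖φ x‖ ≤ C := fun x => by
    simpa using SchwartzMap.one_add_le_sup_seminorm_apply (𝕜 := ℝ) (m := (k, 0)) le_rfl le_rfl φ x
  have hI : IntegrableOn (fun v : ℝ => v ^ (m - 1) • (v ^ lam.re * (1 + v) ^ (-(m + lam.re + 1))))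
      (Ioi 0) := by
    have h1 := (beta_one (a := 1) (b := (m + lam.re : ℝ)) (by simp) (by
      rw [Complex.ofReal_re]; linarith)).1.re
    refine IntegrableOn.congr_fun h1 (fun v hv => ?_) measurableSet_Ioi
    have hv' : (0 : ℝ) < v := hv
    have e1 : (v : ℂ) ^ (((m + lam.re : ℝ) : ℂ) - 1) = ((v ^ (m + lam.re - 1) : ℝ) : ℂ) := by
      rw [Complex.ofReal_cpow hv'.le]; push_cast; rfl
    have e2 : ((1 + v : ℝ) : ℂ) ^ (-(1 + ((m + lam.re : ℝ) : ℂ))) =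
        (((1 + v) ^ (-(m + lam.re + 1)) : ℝ) : ℂ) := by
      rw [Complex.ofReal_cpow (by positivity)]; push_cast; ring_nf
    have e3 : v ^ ((m : ℝ) + lam.re - 1) = v ^ (m - 1) * v ^ lam.re := by
      rw [← Real.rpow_natCast, ← Real.rpow_add hv', Nat.cast_sub hm1]; congr 1; push_cast; ring
    simp only [e1, e2, ← Complex.ofReal_mul, RCLike.re_to_complex, Complex.ofReal_re, e3, smul_eq_mul]
    ring
  have hI2 : Integrable fun x : E m => ‖x‖ ^ lam.re * (1 + ‖x‖) ^ (-(m + lam.re + 1)) := by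
    rw [integrable_fun_norm_addHaar volume
      (f := fun v : ℝ => v ^ lam.re * (1 + v) ^ (-(m + lam.re + 1)))]
    simpa using hI
  refine Integrable.mono' (hI2.const_mul C) ?_ ?_
  · have h1 : Measurable fun x : E m => (‖x‖ : ℂ) ^ lam := by fun_prop
    exact (h1.mul φ.continuous.measurable).aestronglyMeasurable
  · filter_upwards [ae_ne_ne 0] with x hx
    have hx' := norm_pos_iff.mpr hx.1
    have h1x : 1 ≤ 1 + ‖x‖ := by linarith
    rw [norm_mul, Complex.norm_cpow_eq_rpow_re_of_pos hx']
    have h2 : ‖φ x‖ ≤ C * (1 + ‖x‖) ^ (-(m + lam.re + 1)) := by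
      rw [Real.rpow_neg (by positivity), ← div_eq_mul_inv, le_div_iff₀ (by positivity)]
      refine le_trans ?_ (hb x)
      rw [mul_comm]
      gcongr
      rw [← Real.rpow_natCast]
      exact Real.rpow_le_rpow_of_exponent_le h1x hk
    calc ‖x‖ ^ lam.re * ‖φ x‖ ≤ ‖x‖ ^ lam.re * (C * (1 + ‖x‖) ^ (-(m + lam.re + 1))) := by gcongr
      _ = _ := by ring

end

/-! ### Finite parts by Mellin transform, and cancellation of their poles -/

section

open Set Filter
open scoped Topology

/-- Smooth functions on the line all of whose moments are bounded. -/
structure RapidSmooth (f : ℝ → ℂ) : Prop where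
  smooth : ∀ n : ℕ, ContDiff ℝ n f
  decay : ∀ k : ℕ, ∃ C, ∀ r, |r| ^ k * ‖f r‖ ≤ C

/-- The Taylor coefficients at `0`. -/
noncomputable def taylorCoeff (f : ℝ → ℂ) (k : ℕ) : ℂ := iteratedDeriv k f 0 / (k.factorial : ℂ)

/-- `f` minus the cutoff to `(0, 1]` of its Taylor polynomial with `N` terms. -/
noncomputable def taylorRem (f : ℝ → ℂ) (N : ℕ) (r : ℝ) : ℂ :=
  f r - (Ioc (0 : ℝ) 1).indicator
    (fun r : ℝ => ∑ k ∈ Finset.range N, taylorCoeff f k * (r : ℂ) ^ k) r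

variable {f : ℝ → ℂ}

theorem RapidSmooth.taylor_bound (hf : RapidSmooth f) (N : ℕ) :
    ∃ C, ∀ r ∈ Ioc (0 : ℝ) 1, ‖taylorRem f N r‖ ≤ C * r ^ N := by
  cases N with
  | zero =>
    obtain ⟨C, hC⟩ := hf.decay 0
    refine ⟨C, fun r _ => ?_⟩
    simpa [taylorRem] using hC r
  | succ n =>
    obtain ⟨C, hC⟩ := exists_taylor_mean_remainder_bound (f := f) (a := 0) (b := 1) (n := n)
      zero_le_one (by exact_mod_cast (hf.smooth (n + 1)).contDiffOn)
    refine ⟨C, fun r hr => ?_⟩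
    have h := hC r ⟨hr.1.le, hr.2⟩
    rw [taylor_within_apply] at h
    rw [taylorRem, indicator_of_mem hr]
    refine le_trans (le_of_eq ?_) (h.trans (by simp))
    congr 2
    refine Finset.sum_congr rfl fun k _ => ?_
    rw [iteratedDerivWithin_eq_iteratedDeriv (uniqueDiffOn_Icc zero_lt_one)
      (hf.smooth k).contDiffAt ⟨le_rfl, zero_le_one⟩, taylorCoeff, Complex.real_smul]
    push_cast
    rw [sub_zero]
    ring

theorem RapidSmooth.taylorRem_isBigO_zero (hf : RapidSmooth f) (N : ℕ) :
    taylorRem f N =O[𝓝[>] 0] (fun r : ℝ => r ^ (-(-(N : ℝ)))) := by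
  obtain ⟨C, hC⟩ := hf.taylor_bound N
  refine Asymptotics.IsBigO.of_bound C ?_
  filter_upwards [Ioc_mem_nhdsGT (zero_lt_one (α := ℝ))] with r hr
  rw [neg_neg, Real.rpow_natCast, Real.norm_of_nonneg (pow_nonneg hr.1.le _)]
  exact hC r hr

theorem RapidSmooth.taylorRem_isBigO_atTop (hf : RapidSmooth f) (N k : ℕ) :
    taylorRem f N =O[atTop] (fun r : ℝ => r ^ (-(k : ℝ))) := by
  obtain ⟨C, hC⟩ := hf.decay k
  refine Asymptotics.IsBigO.of_bound C ?_
  filter_upwards [Ioi_mem_atTop (1 : ℝ)] with r hr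
  have hr' : (1 : ℝ) < r := hr
  have hr0 : (0 : ℝ) < r := by linarith
  rw [taylorRem, indicator_of_notMem (fun h => not_lt.mpr h.2 hr'), sub_zero, Real.rpow_neg hr0.le,
    Real.rpow_natCast, Real.norm_of_nonneg (by positivity), ← div_eq_mul_inv,
    le_div_iff₀ (by positivity)]
  have := hC r
  rw [abs_of_pos hr0] at this
  linarith

theorem RapidSmooth.continuous (hf : RapidSmooth f) : Continuous f := (hf.smooth 0).continuous

theorem RapidSmooth.locallyIntegrable_taylorRem (hf : RapidSmooth f) (N : ℕ) :
    LocallyIntegrable (taylorRem f N) := by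
  refine hf.continuous.locallyIntegrable.sub (Integrable.locallyIntegrable ?_)
  rw [integrable_indicator_iff measurableSet_Ioc]
  have : Continuous fun r : ℝ => ∑ k ∈ Finset.range N, taylorCoeff f k * (r : ℂ) ^ k := by fun_prop
  exact (this.continuousOn.integrableOn_compact isCompact_Icc).mono_set Ioc_subset_Icc_self

theorem RapidSmooth.mellinConvergent (hf : RapidSmooth f) {N : ℕ} {s : ℂ}
    (hs : -(N : ℝ) - 1 < s.re) : MellinConvergent (taylorRem f N) (s + 1) := by
  obtain ⟨k, hk⟩ := exists_nat_gt (s + 1).re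
  exact mellinConvergent_of_isBigO_rpow ((hf.locallyIntegrable_taylorRem N).locallyIntegrableOn _)
    (hf.taylorRem_isBigO_atTop N k) hk (hf.taylorRem_isBigO_zero N) (by simp; linarith)

theorem RapidSmooth.differentiableAt_mellin (hf : RapidSmooth f) {N : ℕ} {s : ℂ}
    (hs : -(N : ℝ) - 1 < s.re) : DifferentiableAt ℂ (mellin (taylorRem f N)) (s + 1) := by
  obtain ⟨k, hk⟩ := exists_nat_gt (s + 1).re
  exact mellin_differentiableAt_of_isBigO_rpow
    ((hf.locallyIntegrable_taylorRem N).locallyIntegrableOn _)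
    (hf.taylorRem_isBigO_atTop N k) hk (hf.taylorRem_isBigO_zero N) (by simp; linarith)

/-- Because the Taylor polynomial is cut off at `1`, the two integrals of the finite part form a
single Mellin transform, whose holomorphy then follows from decay at `0` and at infinity. -/
theorem RapidSmooth.mellin_split (hf : RapidSmooth f) {N : ℕ} {s : ℂ}
    (hs : -(N : ℝ) - 1 < s.re) : mellin (taylorRem f N) (s + 1) =
      (∫ r in Ioc (0 : ℝ) 1, (r : ℂ) ^ s *
        (f r - ∑ k ∈ Finset.range N, iteratedDeriv k f 0 / (k.factorial : ℂ) * (r : ℂ) ^ k)) +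
      ∫ r in Ioi (1 : ℝ), (r : ℂ) ^ s * f r := by
  have h := hf.mellinConvergent hs
  rw [MellinConvergent, ← Ioc_union_Ioi_eq_Ioi zero_le_one] at h
  rw [mellin, ← Ioc_union_Ioi_eq_Ioi zero_le_one,
    setIntegral_union (Ioc_disjoint_Ioi le_rfl) measurableSet_Ioi h.left_of_union h.right_of_union]
  congr 1
  · refine setIntegral_congr_fun measurableSet_Ioc fun r hr => ?_
    simp [taylorRem, indicator_of_mem hr, taylorCoeff]
  · refine setIntegral_congr_fun measurableSet_Ioi fun r hr => ?_
    have : r ∉ Ioc (0 : ℝ) 1 := fun h => not_lt.mpr h.2 hr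
    simp [taylorRem, indicator_of_notMem this]

/-- The finite part computed with `N` Taylor terms. -/
noncomputable def finitePartTrunc (f : ℝ → ℂ) (N : ℕ) (s : ℂ) : ℂ :=
  mellin (taylorRem f N) (s + 1) + ∑ k ∈ Finset.range N, taylorCoeff f k * (1 / (s + k + 1))

theorem integral_Ioc_cpow_mul_pow {s : ℂ} {N : ℕ} (hs : -(N : ℝ) - 1 < s.re) :
    ∫ r in Ioc (0 : ℝ) 1, (r : ℂ) ^ s * (r : ℂ) ^ N = 1 / (s + N + 1) := by
  have hre : 0 < (s + N + 1).re := by simp; linarith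
  have hne : s + N + 1 ≠ 0 := fun h => by rw [h] at hre; simp at hre
  have h1 : ∀ r ∈ Ioc (0 : ℝ) 1, (r : ℂ) ^ s * (r : ℂ) ^ N = (r : ℂ) ^ (s + N) := fun r hr => by
    rw [Complex.cpow_add _ _ (by exact_mod_cast hr.1.ne'), Complex.cpow_natCast]
  rw [setIntegral_congr_fun measurableSet_Ioc h1, ← intervalIntegral.integral_of_le zero_le_one,
    integral_cpow (Or.inl (by simp; linarith))]
  simp [Complex.zero_cpow hne]

/-- One more subtracted Taylor term removes `∫₀¹ r^(s+N) dr = 1/(s+N+1)` times its coefficient from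
the integral, which is exactly what the sum gains. -/
theorem RapidSmooth.finitePartTrunc_succ (hf : RapidSmooth f) {N : ℕ} {s : ℂ}
    (hs : -(N : ℝ) - 1 < s.re) : finitePartTrunc f N s = finitePartTrunc f (N + 1) s := by
  have hs' : -((N + 1 : ℕ) : ℝ) - 1 < s.re := by push_cast; linarith
  have h1 := hf.mellinConvergent hs
  have h2 := hf.mellinConvergent hs'
  have key : mellin (taylorRem f N) (s + 1) - mellin (taylorRem f (N + 1)) (s + 1) =
      taylorCoeff f N * (1 / (s + N + 1)) := by
    rw [mellin, mellin, ← integral_sub h1 h2, ← integral_Ioc_cpow_mul_pow hs, ← integral_const_mul]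
    have : ∀ r ∈ Ioi (0 : ℝ), (r : ℂ) ^ (s + 1 - 1) • taylorRem f N r -
        (r : ℂ) ^ (s + 1 - 1) • taylorRem f (N + 1) r =
        (Ioc (0 : ℝ) 1).indicator (fun r : ℝ => taylorCoeff f N * ((r : ℂ) ^ s * (r : ℂ) ^ N)) r := by
      intro r hr
      by_cases h : r ∈ Ioc (0 : ℝ) 1
      · simp only [taylorRem, indicator_of_mem h, Finset.sum_range_succ, smul_eq_mul,
          add_sub_cancel_right]
        ring
      · simp [taylorRem, indicator_of_notMem h]
    rw [setIntegral_congr_fun measurableSet_Ioi this, setIntegral_indicator measurableSet_Ioc]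
    congr 2
    exact inter_eq_right.mpr Ioc_subset_Ioi_self
  rw [finitePartTrunc, finitePartTrunc, Finset.sum_range_succ]
  linear_combination key

/-- The floor in `finitePart` is the least admissible number of terms and jumps with `s`. Allowing
any larger number makes it possible to keep it fixed near a given point, as analyticity requires. -/
theorem RapidSmooth.finitePart_eq_trunc (hf : RapidSmooth f) {M : ℕ} {s : ℂ}
    (hs : -(M : ℝ) - 1 < s.re) : finitePart s f = finitePartTrunc f M s := by
  have hN : -((⌊-s.re⌋₊ : ℕ) : ℝ) - 1 < s.re := by
    have := Nat.lt_floor_add_one (-s.re); linarith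
  have h0 : finitePart s f = finitePartTrunc f ⌊-s.re⌋₊ s := by
    rw [finitePartTrunc, hf.mellin_split hN]
    rfl
  have hle : ⌊-s.re⌋₊ ≤ M := by
    by_contra h
    push Not at h
    have h1 : (M : ℝ) + 1 ≤ -s.re := by
      have : M + 1 ≤ ⌊-s.re⌋₊ := h
      have := (Nat.le_floor_iff' (by omega)).mp this
      exact_mod_cast this
    linarith
  rw [h0]
  induction M, hle using Nat.le_induction with
  | base => rfl
  | succ n hn ih =>
    have hn' : (⌊-s.re⌋₊ : ℝ) ≤ n := by exact_mod_cast hn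
    have : -(n : ℝ) - 1 < s.re := by linarith
    rw [ih this, hf.finitePartTrunc_succ this]

/-- The entire function `1 / ((w + l) Γ(w))`. -/
noncomputable def gammaResidue (l : ℕ) (w : ℂ) : ℂ :=
  (∏ j ∈ Finset.range l, (w + j)) * (Complex.Gamma (w + l + 1))⁻¹

/-- Telescoping of `1/Γ(w) = w/Γ(w+1)`. It holds at the poles too: there `Γ` takes the value `0`,
and its inverse `0` is the correct value of the entire function `1/Γ`. -/
theorem add_mul_gammaResidue (l : ℕ) (w : ℂ) : (w + l) * gammaResidue l w = (Complex.Gamma w)⁻¹ := by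
  induction l with
  | zero =>
    have := Complex.one_div_Gamma_eq_self_mul_one_div_Gamma_add_one w
    simp [gammaResidue, this]
  | succ l ih =>
    have := Complex.one_div_Gamma_eq_self_mul_one_div_Gamma_add_one (w + l + 1)
    rw [← ih, gammaResidue, gammaResidue, Finset.prod_range_succ, this]
    push_cast
    ring_nf

theorem differentiable_gammaResidue (l : ℕ) : Differentiable ℂ (gammaResidue l) := by
  have h1 : Differentiable ℂ fun w : ℂ => (Complex.Gamma (w + l + 1))⁻¹ :=
    Complex.differentiable_one_div_Gamma.comp (f := fun w : ℂ => w + l + 1) (by fun_prop)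
  have h2 : Differentiable ℂ fun w : ℂ => ∏ j ∈ Finset.range l, (w + j) := by fun_prop
  exact h2.mul h1

theorem gammaResidue_neg_self (l : ℕ) : gammaResidue l (-l) = (-1) ^ l * (l.factorial : ℂ) := by
  rw [gammaResidue, neg_add_cancel, zero_add, Complex.Gamma_one, inv_one, mul_one]
  rw [← Finset.prod_range_reflect, ← Finset.prod_range_add_one_eq_factorial]
  push_cast
  rw [← Finset.card_range l, ← Finset.prod_const, Finset.card_range, ← Finset.prod_mul_distrib]
  refine Finset.prod_congr rfl fun j hj => ?_
  have : j + 1 ≤ l := Finset.mem_range.mp hj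
  rw [Nat.sub_sub, add_comm 1 j, Nat.cast_sub this]
  push_cast
  ring

theorem gammaResidue_neg_of_ne {l n : ℕ} (h : l ≠ n) : gammaResidue l (-n) = 0 := by
  have h1 := add_mul_gammaResidue l (-n)
  rw [Complex.Gamma_neg_nat_eq_zero, inv_zero, mul_eq_zero] at h1
  refine h1.resolve_left fun h2 => h ?_
  have : (l : ℂ) = n := by linear_combination h2
  exact_mod_cast this

open Classical in
/-- `finitePart (2 w - 1 - p) f / Γ(w)`, with the limit values at the poles of `Γ`. -/
noncomputable def normalizedFinitePart (p : ℕ) (f : ℝ → ℂ) (w : ℂ) : ℂ :=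
  if h : ∃ l : ℕ, w = -l then
    (-1) ^ h.choose * (h.choose.factorial : ℂ) * taylorCoeff f (2 * h.choose + p) / 2
  else finitePart (2 * w - 1 - p) f / Complex.Gamma w

theorem normalizedFinitePart_neg (p : ℕ) (f : ℝ → ℂ) (l : ℕ) :
    normalizedFinitePart p f (-l) =
      (-1) ^ l * (l.factorial : ℂ) * taylorCoeff f (2 * l + p) / 2 := by
  have h : ∃ l' : ℕ, (-(l : ℂ)) = -l' := ⟨l, rfl⟩
  have e : h.choose = l := by
    have := h.choose_spec
    exact_mod_cast (neg_injective this).symm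
  rw [normalizedFinitePart, dif_pos h, e]

theorem normalizedFinitePart_of_ne (p : ℕ) (f : ℝ → ℂ) {w : ℂ} (hw : ∀ l : ℕ, w ≠ -l) :
    normalizedFinitePart p f w = finitePart (2 * w - 1 - p) f / Complex.Gamma w := by
  rw [normalizedFinitePart, dif_neg (by simpa using hw)]

/-- Vanishing of the Taylor coefficients of order less than `p` or of order `p + 1, p + 3, …`. -/
def TaylorParity (p : ℕ) (f : ℝ → ℂ) : Prop :=
  (∀ k < p, taylorCoeff f k = 0) ∧ ∀ l, taylorCoeff f (2 * l + p + 1) = 0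

theorem TaylorParity.sum_eq {p : ℕ} (hp : TaylorParity p f) (M : ℕ) (w : ℂ) :
    ∑ k ∈ Finset.range (2 * M + p), taylorCoeff f k * (1 / (2 * w - 1 - p + k + 1)) =
      ∑ l ∈ Finset.range M, taylorCoeff f (2 * l + p) / 2 * (1 / (w + l)) := by
  induction M with
  | zero =>
    simp only [mul_zero, zero_add, Finset.range_zero, Finset.sum_empty]
    exact Finset.sum_eq_zero fun k hk => by rw [hp.1 k (Finset.mem_range.mp hk), zero_mul]
  | succ M ih =>
    rw [show 2 * (M + 1) + p = 2 * M + p + 1 + 1 by ring, Finset.sum_range_succ,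
      Finset.sum_range_succ, ih, hp.2, Finset.sum_range_succ, zero_mul, add_zero]
    congr 1
    push_cast
    rw [show 2 * w - 1 - p + (2 * M + p) + 1 = 2 * (w + M) by ring, one_div, mul_inv]
    ring

/-- By parity only the terms `k = 2l + p` occur, with denominators `2(w+l)`, and `gammaResidue`
absorbs each into `1/Γ(w)`. The right-hand side is visibly holomorphic for `Re w > -M`, also across
the points where the left-hand side is defined by a Taylor coefficient. -/
theorem RapidSmooth.normalizedFinitePart_eq {p : ℕ} (hf : RapidSmooth f) (hp : TaylorParity p f)
    {M : ℕ} {w : ℂ} (hw : -(M : ℝ) < w.re) :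
    normalizedFinitePart p f w =
      (Complex.Gamma w)⁻¹ * mellin (taylorRem f (2 * M + p)) (2 * w - 1 - p + 1) +
        ∑ l ∈ Finset.range M, taylorCoeff f (2 * l + p) / 2 * gammaResidue l w := by
  by_cases h : ∃ n : ℕ, w = -n
  -- At `w = -n` the factor `1/Γ` kills the Mellin term and every `gammaResidue l` with `l ≠ n`; the
  -- remaining one is `(-1)^n n!`, the reciprocal of the residue of `Γ`.
  · obtain ⟨n, rfl⟩ := h
    have hn : n < M := by
      simp only [Complex.neg_re, Complex.natCast_re, neg_lt_neg_iff] at hw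
      exact_mod_cast hw
    rw [normalizedFinitePart_neg, Complex.Gamma_neg_nat_eq_zero, inv_zero, zero_mul, zero_add,
      Finset.sum_eq_single_of_mem n (Finset.mem_range.mpr hn)
        fun l _ hl => by rw [gammaResidue_neg_of_ne hl, mul_zero], gammaResidue_neg_self]
    ring
  · push Not at h
    have hs : -((2 * M + p : ℕ) : ℝ) - 1 < (2 * w - 1 - p).re := by
      push_cast; simp; linarith
    rw [normalizedFinitePart_of_ne p f h, hf.finitePart_eq_trunc hs, finitePartTrunc,
      hp.sum_eq M w, div_eq_inv_mul, mul_add, Finset.mul_sum]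
    congr 1
    refine Finset.sum_congr rfl fun l _ => ?_
    have hne : w + l ≠ 0 := fun h0 => h l (by linear_combination h0)
    rw [← add_mul_gammaResidue l w]
    field_simp

theorem RapidSmooth.differentiable_normalizedFinitePart {p : ℕ} (hf : RapidSmooth f)
    (hp : TaylorParity p f) : Differentiable ℂ (normalizedFinitePart p f) := by
  intro w
  obtain ⟨M, hM⟩ := exists_nat_gt (-w.re)
  have hM' : -(M : ℝ) < w.re := by linarith
  have hev : normalizedFinitePart p f =ᶠ[𝓝 w] fun w =>
      (Complex.Gamma w)⁻¹ * mellin (taylorRem f (2 * M + p)) (2 * w - 1 - p + 1) +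
        ∑ l ∈ Finset.range M, taylorCoeff f (2 * l + p) / 2 * gammaResidue l w := by
    filter_upwards [(isOpen_lt continuous_const Complex.continuous_re).mem_nhds hM'] with w' hw'
    exact hf.normalizedFinitePart_eq hp hw'
  refine DifferentiableAt.congr_of_eventuallyEq ?_ hev
  refine DifferentiableAt.add (DifferentiableAt.mul (Complex.differentiable_one_div_Gamma w) ?_) ?_
  · have h1 := hf.differentiableAt_mellin (N := 2 * M + p) (s := 2 * w - 1 - p)
      (by push_cast; simp; linarith)
    exact DifferentiableAt.comp (f := fun w : ℂ => 2 * w - 1 - p + 1) w h1 (by fun_prop)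
  · exact DifferentiableAt.fun_sum fun l _ => (differentiable_gammaResidue l w).const_mul _

theorem taylorCoeff_eq_zero_of_parity {ε : ℂ} (hε : ∀ r, f (-r) = ε * f r) {k : ℕ}
    (hk : ε * (-1) ^ k = -1) : taylorCoeff f k = 0 := by
  have h1 := iteratedDeriv_comp_neg k f 0
  have h2 : iteratedDeriv k (fun x => f (-x)) 0 = ε * iteratedDeriv k f 0 := by
    simp_rw [hε]
    exact iteratedDeriv_const_mul_field ε f
  rw [h2, neg_zero] at h1
  have h3 : iteratedDeriv k f 0 = 0 := by
    have h4 : ((-1 : ℝ) ^ k • iteratedDeriv k f 0) = (-1 : ℂ) ^ k * iteratedDeriv k f 0 := by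
      rw [Complex.real_smul]; push_cast; rfl
    rw [h4] at h1
    have h5 : ((-1 : ℂ) ^ k) * (-1) ^ k = 1 := by rw [← mul_pow]; norm_num
    linear_combination -((-1) ^ k / 2) * h1 + (1 / 2) * iteratedDeriv k f 0 * hk -
      (1 / 2) * iteratedDeriv k f 0 * h5
  rw [taylorCoeff, h3, zero_div]

theorem taylorParity_zero (hf : ∀ r, f (-r) = f r) : TaylorParity 0 f :=
  ⟨fun k hk => absurd hk (by omega), fun l => taylorCoeff_eq_zero_of_parity (ε := 1)
    (by simpa using hf) (by simp [pow_add, pow_mul])⟩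

theorem taylorParity_one (hf : ∀ r, f (-r) = -f r) : TaylorParity 1 f := by
  have h : ∀ r, f (-r) = -1 * f r := fun r => by rw [hf]; ring
  refine ⟨fun k hk => taylorCoeff_eq_zero_of_parity h (by
    have : k = 0 := by omega
    simp [this]), fun l => taylorCoeff_eq_zero_of_parity h (by simp [pow_add, pow_mul])⟩

theorem rapidSmooth_wMean {m : ℕ} {h : E m → ℂ} (hh : Continuous h) (φ : 𝓢(E m, ℂ)) :
    RapidSmooth (wMean h φ) :=
  ⟨contDiff_wMean hh φ, wMean_decay hh φ⟩

/-- For `Re lam > -m` no Taylor term has to be subtracted, and polar coordinates identify the finite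
part with an ordinary integral. Here `g` is `h` extended to be constant along rays. -/
theorem finitePart_wMean {m : ℕ} [NeZero m] {h g : E m → ℂ} (hh : Continuous h)
    (hg : Measurable g) (hgb : ∀ x, ‖g x‖ ≤ 1)
    (hgh : ∀ (r : ℝ), 0 < r → ∀ ω : Metric.sphere (0 : E m) 1, g (r • (ω : E m)) = h ω)
    {lam : ℂ} (hl : -(m : ℝ) < lam.re) (φ : 𝓢(E m, ℂ)) :
    Integrable (fun x => (‖x‖ : ℂ) ^ lam * (g x * φ x)) ∧
    finitePart (lam + m - 1) (wMean h φ) = ∫ x, (‖x‖ : ℂ) ^ lam * (g x * φ x) := by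
  have hm1 : 1 ≤ m := Nat.one_le_iff_ne_zero.mpr (NeZero.ne m)
  have hi := integrable_norm_cpow_mul_schwartz hl φ
  have hint : Integrable (fun x => (‖x‖ : ℂ) ^ lam * (g x * φ x)) := by
    refine Integrable.mono hi ?_ (Eventually.of_forall fun x => ?_)
    · have h1 : Measurable fun x : E m => (‖x‖ : ℂ) ^ lam := by fun_prop
      exact (h1.mul (hg.mul φ.continuous.measurable)).aestronglyMeasurable
    · rw [norm_mul, norm_mul, norm_mul]
      have := hgb x
      calc ‖(‖x‖ : ℂ) ^ lam‖ * (‖g x‖ * ‖φ x‖) ≤ ‖(‖x‖ : ℂ) ^ lam‖ * (1 * ‖φ x‖) := by gcongr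
        _ = _ := by ring
  refine ⟨hint, ?_⟩
  have hs : -((0 : ℕ) : ℝ) - 1 < (lam + m - 1).re := by simp; linarith
  rw [(rapidSmooth_wMean hh φ).finitePart_eq_trunc hs, integral_polar hint, finitePartTrunc, mellin]
  simp only [Finset.range_zero, Finset.sum_empty, add_zero]
  refine setIntegral_congr_fun measurableSet_Ioi fun r hr => ?_
  have hr' : (0 : ℝ) < r := hr
  have h1 : ∀ ω : Metric.sphere (0 : E m) 1, (‖r • (ω : E m)‖ : ℂ) ^ lam *
      (g (r • (ω : E m)) * φ (r • (ω : E m))) = (r : ℂ) ^ lam * (h ω * φ (r • (ω : E m))) := by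
    intro ω
    rw [hgh r hr' ω, norm_smul, norm_eq_of_mem_sphere, mul_one, Real.norm_of_nonneg hr'.le]
  simp only [h1]
  rw [integral_const_mul, ← mul_assoc, ← Complex.cpow_natCast,
    ← Complex.cpow_add _ _ (by exact_mod_cast hr'.ne'), Nat.cast_sub hm1]
  simp only [taylorRem, Finset.range_zero, Finset.sum_empty, indicator_zero, sub_zero, smul_eq_mul,
    wMean]
  congr 2
  push_cast; ring

end

/-! ### The entire families and their differential recursions -/

section

open Set Filter
open scoped Topology

/-- The value of `T*_lam` on `φ`, as an entire function of `lam`. -/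
noncomputable def tVal {m : ℕ} (lam : ℂ) (φ : 𝓢(E m, ℂ)) : ℂ :=
  (Real.pi : ℂ) ^ ((lam + m) / 2) * normalizedFinitePart 0 (sphMean φ) ((lam + m) / 2)

/-- The value of the `e_j`-component of `U*_lam` on `φ`, as an entire function of `lam`. -/
noncomputable def uVal {m : ℕ} (j : Fin m) (lam : ℂ) (φ : 𝓢(E m, ℂ)) : ℂ :=
  (Real.pi : ℂ) ^ ((lam + m + 1) / 2) *
    normalizedFinitePart 1 (sphMeanVec j φ) ((lam + m + 1) / 2)

/-- The `j`-th component of `x / ‖x‖`. -/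
noncomputable def unitCoord {m : ℕ} (j : Fin m) (x : E m) : ℂ := ((‖x‖⁻¹ * x j : ℝ) : ℂ)

/-- The `j`-th partial derivative of a Schwartz function. -/
noncomputable abbrev pd {m : ℕ} (j : Fin m) (φ : 𝓢(E m, ℂ)) : 𝓢(E m, ℂ) :=
  ∂_{EuclideanSpace.single j (1 : ℝ)} φ

theorem rapidSmooth_sphMean {m : ℕ} (φ : 𝓢(E m, ℂ)) : RapidSmooth (sphMean φ) := by
  rw [sphMean_eq]; exact rapidSmooth_wMean continuous_const φ

theorem rapidSmooth_sphMeanVec {m : ℕ} (j : Fin m) (φ : 𝓢(E m, ℂ)) :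
    RapidSmooth (sphMeanVec j φ) := by
  rw [sphMeanVec_eq]; exact rapidSmooth_wMean (continuous_coord j) φ

theorem taylorParity_sphMean {m : ℕ} (φ : 𝓢(E m, ℂ)) : TaylorParity 0 (sphMean φ) := by
  rw [sphMean_eq]; exact taylorParity_zero fun r => wMean_neg _ φ r

theorem taylorParity_sphMeanVec {m : ℕ} (j : Fin m) (φ : 𝓢(E m, ℂ)) :
    TaylorParity 1 (sphMeanVec j φ) := by
  rw [sphMeanVec_eq]
  refine taylorParity_one fun r => ?_
  rw [wMean_neg, wMean, wMean, ← integral_neg]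
  simp [coord]

theorem differentiable_pi_cpow {g : ℂ → ℂ} (hg : Differentiable ℂ g) :
    Differentiable ℂ fun w => (Real.pi : ℂ) ^ g w :=
  fun w => (hg w).const_cpow (Or.inl (by exact_mod_cast Real.pi_pos.ne'))

theorem differentiable_tVal {m : ℕ} (φ : 𝓢(E m, ℂ)) : Differentiable ℂ fun lam => tVal lam φ := by
  have h := (rapidSmooth_sphMean φ).differentiable_normalizedFinitePart (taylorParity_sphMean φ)
  exact (differentiable_pi_cpow (by fun_prop)).mul
    (h.comp (f := fun lam : ℂ => (lam + m) / 2) (by fun_prop))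

theorem differentiable_uVal {m : ℕ} (j : Fin m) (φ : 𝓢(E m, ℂ)) :
    Differentiable ℂ fun lam => uVal j lam φ := by
  have h := (rapidSmooth_sphMeanVec j φ).differentiable_normalizedFinitePart
    (taylorParity_sphMeanVec j φ)
  exact (differentiable_pi_cpow (by fun_prop)).mul
    (h.comp (f := fun lam : ℂ => (lam + m + 1) / 2) (by fun_prop))

theorem norm_unitCoord_le {m : ℕ} (j : Fin m) (x : E m) : ‖unitCoord j x‖ ≤ 1 := by
  rw [unitCoord, Complex.norm_real, norm_mul, norm_inv, norm_norm]
  have : ‖x j‖ ≤ ‖x‖ := EuclideanSpace.norm_eq x ▸ by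
    refine Real.le_sqrt_of_sq_le ?_
    exact Finset.single_le_sum (f := fun i => ‖x i‖ ^ 2) (fun i _ => sq_nonneg _) (Finset.mem_univ j)
  exact (mul_le_mul_of_nonneg_left this (by positivity)).trans (inv_mul_le_one)

theorem measurable_unitCoord {m : ℕ} (j : Fin m) : Measurable (unitCoord j) := by
  unfold unitCoord; fun_prop

theorem unitCoord_smul {m : ℕ} (j : Fin m) (r : ℝ) (hr : 0 < r) (ω : Metric.sphere (0 : E m) 1) :
    unitCoord j (r • (ω : E m)) = coord j ω := by
  rw [unitCoord, coord, norm_smul, norm_eq_of_mem_sphere, Real.norm_of_nonneg hr.le, mul_one,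
    PiLp.smul_apply, smul_eq_mul, inv_mul_cancel_left₀ hr.ne']

theorem finitePart_sphMean {m : ℕ} [NeZero m] {lam : ℂ} (hl : -(m : ℝ) < lam.re) (φ : 𝓢(E m, ℂ)) :
    finitePart (lam + m - 1) (sphMean φ) = ∫ x, (‖x‖ : ℂ) ^ lam * φ x := by
  have h := (finitePart_wMean (h := fun _ => 1) (g := fun _ => 1) continuous_const
    measurable_const (by simp) (by simp) hl φ).2
  rw [sphMean_eq, h]
  simp

theorem integrable_unitCoord {m : ℕ} [NeZero m] (j : Fin m) {lam : ℂ} (hl : -(m : ℝ) < lam.re)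
    (φ : 𝓢(E m, ℂ)) : Integrable fun x => (‖x‖ : ℂ) ^ lam * (unitCoord j x * φ x) :=
  (finitePart_wMean (continuous_coord j)
    (measurable_unitCoord j) (norm_unitCoord_le j) (unitCoord_smul j) hl φ).1

theorem finitePart_sphMeanVec {m : ℕ} [NeZero m] (j : Fin m) {lam : ℂ} (hl : -(m : ℝ) < lam.re)
    (φ : 𝓢(E m, ℂ)) :
    finitePart (lam + m - 1) (sphMeanVec j φ) =
      ∫ x, (‖x‖ : ℂ) ^ lam * (unitCoord j x * φ x) :=
  (finitePart_wMean (continuous_coord j)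
    (measurable_unitCoord j) (norm_unitCoord_le j) (unitCoord_smul j) hl φ).2

theorem ne_neg_nat_of_re_pos {w : ℂ} (hw : 0 < w.re) (l : ℕ) : w ≠ -l := by
  rintro rfl
  simp only [Complex.neg_re, Complex.natCast_re, Left.neg_pos_iff] at hw
  exact absurd hw (not_lt.mpr (Nat.cast_nonneg l))

theorem tVal_eq_integral {m : ℕ} [NeZero m] {lam : ℂ} (hl : -(m : ℝ) < lam.re) (φ : 𝓢(E m, ℂ)) :
    tVal lam φ = (Real.pi : ℂ) ^ ((lam + m) / 2) / Complex.Gamma ((lam + m) / 2) *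
      ∫ x, (‖x‖ : ℂ) ^ lam * φ x := by
  rw [tVal, normalizedFinitePart_of_ne _ _ (ne_neg_nat_of_re_pos (by simp; linarith)),
    ← finitePart_sphMean hl]
  rw [show 2 * ((lam + m) / 2) - 1 - ((0 : ℕ) : ℂ) = lam + m - 1 by push_cast; ring]
  ring

theorem uVal_eq_integral {m : ℕ} [NeZero m] (j : Fin m) {lam : ℂ} (hl : -(m : ℝ) < lam.re)
    (φ : 𝓢(E m, ℂ)) :
    uVal j lam φ = (Real.pi : ℂ) ^ ((lam + m + 1) / 2) / Complex.Gamma ((lam + m + 1) / 2) *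
      ∫ x, (‖x‖ : ℂ) ^ lam * (unitCoord j x * φ x) := by
  rw [uVal, normalizedFinitePart_of_ne _ _ (ne_neg_nat_of_re_pos (by simp; linarith)),
    ← finitePart_sphMeanVec j hl]
  rw [show 2 * ((lam + m + 1) / 2) - 1 - ((1 : ℕ) : ℂ) = lam + m - 1 by push_cast; ring]
  ring

/-- The bound `2 < κ.re` makes the power `O(t²)` along the line through the origin, so its
derivative there is zero. Nothing is lost: the resulting identities are continued analytically. -/
theorem hasLineDerivAt_norm_cpow {m : ℕ} (j : Fin m) {κ : ℂ} (hκ : 2 < κ.re) (x : E m) :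
    HasLineDerivAt ℝ (fun x : E m => (‖x‖ : ℂ) ^ κ) (κ * (‖x‖ : ℂ) ^ (κ - 1) * unitCoord j x) x
      (EuclideanSpace.single j (1 : ℝ)) := by
  have hκ0 : κ ≠ 0 := by rintro rfl; simp at hκ; linarith
  by_cases hx : x = 0
  · subst hx
    have e0 : κ * ((‖(0 : E m)‖ : ℝ) : ℂ) ^ (κ - 1) * unitCoord j 0 = 0 := by simp [unitCoord]
    rw [e0]
    have hO : (fun t : ℝ => (‖(0 : E m) + t • EuclideanSpace.single j (1 : ℝ)‖ : ℂ) ^ κ) =O[𝓝 0]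
        fun t : ℝ => ‖t - 0‖ ^ 2 := by
      refine Asymptotics.IsBigO.of_bound 1 ?_
      filter_upwards [Metric.ball_mem_nhds (0 : ℝ) one_pos] with t ht
      have ht1 : |t| < 1 := by simpa using ht
      have e : ‖(0 : E m) + t • EuclideanSpace.single j (1 : ℝ)‖ = |t| := by
        simp [norm_smul]
      rw [e]
      by_cases h0 : t = 0
      · simp [h0, hκ0]
      · have hp : 0 < |t| := abs_pos.mpr h0
        have h2 := Real.rpow_le_rpow_of_exponent_ge hp ht1.le hκ.le
        rw [Real.rpow_two] at h2
        simpa [Complex.norm_cpow_eq_rpow_re_of_pos hp] using h2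
    have h1 := (hO.hasFDerivAt one_lt_two).hasDerivAt
    simpa [HasLineDerivAt] using h1
  · have hn : 0 < ‖x‖ := norm_pos_iff.mpr hx
    have h1 : HasDerivAt (fun t : ℝ => x + t • (EuclideanSpace.single j (1 : ℝ) : E m))
        (EuclideanSpace.single j (1 : ℝ)) 0 := by
      simpa using ((hasDerivAt_id (0 : ℝ)).smul_const
        (EuclideanSpace.single j (1 : ℝ) : E m)).const_add x
    have h2 := h1.norm_sq.sqrt (by simpa using hx)
    simp only [zero_smul, add_zero, Real.sqrt_sq (norm_nonneg _)] at h2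
    have h3 := (hasDerivAt_ofReal_cpow_const (x := ‖x + (0 : ℝ) •
      (EuclideanSpace.single j (1 : ℝ) : E m)‖) (by simpa using hx) hκ0)
    have h4 := h3.scomp (0 : ℝ) h2
    refine h4.congr_deriv ?_
    simp only [zero_smul, add_zero]
    rw [EuclideanSpace.inner_single_right, Complex.real_smul, unitCoord]
    push_cast
    have hnc : (‖x‖ : ℂ) ≠ 0 := by exact_mod_cast hn.ne'
    simp
    field_simp

theorem hasLineDerivAt_schwartz {m : ℕ} (j : Fin m) (φ : 𝓢(E m, ℂ)) (x : E m) :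
    HasLineDerivAt ℝ φ (pd j φ x) x
      (EuclideanSpace.single j (1 : ℝ)) :=
  (φ.hasFDerivAt x).hasLineDerivAt _

theorem cpow_mul_coord {m : ℕ} (j : Fin m) (κ : ℂ) {x : E m} (hx : x ≠ 0) :
    (‖x‖ : ℂ) ^ κ * coord j x = (‖x‖ : ℂ) ^ (κ + 1) * unitCoord j x := by
  have hn : (‖x‖ : ℂ) ≠ 0 := by exact_mod_cast (norm_pos_iff.mpr hx).ne'
  rw [Complex.cpow_add _ _ hn, Complex.cpow_one, unitCoord, coord]
  push_cast
  field_simp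

theorem integral_norm_cpow_mul_lineDeriv {m : ℕ} [NeZero m] (j : Fin m) {κ : ℂ} (hκ : 2 < κ.re)
    (φ : 𝓢(E m, ℂ)) :
    ∫ x, (‖x‖ : ℂ) ^ κ * pd j φ x =
      -(κ * ∫ x, (‖x‖ : ℂ) ^ (κ - 1) * (unitCoord j x * φ x)) := by
  have hm : (0 : ℝ) ≤ m := Nat.cast_nonneg m
  have hi := (integrable_unitCoord j (lam := κ - 1) (by simp; linarith) φ).const_mul κ
  have h := integral_bilinear_hasLineDerivAt_right_eq_neg_left_of_integrable (μ := volume)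
    (f := fun x : E m => (‖x‖ : ℂ) ^ κ)
    (f' := fun x => κ * (‖x‖ : ℂ) ^ (κ - 1) * unitCoord j x) (g := φ)
    (g' := pd j φ) (B := ContinuousLinearMap.mul ℝ ℂ)
    (v := EuclideanSpace.single j (1 : ℝ))
    (by
      refine hi.congr (Eventually.of_forall fun x => ?_)
      simp only [ContinuousLinearMap.mul_apply']
      ring)
    (integrable_norm_cpow_mul_schwartz (by linarith) _)
    (integrable_norm_cpow_mul_schwartz (by linarith) _)
    (fun x _ => hasLineDerivAt_norm_cpow j hκ x) (fun x _ => hasLineDerivAt_schwartz j φ x)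
  simp only [ContinuousLinearMap.mul_apply'] at h
  rw [h, ← integral_const_mul]
  congr 2
  ext x
  ring

theorem sum_unitCoord_sq {m : ℕ} {x : E m} (hx : x ≠ 0) : ∑ j, unitCoord j x * unitCoord j x = 1 := by
  have hn := (norm_pos_iff.mpr hx).ne'
  have h : ∑ j, (‖x‖⁻¹ * x j) * (‖x‖⁻¹ * x j) = (1 : ℝ) := by
    have h2 := EuclideanSpace.real_norm_sq_eq x
    have : ∀ j, (‖x‖⁻¹ * x j) * (‖x‖⁻¹ * x j) = (‖x‖ ^ 2)⁻¹ * x j ^ 2 := fun j => by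
      field_simp
    simp_rw [this]
    rw [← Finset.mul_sum, ← h2]
    field_simp
  simp only [unitCoord]
  exact_mod_cast h

/-- Integration by parts with `∑ ∂_j (‖x‖^κ x_j) = (κ + m) ‖x‖^κ`: Euler's relation gives `κ`, the
divergence of `x` gives `m`. -/
theorem sum_integral_norm_cpow_mul_lineDeriv {m : ℕ} [NeZero m] {κ : ℂ} (hκ : 2 < κ.re)
    (φ : 𝓢(E m, ℂ)) :
    ∑ j, ∫ x, (‖x‖ : ℂ) ^ (κ + 1) * (unitCoord j x * pd j φ x) =
      -((κ + m) * ∫ x, (‖x‖ : ℂ) ^ κ * φ x) := by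
  have hm : (0 : ℝ) ≤ m := Nat.cast_nonneg m
  have hcoord : ∀ (j : Fin m) (x : E m), HasLineDerivAt ℝ (coord j) 1 x
      (EuclideanSpace.single j (1 : ℝ)) := by
    intro j x
    have h1 : HasDerivAt (fun t : ℝ => x j + t * 1) 1 0 := by
      simpa using ((hasDerivAt_id (0 : ℝ)).const_add (x j))
    simpa [HasLineDerivAt, coord] using h1.ofReal_comp
  have hi0 := integrable_norm_cpow_mul_schwartz (lam := κ) (by linarith) φ
  have hi2 : ∀ j : Fin m, Integrable fun x => (‖x‖ : ℂ) ^ κ *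
      (unitCoord j x * (unitCoord j x * φ x)) := fun j => by
    refine hi0.mono ?_ (Eventually.of_forall fun x => ?_)
    · have h1 : Measurable fun x : E m => (‖x‖ : ℂ) ^ κ := by fun_prop
      exact (h1.mul ((measurable_unitCoord j).mul ((measurable_unitCoord j).mul
        φ.continuous.measurable))).aestronglyMeasurable
    · simp only [norm_mul]
      have := norm_unitCoord_le j x
      calc ‖(‖x‖ : ℂ) ^ κ‖ * (‖unitCoord j x‖ * (‖unitCoord j x‖ * ‖φ x‖)) ≤
          ‖(‖x‖ : ℂ) ^ κ‖ * (1 * (1 * ‖φ x‖)) := by gcongr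
        _ = _ := by ring
  have hae : ∀ᵐ x : E m, x ≠ 0 := by simp [ae_iff]
  have key : ∀ j : Fin m, ∫ x, (‖x‖ : ℂ) ^ (κ + 1) *
      (unitCoord j x * pd j φ x) =
      -(κ * ∫ x, (‖x‖ : ℂ) ^ κ * (unitCoord j x * (unitCoord j x * φ x))) -
        ∫ x, (‖x‖ : ℂ) ^ κ * φ x := by
    intro j
    have ef' : ∀ x : E m, x ≠ 0 →
        ((κ * (‖x‖ : ℂ) ^ (κ - 1) * unitCoord j x) * coord j x + (‖x‖ : ℂ) ^ κ * 1) * φ x =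
        κ * ((‖x‖ : ℂ) ^ κ * (unitCoord j x * (unitCoord j x * φ x))) + (‖x‖ : ℂ) ^ κ * φ x := by
      intro x hx
      have := cpow_mul_coord j (κ - 1) hx
      rw [sub_add_cancel] at this
      linear_combination κ * unitCoord j x * φ x * this
    have h := integral_bilinear_hasLineDerivAt_right_eq_neg_left_of_integrable (μ := volume)
      (f := fun x : E m => (‖x‖ : ℂ) ^ κ * coord j x)
      (f' := fun x => (κ * (‖x‖ : ℂ) ^ (κ - 1) * unitCoord j x) * coord j x + (‖x‖ : ℂ) ^ κ * 1)
      (g := φ)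
      (g' := pd j φ) (B := ContinuousLinearMap.mul ℝ ℂ)
      (v := EuclideanSpace.single j (1 : ℝ))
      (by
        refine (((hi2 j).const_mul κ).add hi0).congr ?_
        filter_upwards [hae] with x hx
        exact (ef' x hx).symm)
      (by
        refine (integrable_unitCoord j (lam := κ + 1) (by simp; linarith)
          (pd j φ)).congr ?_
        filter_upwards [hae] with x hx
        simp only [ContinuousLinearMap.mul_apply']
        rw [cpow_mul_coord j κ hx, mul_assoc])
      (by
        refine (integrable_unitCoord j (lam := κ + 1) (by simp; linarith) φ).congr ?_
        filter_upwards [hae] with x hx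
        simp only [ContinuousLinearMap.mul_apply']
        rw [cpow_mul_coord j κ hx, mul_assoc])
      (fun x _ => by
        have h1 := hasLineDerivAt_norm_cpow j hκ x
        have h2 := hcoord j x
        have h3 := HasDerivAt.mul h1 h2
        simp only [zero_smul, add_zero] at h3
        exact h3)
      (fun x _ => hasLineDerivAt_schwartz j φ x)
    simp only [ContinuousLinearMap.mul_apply'] at h
    have e1 : ∫ x, (‖x‖ : ℂ) ^ κ * coord j x * pd j φ x =
        ∫ x, (‖x‖ : ℂ) ^ (κ + 1) *
          (unitCoord j x * pd j φ x) := by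
      refine integral_congr_ae ?_
      filter_upwards [hae] with x hx
      rw [cpow_mul_coord j κ hx, mul_assoc]
    have e2 : ∫ x, ((κ * (‖x‖ : ℂ) ^ (κ - 1) * unitCoord j x) * coord j x + (‖x‖ : ℂ) ^ κ * 1) * φ x
        = ∫ x, (κ * ((‖x‖ : ℂ) ^ κ * (unitCoord j x * (unitCoord j x * φ x))) +
          (‖x‖ : ℂ) ^ κ * φ x) := by
      refine integral_congr_ae ?_
      filter_upwards [hae] with x hx
      exact ef' x hx
    rw [← e1, h, e2, integral_add ((hi2 j).const_mul κ) hi0, integral_const_mul]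
    ring
  simp_rw [key]
  rw [Finset.sum_sub_distrib, Finset.sum_neg_distrib, ← Finset.mul_sum,
    ← integral_finsetSum _ fun j _ => hi2 j]
  have e3 : ∫ x, ∑ j, (‖x‖ : ℂ) ^ κ * (unitCoord j x * (unitCoord j x * φ x)) =
      ∫ x, (‖x‖ : ℂ) ^ κ * φ x := by
    refine integral_congr_ae ?_
    filter_upwards [hae] with x hx
    simp_rw [← mul_assoc, mul_assoc ((‖x‖ : ℂ) ^ κ)]
    rw [← Finset.mul_sum, ← Finset.sum_mul, sum_unitCoord_sq hx, one_mul]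
  rw [e3]
  simp
  ring

theorem eq_of_eqOn_half_plane {f g : ℂ → ℂ} (hf : Differentiable ℂ f) (hg : Differentiable ℂ g)
    {c : ℝ} (h : ∀ w : ℂ, c < w.re → f w = g w) : f = g := by
  refine AnalyticOnNhd.eq_of_eventuallyEq (𝕜 := ℂ) (fun w _ => hf.analyticAt w)
    (fun w _ => hg.analyticAt w) (z₀ := ((c + 1 : ℝ) : ℂ)) ?_
  filter_upwards [(isOpen_lt continuous_const Complex.continuous_re).mem_nhds
    (show c < ((c + 1 : ℝ) : ℂ).re by simp)] with w hw
  exact h w hw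

/-- The componentwise form of `∂ T*_{lam+1} = (lam+1) U*_lam`: integration by parts for large real
part, then the identity theorem, both sides being entire. -/
theorem tVal_lineDeriv {m : ℕ} [NeZero m] (j : Fin m) (lam : ℂ) (φ : 𝓢(E m, ℂ)) :
    tVal (lam + 1) (pd j φ) = -(lam + 1) * uVal j lam φ := by
  refine congrFun (eq_of_eqOn_half_plane (c := 2)
    (f := fun lam => tVal (lam + 1) (pd j φ))
    (g := fun lam => -(lam + 1) * uVal j lam φ)
    ((differentiable_tVal _).comp (f := fun lam : ℂ => lam + 1) (by fun_prop))
    ((by fun_prop : Differentiable ℂ fun lam : ℂ => -(lam + 1)).mul (differentiable_uVal j φ))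
    fun w hw => ?_) lam
  have hm : (0 : ℝ) ≤ m := Nat.cast_nonneg m
  rw [tVal_eq_integral (by simp; linarith), uVal_eq_integral j (by linarith),
    integral_norm_cpow_mul_lineDeriv j (by simp; linarith), add_sub_cancel_right,
    add_right_comm w 1 (m : ℂ)]
  ring

/-- The divergence counterpart. The factor `κ + m` from integration by parts is absorbed by `Γ(q+1)
= q Γ(q)` with `q = (lam+m)/2`, leaving the constant `2π`; the recursion can therefore be solved for
`T*_lam` even at the poles of the unnormalized family. -/
theorem sum_uVal_lineDeriv {m : ℕ} [NeZero m] (lam : ℂ) (φ : 𝓢(E m, ℂ)) :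
    ∑ j, uVal j (lam + 1) (pd j φ) =
      -(2 * Real.pi) * tVal lam φ := by
  refine congrFun (eq_of_eqOn_half_plane (c := 2)
    (f := fun lam => ∑ j, uVal j (lam + 1) (pd j φ))
    (g := fun lam => -(2 * Real.pi) * tVal lam φ)
    (Differentiable.fun_sum fun j _ =>
      (differentiable_uVal j _).comp (f := fun lam : ℂ => lam + 1) (by fun_prop))
    ((differentiable_tVal φ).const_mul _)
    fun w hw => ?_) lam
  have hm : (0 : ℝ) ≤ m := Nat.cast_nonneg m
  have h1 : ∀ j : Fin m, uVal j (w + 1) (pd j φ) = _ := fun j =>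
    uVal_eq_integral j (by simp; linarith) _
  have hw0 : (w + m) / 2 ≠ 0 := by
    intro h0
    have := congrArg Complex.re h0
    simp at this
    linarith
  simp only [h1]
  rw [← Finset.mul_sum, sum_integral_norm_cpow_mul_lineDeriv hw, tVal_eq_integral (by linarith),
    show (w + 1 + m + 1) / 2 = (w + m) / 2 + 1 by ring, Complex.Gamma_add_one _ hw0,
    Complex.cpow_add _ _ (by exact_mod_cast Real.pi_pos.ne'), Complex.cpow_one]
  have hG : Complex.Gamma ((w + m) / 2) ≠ 0 :=
    Complex.Gamma_ne_zero_of_re_pos (by simp; linarith)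
  have hw1 : w + m ≠ 0 := fun h => hw0 (by rw [h, zero_div])
  field_simp

end

/-! ### Values at the exceptional parameters and the Clifford relations -/

section

open Set Filter
open scoped Topology

/-- `-Δ` as a linear map on Schwartz functions. -/
noncomputable def negLap (m : ℕ) : 𝓢(E m, ℂ) →ₗ[ℂ] 𝓢(E m, ℂ) :=
  -(LineDeriv.laplacianCLM ℂ (E m) 𝓢(E m, ℂ)).toLinearMap

theorem negLap_apply {m : ℕ} (φ : 𝓢(E m, ℂ)) : negLap m φ = -Δ φ := by
  simp [negLap, LinearMap.neg_apply]

theorem laplacian_eq_sum_pd {m : ℕ} (φ : 𝓢(E m, ℂ)) : Δ φ = ∑ j, pd j (pd j φ) := by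
  have := SchwartzMap.laplacian_eq_sum (EuclideanSpace.basisFun (Fin m) ℝ) φ
  simpa using this

theorem pd_comm {m : ℕ} (j k : Fin m) (φ : 𝓢(E m, ℂ)) : pd j (pd k φ) = pd k (pd j φ) := by
  ext x
  have hd : DifferentiableAt ℝ (fderiv ℝ φ) x :=
    ((φ.smooth 2).fderiv_right (m := 1) (by norm_num)).differentiable (by norm_num) x
  have h : ∀ v w : E m, (∂_{v} (∂_{w} φ : 𝓢(E m, ℂ)) : 𝓢(E m, ℂ)) x =
      fderiv ℝ (fderiv ℝ φ) x v w := by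
    intro v w
    rw [SchwartzMap.lineDerivOp_apply_eq_fderiv]
    have : (⇑(∂_{w} φ : 𝓢(E m, ℂ)) : E m → ℂ) = fun y => fderiv ℝ φ y w := by
      ext y; rw [SchwartzMap.lineDerivOp_apply_eq_fderiv]
    rw [this, fderiv_clm_apply hd (by fun_prop)]
    simp
  have hs : IsSymmSndFDerivAt ℝ φ x :=
    (φ.smooth 2).contDiffAt.isSymmSndFDerivAt (by simp)
  rw [pd, pd, pd, pd, h, h]
  exact hs _ _

theorem sphMean_zero {m : ℕ} [NeZero m] (φ : 𝓢(E m, ℂ)) :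
    sphMean φ 0 = 2 * (Real.pi : ℂ) ^ ((m : ℂ) / 2) / Complex.Gamma ((m : ℂ) / 2) * φ 0 := by
  rw [← toSphere_real_univ, sphMean]
  simp

/-- At `l = 0` the value is half the spherical mean at radius `0`. One use of each recursion then
expresses `T*_{lam}` through `T*_{lam+2}` applied to `∑ ∂_j² φ`, which raises the power of `-Δ` by
one. Higher Taylor coefficients of spherical means never have to be computed. -/
theorem tVal_neg {m : ℕ} [NeZero m] (l : ℕ) (φ : 𝓢(E m, ℂ)) :
    tVal (-m - 2 * l) φ = (Real.pi : ℂ) ^ ((m : ℂ) / 2 - l) /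
      (2 ^ (2 * l) * Complex.Gamma ((m : ℂ) / 2 + l)) * ((negLap m ^ l) φ) 0 := by
  induction l generalizing φ with
  | zero =>
    have h : ((-m - 2 * ((0 : ℕ) : ℂ) + m) / 2 : ℂ) = -((0 : ℕ) : ℂ) := by push_cast; ring
    rw [tVal, h, normalizedFinitePart_neg]
    simp [taylorCoeff, sphMean_zero]
    ring
  | succ l ih =>
    have hmne : (m : ℂ) / 2 + l ≠ 0 := by
      have : (0 : ℝ) < m := by exact_mod_cast Nat.pos_of_ne_zero (NeZero.ne m)
      intro h0
      have := congrArg Complex.re h0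
      simp at this
      linarith [(Nat.cast_nonneg l : (0 : ℝ) ≤ l)]
    set lam : ℂ := -m - 2 * ((l + 1 : ℕ) : ℂ) with hlam
    have h1 := sum_uVal_lineDeriv lam φ
    have h2 : ∀ j : Fin m, uVal j (lam + 1) (pd j φ) =
        (2 * ((m : ℂ) / 2 + l))⁻¹ * tVal (-m - 2 * l) (pd j (pd j φ)) := by
      intro j
      have := tVal_lineDeriv j (lam + 1) (pd j φ)
      have e : lam + 1 + 1 = -m - 2 * l := by rw [hlam]; push_cast; ring
      rw [e] at this
      rw [this, eq_inv_mul_iff_mul_eq₀ (mul_ne_zero two_ne_zero hmne)]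
      ring
    have h3 : ∑ j, tVal (-m - 2 * l) (pd j (pd j φ)) =
        -((Real.pi : ℂ) ^ ((m : ℂ) / 2 - l) /
        (2 ^ (2 * l) * Complex.Gamma ((m : ℂ) / 2 + l)) * ((negLap m ^ (l + 1)) φ) 0) := by
      simp_rw [ih]
      rw [← Finset.mul_sum, pow_succ, Module.End.mul_apply, negLap_apply, laplacian_eq_sum_pd,
        map_neg, map_sum, neg_apply, sum_apply]
      ring
    have h1' : ∑ j, uVal j (lam + 1) (pd j φ) = -(2 * Real.pi) * tVal lam φ := h1
    simp_rw [h2] at h1'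
    rw [← Finset.mul_sum, h3] at h1'
    have hpi : (Real.pi : ℂ) ≠ 0 := by exact_mod_cast Real.pi_pos.ne'
    have hp : (Real.pi : ℂ) ^ ((m : ℂ) / 2 - ((l + 1 : ℕ) : ℂ)) =
        (Real.pi : ℂ) ^ ((m : ℂ) / 2 - l) / Real.pi := by
      rw [show (m : ℂ) / 2 - ((l + 1 : ℕ) : ℂ) = m / 2 - l - 1 by push_cast; ring,
        Complex.cpow_sub _ _ hpi, Complex.cpow_one]
    have hG : Complex.Gamma ((m : ℂ) / 2 + ((l + 1 : ℕ) : ℂ)) =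
        (m / 2 + l) * Complex.Gamma (m / 2 + l) := by
      rw [← Complex.Gamma_add_one _ hmne]; congr 1; push_cast; ring
    have h4 : tVal lam φ = (2 * (Real.pi : ℂ))⁻¹ * ((2 * ((m : ℂ) / 2 + l))⁻¹ *
        ((Real.pi : ℂ) ^ ((m : ℂ) / 2 - l) /
        (2 ^ (2 * l) * Complex.Gamma ((m : ℂ) / 2 + l)) * ((negLap m ^ (l + 1)) φ) 0)) := by
      have h5 : (2 * (Real.pi : ℂ))⁻¹ * (2 * Real.pi) = 1 := by field_simp
      linear_combination (2 * (Real.pi : ℂ))⁻¹ * h1' - tVal lam φ * h5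
    rw [h4, hp, hG, show 2 * (l + 1) = 2 * l + 2 by ring, pow_add, div_eq_mul_inv, div_eq_mul_inv,
      div_eq_mul_inv]
    simp only [mul_inv]
    ring

theorem uVal_neg {m : ℕ} [NeZero m] (j : Fin m) (l : ℕ) (φ : 𝓢(E m, ℂ)) :
    uVal j (-m - 2 * l - 1) φ = (Real.pi : ℂ) ^ ((m : ℂ) / 2 - l) /
      (2 ^ (2 * l + 1) * Complex.Gamma ((m : ℂ) / 2 + l + 1)) * ((negLap m ^ l) (pd j φ)) 0 := by
  have hmne : (m : ℂ) / 2 + l ≠ 0 := by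
    have : (0 : ℝ) < m := by exact_mod_cast Nat.pos_of_ne_zero (NeZero.ne m)
    intro h0
    have := congrArg Complex.re h0
    simp at this
    linarith [(Nat.cast_nonneg l : (0 : ℝ) ≤ l)]
  have h := tVal_lineDeriv j (-m - 2 * l - 1) φ
  rw [sub_add_cancel, tVal_neg] at h
  have h2 : uVal j (-m - 2 * l - 1) φ = (2 * ((m : ℂ) / 2 + l))⁻¹ *
      ((Real.pi : ℂ) ^ ((m : ℂ) / 2 - l) /
      (2 ^ (2 * l) * Complex.Gamma ((m : ℂ) / 2 + l)) * ((negLap m ^ l) (pd j φ)) 0) := by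
    rw [h, eq_inv_mul_iff_mul_eq₀ (mul_ne_zero two_ne_zero hmne)]
    ring
  rw [h2, Complex.Gamma_add_one _ hmne, pow_succ]
  generalize (m : ℂ) / 2 + l = q
  simp only [div_eq_mul_inv, mul_inv]
  ring

theorem vec_eq_sum {m : ℕ} (x : E m) : vec x = ∑ j, coord j x • gen j := by
  have h : (fun i => (x i : ℂ)) = ∑ j, coord j x • fun i => ((EuclideanSpace.single j (1 : ℝ) : E m) i : ℂ) := by
    ext i
    simp only [Finset.sum_apply, Pi.smul_apply, smul_eq_mul, coord]
    rw [Finset.sum_eq_single i]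
    · simp
    · intro b _ hb
      simp [hb.symm]
    · simp
  rw [vec, h, map_sum]
  simp [gen, vec]

theorem gen_mul_gen_self {m : ℕ} (j : Fin m) : gen j * gen j = (-1 : Cl m) := by
  rw [gen, vec, CliffordAlgebra.ι_sq_scalar, QuadraticMap.weightedSumSquares_apply,
    Finset.sum_eq_single j]
  · simp
  · intro b _ hb
    simp [hb]
  · simp

theorem gen_anticomm {m : ℕ} {j k : Fin m} (hjk : j ≠ k) : gen j * gen k = -(gen k * gen j : Cl m) := by
  rw [gen, gen, vec, vec, eq_neg_iff_add_eq_zero, CliffordAlgebra.ι_mul_ι_add_swap,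
    QuadraticMap.polar]
  simp only [QuadraticMap.weightedSumSquares_apply, Pi.add_apply]
  rw [← Finset.sum_sub_distrib, ← Finset.sum_sub_distrib, Finset.sum_eq_zero, map_zero]
  intro i _
  by_cases hij : i = j
  · subst hij; simp [hjk]
  · simp [hij]

theorem negLaplacian_iterate {m : ℕ} (l : ℕ) (S : CliffordFunctional m) (φ : 𝓢(E m, ℂ)) :
    (negLaplacian^[l] S) φ = S ((negLap m ^ l) φ) := by
  induction l generalizing φ with
  | zero => simp
  | succ l ih =>
    rw [Function.iterate_succ_apply', negLaplacian, ih, pow_succ, Module.End.mul_apply,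
      negLap_apply]

/-- Add the double sum to itself with the indices exchanged: mixed partials commute while distinct
generators anticommute, so only the diagonal `gen j * gen j = -1` remains. -/
theorem diracOp_diracOp {m : ℕ} (S : 𝓢(E m, ℂ) →ₗ[ℂ] Cl m) :
    diracOp (diracOp (S : CliffordFunctional m)) = fun φ => S (negLap m φ) := by
  ext φ
  have h1 : diracOp (diracOp (S : CliffordFunctional m)) φ =
      ∑ j, ∑ k, gen j * gen k * S (pd k (pd j φ)) := by
    simp only [diracOp, mul_neg, Finset.sum_neg_distrib, neg_neg, Finset.mul_sum, mul_assoc]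
  have hadd : ∑ j, ∑ k, gen j * gen k * S (pd k (pd j φ)) +
      ∑ j, ∑ k, gen j * gen k * S (pd k (pd j φ)) =
      ∑ j : Fin m, (2 : ℂ) • -S (pd j (pd j φ)) := by
    nth_rw 2 [Finset.sum_comm]
    rw [← Finset.sum_add_distrib]
    refine Finset.sum_congr rfl fun j _ => ?_
    rw [← Finset.sum_add_distrib, Finset.sum_eq_single j]
    · rw [gen_mul_gen_self, neg_one_mul, two_smul]
    · intro k _ hk
      rw [gen_anticomm hk.symm, pd_comm j k, neg_mul, neg_add_cancel]
    · simp
  rw [h1, negLap_apply, laplacian_eq_sum_pd, map_neg, map_sum]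
  rw [← two_smul ℂ, ← Finset.smul_sum, Finset.sum_neg_distrib] at hadd
  exact smul_right_injective (Cl m) (two_ne_zero (α := ℂ)) hadd

theorem diracOp_iterate_even {m : ℕ} (l : ℕ) (S : 𝓢(E m, ℂ) →ₗ[ℂ] Cl m) :
    diracOp^[2 * l] (S : CliffordFunctional m) = fun φ => S ((negLap m ^ l) φ) := by
  induction l with
  | zero => simp
  | succ l ih =>
    rw [show 2 * (l + 1) = (2 * l + 1) + 1 by ring, Function.iterate_succ_apply',
      Function.iterate_succ_apply', ih]
    have := diracOp_diracOp (S ∘ₗ (negLap m ^ l))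
    refine this.trans ?_
    ext φ
    simp [pow_succ, Module.End.mul_apply]

/-- The delta distribution as a linear map. -/
noncomputable def deltaLin (m : ℕ) : 𝓢(E m, ℂ) →ₗ[ℂ] Cl m where
  toFun := delta m
  map_add' φ ψ := by simp [delta]
  map_smul' c φ := by simp [delta, Algebra.smul_def]

/-- This shows that the definition by cases is one entire function of `lam`: its exceptional branch
is the limit computed in `tVal_neg`. -/
theorem Tstar_apply {m : ℕ} [NeZero m] (lam : ℂ) (φ : 𝓢(E m, ℂ)) :
    Tstar m lam φ = algebraMap ℂ (Cl m) (tVal lam φ) := by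
  by_cases h : ∃ l : ℕ, lam = -m - 2 * l
  · rw [Tstar, dif_pos h, Pi.smul_apply, negLaplacian_iterate, delta, Algebra.smul_def, ← map_mul,
      ← tVal_neg, ← h.choose_spec]
  · rw [Tstar, dif_neg h, Pi.smul_apply, T, Algebra.smul_def, ← map_mul, tVal,
      normalizedFinitePart_of_ne]
    · rw [show 2 * ((lam + m) / 2) - 1 - ((0 : ℕ) : ℂ) = lam + m - 1 by push_cast; ring]
      congr 1
      ring
    · intro l hl
      exact h ⟨l, by linear_combination 2 * hl⟩

/-- In the exceptional branch the odd power of the Dirac operator is one further application to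
`(-Δ)^l δ`. The minus sign in the definition of `Ustar` cancels the one from moving the derivative
onto `φ`. -/
theorem Ustar_apply {m : ℕ} [NeZero m] (lam : ℂ) (φ : 𝓢(E m, ℂ)) :
    Ustar m lam φ = ∑ j, uVal j lam φ • gen j := by
  by_cases h : ∃ l : ℕ, lam = -m - 2 * l - 1
  · rw [Ustar, dif_pos h, Pi.smul_apply, Function.iterate_succ_apply']
    have h1 := diracOp_iterate_even h.choose (deltaLin m)
    change diracOp^[2 * h.choose] (delta m) = _ at h1
    rw [h1, diracOp, smul_neg, neg_smul, neg_neg, Finset.smul_sum]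
    refine Finset.sum_congr rfl fun j _ => ?_
    have h2 := uVal_neg j h.choose φ
    rw [← h.choose_spec] at h2
    rw [h2]
    change _ • (gen j * algebraMap ℂ (Cl m) (((negLap m ^ h.choose) (pd j φ)) 0)) = _
    rw [← Algebra.commutes, ← Algebra.smul_def, smul_smul]
  · rw [Ustar, dif_neg h, Pi.smul_apply, U, Finset.smul_sum]
    refine Finset.sum_congr rfl fun j _ => ?_
    rw [smul_smul, uVal, normalizedFinitePart_of_ne]
    · rw [show 2 * ((lam + m + 1) / 2) - 1 - ((1 : ℕ) : ℂ) = lam + m - 1 by push_cast; ring]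
      congr 1
      ring
    · intro l hl
      exact h ⟨l, by linear_combination 2 * hl⟩

end

/-! ### Reduction of the convolution integral, and analyticity of the coefficients -/

section

open Set Filter
open scoped Topology

theorem integral_norm_rpow_mul_norm_sub_rpow {m : ℕ} [NeZero m] {α β : ℝ} (hα : -(m : ℝ) < α)
    (hβ : -(m : ℝ) < β) (hαβ : α + β < -(m : ℝ)) :
    ∃ D : ℝ, ∀ z : E m, z ≠ 0 → Integrable (fun x => ‖x‖ ^ α * ‖z - x‖ ^ β) ∧
      ∫ x, ‖x‖ ^ α * ‖z - x‖ ^ β ≤ D * ‖z‖ ^ (α + β + m) := by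
  have e : ∀ z x : E m, (‖x‖ : ℂ) ^ (-2 * ((-α / 2 : ℝ) : ℂ)) *
      (‖z - x‖ : ℂ) ^ (-2 * ((-β / 2 : ℝ) : ℂ)) = ((‖x‖ ^ α * ‖z - x‖ ^ β : ℝ) : ℂ) := by
    intro z x
    rw [Complex.ofReal_mul, Complex.ofReal_cpow (norm_nonneg _),
      Complex.ofReal_cpow (norm_nonneg _)]
    congr 2 <;> · push_cast; ring
  have ha : 0 < ((-α / 2 : ℝ) : ℂ).re := by rw [Complex.ofReal_re]; linarith
  have hb : 0 < ((-β / 2 : ℝ) : ℂ).re := by rw [Complex.ofReal_re]; linarith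
  have ham : ((-α / 2 : ℝ) : ℂ).re < m / 2 := by rw [Complex.ofReal_re]; linarith
  have hbm : ((-β / 2 : ℝ) : ℂ).re < m / 2 := by rw [Complex.ofReal_re]; linarith
  have hab : (m : ℝ) / 2 < ((-α / 2 : ℝ) : ℂ).re + ((-β / 2 : ℝ) : ℂ).re := by
    rw [Complex.ofReal_re, Complex.ofReal_re]; linarith
  have hv := fun (z : E m) (hz : z ≠ 0) =>
    integral_norm_cpow_mul_norm_sub_cpow ha hb ham hbm hab hz
  have hi := fun (z : E m) (hz : z ≠ 0) =>
    integrable_norm_cpow_mul_norm_sub_cpow ha hb ham hbm hab hz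
  simp only [e] at hv hi
  obtain ⟨c, hc⟩ : ∃ c : ℂ, ∀ z : E m, z ≠ 0 →
      ∫ x, ((‖x‖ ^ α * ‖z - x‖ ^ β : ℝ) : ℂ) = c * (‖z‖ : ℂ) ^ ((m : ℂ) -
        2 * (((-α / 2 : ℝ) : ℂ) + ((-β / 2 : ℝ) : ℂ))) := ⟨_, hv⟩
  refine ⟨‖c‖, fun z hz => ⟨(hi z hz).re, ?_⟩⟩
  have h := congrArg norm (hc z hz)
  rw [integral_complex_ofReal, norm_mul, Complex.norm_real,
    Complex.norm_cpow_eq_rpow_re_of_pos (norm_pos_iff.mpr hz)] at h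
  have e2 : ((m : ℂ) - 2 * (((-α / 2 : ℝ) : ℂ) + ((-β / 2 : ℝ) : ℂ))).re = α + β + m := by
    simp [-Complex.ofReal_div, -Complex.ofReal_neg]; ring
  rw [e2] at h
  exact (le_abs_self _).trans h.le

/-- The shear `(x, y) ↦ (x, x + y)` preserves measure and turns the inner integral into `k z`. For
absolute convergence, the composition integral at real exponents bounds the inner integral of `‖K‖`
by a multiple of `‖z‖^(α+β+m)`. This is integrable against a Schwartz function because `α, β > -m`
gives `α+β+m > -m`. -/
theorem integral_convolution {m : ℕ} [NeZero m] {α β : ℝ} (hα : -(m : ℝ) < α)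
    (hβ : -(m : ℝ) < β) (hαβ : α + β < -(m : ℝ)) {K : E m → E m → ℂ}
    (hK : Measurable fun p : E m × E m => K p.1 p.2) {C : ℝ}
    (hKb : ∀ x y, x ≠ 0 → y ≠ 0 → ‖K x y‖ ≤ C * (‖x‖ ^ α * ‖y‖ ^ β)) {k : E m → ℂ}
    (hk : ∀ z, z ≠ 0 → ∫ x, K x (z - x) = k z) (φ : 𝓢(E m, ℂ)) :
    Integrable (fun p : E m × E m => K p.1 p.2 * φ (p.1 + p.2)) ∧
    ∫ p : E m × E m, K p.1 p.2 * φ (p.1 + p.2) = ∫ z, k z * φ z := by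
  obtain ⟨D, hD⟩ := integral_norm_rpow_mul_norm_sub_rpow hα hβ hαβ
  have hmp := (measurePreserving_prod_neg_add (volume : Measure (E m)) (volume : Measure (E m)))
  have hme : MeasurableEmbedding fun p : E m × E m => (p.1, -p.1 + p.2) :=
    (MeasurableEquiv.shearAddRight (E m)).symm.measurableEmbedding
  have hcomp : ∀ p : E m × E m, K p.1 (-p.1 + p.2) * φ (p.1 + (-p.1 + p.2)) =
      K p.1 (p.2 - p.1) * φ p.2 := fun p => by
    rw [add_neg_cancel_left, neg_add_eq_sub]
  have hm1 : Measurable fun p : E m × E m => K p.1 (p.2 - p.1) :=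
    hK.comp (measurable_fst.prodMk (measurable_snd.sub measurable_fst))
  have hm2 : Measurable fun p : E m × E m => K p.1 (p.2 - p.1) * φ p.2 :=
    hm1.mul (φ.continuous.measurable.comp measurable_snd)
  have hne : ∀ᵐ z : E m, z ≠ 0 := by simp [ae_iff]
  have hKi : ∀ z : E m, z ≠ 0 → Integrable (fun x => K x (z - x)) := fun z hz => by
    refine Integrable.mono' ((hD z hz).1.const_mul C)
      (hm1.comp (measurable_id.prodMk measurable_const)).aestronglyMeasurable ?_
    filter_upwards [ae_ne_ne z] with x hx
    exact hKb x (z - x) hx.1 hx.2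
  have hint : Integrable (fun p : E m × E m => K p.1 (p.2 - p.1) * φ p.2)
      ((volume : Measure (E m)).prod volume) := by
    rw [integrable_prod_iff' hm2.aestronglyMeasurable]
    constructor
    · filter_upwards [hne] with z hz
      exact (hKi z hz).mul_const _
    · have hb := (integrable_norm_cpow_mul_schwartz (lam := ((α + β + m : ℝ) : ℂ))
        (by rw [Complex.ofReal_re]; linarith) φ).norm.const_mul (C * D)
      refine Integrable.mono' hb ?_ ?_
      · exact (hm2.aestronglyMeasurable.norm.prod_swap).integral_prod_right'
      · filter_upwards [hne] with z hz
        have hz' := norm_pos_iff.mpr hz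
        -- Forced by the bound `hKb` itself at a nonzero point.
        have hC : 0 ≤ C := by
          by_contra hC
          push Not at hC
          have h1 := hKb z z hz hz
          have h2 : 0 < ‖z‖ ^ α * ‖z‖ ^ β := by positivity
          nlinarith [norm_nonneg (K z z)]
        simp only [norm_mul]
        rw [integral_mul_const, norm_mul, norm_norm, Real.norm_of_nonneg
          (integral_nonneg fun _ => norm_nonneg _), Complex.norm_cpow_eq_rpow_re_of_pos hz',
          Complex.ofReal_re, ← mul_assoc]
        gcongr
        calc ∫ x, ‖K x (z - x)‖ ≤ ∫ x, C * (‖x‖ ^ α * ‖z - x‖ ^ β) := by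
              refine integral_mono_ae (hKi z hz).norm ((hD z hz).1.const_mul C) ?_
              filter_upwards [ae_ne_ne z] with x hx
              exact hKb x (z - x) hx.1 hx.2
          _ ≤ C * D * ‖z‖ ^ (α + β + m) := by
              rw [integral_const_mul, mul_assoc]
              gcongr
              exact (hD z hz).2
  rw [Measure.volume_eq_prod]
  constructor
  · rw [← hmp.integrable_comp_emb hme]
    exact hint.congr (Eventually.of_forall fun p => (hcomp p).symm)
  · rw [← hmp.integral_comp hme]
    simp only [hcomp]
    rw [integral_prod_symm _ hint]
    refine integral_congr_ae ?_
    filter_upwards [hne] with z hz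
    rw [integral_mul_const, hk z hz]

/-- The normalizing factor of `T*`. -/
noncomputable def normT (m : ℕ) (lam : ℂ) : ℂ :=
  (Real.pi : ℂ) ^ ((lam + m) / 2) / Complex.Gamma ((lam + m) / 2)

/-- The normalizing factor of `U*`. -/
noncomputable def normU (m : ℕ) (lam : ℂ) : ℂ :=
  (Real.pi : ℂ) ^ ((lam + m + 1) / 2) / Complex.Gamma ((lam + m + 1) / 2)

theorem vec_add {m : ℕ} (x y : E m) : vec (x + y) = vec x + vec y := by
  simp only [vec, ← map_add]
  congr 1; ext i; simp

theorem vec_smul {m : ℕ} (r : ℝ) (x : E m) : vec (r • x) = (r : ℂ) • vec x := by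
  simp only [vec, ← map_smul]
  congr 1; ext i; simp

theorem vec_mul_self {m : ℕ} (x : E m) :
    vec x * vec x = algebraMap ℂ (Cl m) (-(‖x‖ : ℂ) ^ 2) := by
  rw [vec, CliffordAlgebra.ι_sq_scalar, QuadraticMap.weightedSumSquares_apply]
  congr 1
  have h := congrArg (fun t : ℝ => (t : ℂ)) (EuclideanSpace.real_norm_sq_eq x)
  simp only [Complex.ofReal_pow, Complex.ofReal_sum] at h
  rw [h, ← Finset.sum_neg_distrib]
  refine Finset.sum_congr rfl fun i _ => ?_
  simp [sq]

/-- The linear form `x ↦ L (vec x)`. -/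
noncomputable def vecForm {m : ℕ} (L : Cl m →ₗ[ℂ] ℂ) : E m →ₗ[ℝ] ℂ where
  toFun x := L (vec x)
  map_add' x y := by rw [vec_add, map_add]
  map_smul' r x := by rw [vec_smul, map_smul]; simp

/-- The bilinear form `(x, y) ↦ L (vec x * vec y)`. -/
noncomputable def vecBilin {m : ℕ} (L : Cl m →ₗ[ℂ] ℂ) : E m →ₗ[ℝ] E m →ₗ[ℝ] ℂ :=
  LinearMap.mk₂ ℝ (fun x y => L (vec x * vec y))
    (fun x y z => by rw [vec_add, add_mul, map_add])
    (fun r x y => by rw [vec_smul, smul_mul_assoc, map_smul]; simp)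
    (fun x y z => by rw [vec_add, mul_add, map_add])
    (fun r x y => by rw [vec_smul, mul_smul_comm, map_smul]; simp)

theorem sum_uVal_eq_integral {m : ℕ} [NeZero m] (L : Cl m →ₗ[ℂ] ℂ) {lam : ℂ}
    (hl : -(m : ℝ) < lam.re) (φ : 𝓢(E m, ℂ)) :
    L (Ustar m lam φ) = normU m lam * ∫ z, (‖z‖ : ℂ) ^ (lam - 1) * vecForm L z * φ z := by
  have hne : ∀ᵐ z : E m, z ≠ 0 := by simp [ae_iff]
  rw [Ustar_apply, map_sum]
  simp only [map_smul, smul_eq_mul, uVal_eq_integral _ hl]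
  change ∑ j, (normU m lam * _) * _ = _
  simp only [mul_assoc (normU m lam)]
  simp only [← integral_mul_const]
  rw [← Finset.mul_sum, ← integral_finsetSum]
  · congr 1
    refine integral_congr_ae ?_
    filter_upwards [hne] with z hz
    have h1 : vecForm L z = ∑ j, coord j z * L (gen j) := by
      change L (vec z) = _
      rw [vec_eq_sum, map_sum]; simp
    rw [h1, mul_assoc, Finset.sum_mul, Finset.mul_sum]
    refine Finset.sum_congr rfl fun j _ => ?_
    have := cpow_mul_coord j (lam - 1) hz
    rw [sub_add_cancel] at this
    linear_combination -(L (gen j)) * φ z * this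
  · exact fun j _ => (integrable_unitCoord j hl φ).mul_const _

theorem TstarFun_mul_TstarFun {m : ℕ} (L : Cl m →ₗ[ℂ] ℂ) (α β : ℂ) (x y : E m) :
    L (TstarFun m α x * TstarFun m β y) =
      L 1 * normT m α * normT m β * ((‖x‖ : ℂ) ^ α * (‖y‖ : ℂ) ^ β) := by
  rw [TstarFun, TstarFun, ← map_mul, Algebra.algebraMap_eq_smul_one, map_smul, smul_eq_mul,
    normT, normT]
  ring

theorem cpow_mul_inv {m : ℕ} {x : E m} (hx : x ≠ 0) (α : ℂ) :
    (‖x‖ : ℂ) ^ α * ((‖x‖⁻¹ : ℝ) : ℂ) = (‖x‖ : ℂ) ^ (α - 1) := by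
  have hn : (‖x‖ : ℂ) ≠ 0 := by exact_mod_cast (norm_pos_iff.mpr hx).ne'
  rw [Complex.cpow_sub _ _ hn, Complex.cpow_one]
  push_cast
  field_simp

theorem UstarFun_mul_TstarFun {m : ℕ} (L : Cl m →ₗ[ℂ] ℂ) (α β : ℂ) (x y : E m) :
    L (UstarFun m α x * TstarFun m β y) =
      normU m α * normT m β * (((‖x‖ : ℂ) ^ α * ((‖x‖⁻¹ : ℝ) : ℂ)) *
        (vecForm L x * (‖y‖ : ℂ) ^ β)) := by
  rw [TstarFun, UstarFun, ← Algebra.commutes, ← Algebra.smul_def, smul_smul, vec_smul, smul_smul,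
    map_smul, smul_eq_mul, normT, normU]
  change _ * vecForm L x = _
  ring

theorem UstarFun_mul_UstarFun {m : ℕ} (L : Cl m →ₗ[ℂ] ℂ) (α β : ℂ) (x y : E m) :
    L (UstarFun m α x * UstarFun m β y) =
      normU m α * normU m β * (((‖x‖ : ℂ) ^ α * ((‖x‖⁻¹ : ℝ) : ℂ)) *
        (((‖y‖ : ℂ) ^ β * ((‖y‖⁻¹ : ℝ) : ℂ)) * vecBilin L x y)) := by
  rw [UstarFun, UstarFun, vec_smul, vec_smul, smul_smul, smul_smul, smul_mul_smul_comm, map_smul,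
    smul_eq_mul, normU, normU]
  change _ * vecBilin L x y = _
  ring

/-- `Γ(-(α+β+m)/2) π^(m/2) / (Γ(-α/2) Γ(-β/2))`. -/
noncomputable def coeffTT (m : ℕ) (α β : ℂ) : ℂ :=
  (Real.pi : ℂ) ^ ((m : ℂ) / 2) * Complex.Gamma (-(α + β + m) / 2) *
    (Complex.Gamma (-α / 2))⁻¹ * (Complex.Gamma (-β / 2))⁻¹

/-- `Γ((1-α-β-m)/2) π^(m/2) / (Γ((1-α)/2) Γ(-β/2))`. -/
noncomputable def coeffUT (m : ℕ) (α β : ℂ) : ℂ :=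
  (Real.pi : ℂ) ^ ((m : ℂ) / 2) * Complex.Gamma ((1 - (α + β + m)) / 2) *
    (Complex.Gamma ((1 - α) / 2))⁻¹ * (Complex.Gamma (-β / 2))⁻¹

/-- `Γ(-(α+β+m)/2) π^(m/2+1) / (Γ((1-α)/2) Γ((1-β)/2))`. -/
noncomputable def coeffUU (m : ℕ) (α β : ℂ) : ℂ :=
  (Real.pi : ℂ) ^ ((m : ℂ) / 2 + 1) * Complex.Gamma (-(α + β + m) / 2) *
    (Complex.Gamma ((1 - α) / 2))⁻¹ * (Complex.Gamma ((1 - β) / 2))⁻¹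

theorem analyticAt_Gamma {w : ℂ} (hw : ∀ n : ℕ, w ≠ -n) : AnalyticAt ℂ Complex.Gamma w := by
  have h := (Complex.differentiable_one_div_Gamma.analyticAt w).inv
    (inv_ne_zero (Complex.Gamma_ne_zero hw))
  refine h.congr (Eventually.of_forall fun z => ?_)
  simp

theorem analyticAt_inv_Gamma (w : ℂ) : AnalyticAt ℂ (fun z => (Complex.Gamma z)⁻¹) w :=
  Complex.differentiable_one_div_Gamma.analyticAt w

/-- Only the Gamma factor of `α+β+m` can be singular, and its poles are at even naturals, which the
domain excludes. The other two Gamma functions enter through the entire function `1/Γ`. For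
`coeffUT` the excluded poles are the odd naturals. -/
theorem analyticAt_coeffTT {m : ℕ} {p : ℂ × ℂ} (hp : ∀ n : ℕ, p.1 + p.2 + m ≠ n) :
    AnalyticAt ℂ (fun p : ℂ × ℂ => coeffTT m p.1 p.2) p := by
  have h1 : AnalyticAt ℂ (fun p : ℂ × ℂ => Complex.Gamma (-(p.1 + p.2 + m) / 2)) p :=
    (analyticAt_Gamma (fun n hn => hp (2 * n) (by
      push_cast; linear_combination -2 * hn))).fun_comp
      (f := fun p : ℂ × ℂ => -(p.1 + p.2 + m) / 2) ((analyticAt_fst.add analyticAt_snd).add analyticAt_const).neg.div_const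
  have h2 : AnalyticAt ℂ (fun p : ℂ × ℂ => (Complex.Gamma (-p.1 / 2))⁻¹) p :=
    (analyticAt_inv_Gamma _).fun_comp (g := fun z => (Complex.Gamma z)⁻¹)
      (f := fun p : ℂ × ℂ => -p.1 / 2) analyticAt_fst.neg.div_const
  have h3 : AnalyticAt ℂ (fun p : ℂ × ℂ => (Complex.Gamma (-p.2 / 2))⁻¹) p :=
    (analyticAt_inv_Gamma _).fun_comp (g := fun z => (Complex.Gamma z)⁻¹)
      (f := fun p : ℂ × ℂ => -p.2 / 2) analyticAt_snd.neg.div_const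
  exact ((analyticAt_const.mul h1).mul h2).mul h3

theorem analyticAt_coeffUU {m : ℕ} {p : ℂ × ℂ} (hp : ∀ n : ℕ, p.1 + p.2 + m ≠ n) :
    AnalyticAt ℂ (fun p : ℂ × ℂ => coeffUU m p.1 p.2) p := by
  have h1 : AnalyticAt ℂ (fun p : ℂ × ℂ => Complex.Gamma (-(p.1 + p.2 + m) / 2)) p :=
    (analyticAt_Gamma (fun n hn => hp (2 * n) (by
      push_cast; linear_combination -2 * hn))).fun_comp
      (f := fun p : ℂ × ℂ => -(p.1 + p.2 + m) / 2) ((analyticAt_fst.add analyticAt_snd).add analyticAt_const).neg.div_const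
  have h2 : AnalyticAt ℂ (fun p : ℂ × ℂ => (Complex.Gamma ((1 - p.1) / 2))⁻¹) p :=
    (analyticAt_inv_Gamma _).fun_comp (g := fun z => (Complex.Gamma z)⁻¹)
      (f := fun p : ℂ × ℂ => (1 - p.1) / 2) (analyticAt_const.sub analyticAt_fst).div_const
  have h3 : AnalyticAt ℂ (fun p : ℂ × ℂ => (Complex.Gamma ((1 - p.2) / 2))⁻¹) p :=
    (analyticAt_inv_Gamma _).fun_comp (g := fun z => (Complex.Gamma z)⁻¹)
      (f := fun p : ℂ × ℂ => (1 - p.2) / 2) (analyticAt_const.sub analyticAt_snd).div_const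
  exact ((analyticAt_const.mul h1).mul h2).mul h3

theorem analyticAt_coeffUT {m : ℕ} {p : ℂ × ℂ} (hp : ∀ n : ℕ, p.1 + p.2 + m ≠ n) :
    AnalyticAt ℂ (fun p : ℂ × ℂ => coeffUT m p.1 p.2) p := by
  have h1 : AnalyticAt ℂ (fun p : ℂ × ℂ => Complex.Gamma ((1 - (p.1 + p.2 + m)) / 2)) p :=
    (analyticAt_Gamma (fun n hn => hp (2 * n + 1) (by
      push_cast; linear_combination -2 * hn))).fun_comp
      (f := fun p : ℂ × ℂ => (1 - (p.1 + p.2 + m)) / 2) (analyticAt_const.sub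
        ((analyticAt_fst.add analyticAt_snd).add analyticAt_const)).div_const
  have h2 : AnalyticAt ℂ (fun p : ℂ × ℂ => (Complex.Gamma ((1 - p.1) / 2))⁻¹) p :=
    (analyticAt_inv_Gamma _).fun_comp (g := fun z => (Complex.Gamma z)⁻¹)
      (f := fun p : ℂ × ℂ => (1 - p.1) / 2) (analyticAt_const.sub analyticAt_fst).div_const
  have h3 : AnalyticAt ℂ (fun p : ℂ × ℂ => (Complex.Gamma (-p.2 / 2))⁻¹) p :=
    (analyticAt_inv_Gamma _).fun_comp (g := fun z => (Complex.Gamma z)⁻¹)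
      (f := fun p : ℂ × ℂ => -p.2 / 2) analyticAt_snd.neg.div_const
  exact ((analyticAt_const.mul h1).mul h2).mul h3

theorem analyticAt_Tstar {m : ℕ} [NeZero m] (L : Cl m →ₗ[ℂ] ℂ) (φ : 𝓢(E m, ℂ)) (p : ℂ × ℂ) :
    AnalyticAt ℂ (fun p : ℂ × ℂ => L (Tstar m (p.1 + p.2 + m) φ)) p := by
  have h : ∀ lam, L (Tstar m lam φ) = tVal lam φ * L 1 := fun lam => by
    rw [Tstar_apply, Algebra.algebraMap_eq_smul_one, map_smul, smul_eq_mul]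
  simp only [h]
  have h1 := ((differentiable_tVal φ).analyticAt (p.1 + p.2 + m)).fun_comp
    (g := fun lam => tVal lam φ) (f := fun p : ℂ × ℂ => p.1 + p.2 + m) ((analyticAt_fst.add analyticAt_snd).add analyticAt_const)
  exact h1.mul analyticAt_const

theorem analyticAt_Ustar {m : ℕ} [NeZero m] (L : Cl m →ₗ[ℂ] ℂ) (φ : 𝓢(E m, ℂ)) (p : ℂ × ℂ) :
    AnalyticAt ℂ (fun p : ℂ × ℂ => L (Ustar m (p.1 + p.2 + m) φ)) p := by
  have h : ∀ lam, L (Ustar m lam φ) = ∑ j, uVal j lam φ * L (gen j) := fun lam => by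
    rw [Ustar_apply, map_sum]; simp
  simp only [h]
  refine Finset.analyticAt_fun_sum _ fun j _ => ?_
  have h1 := ((differentiable_uVal j φ).analyticAt (p.1 + p.2 + m)).fun_comp
    (g := fun lam => uVal j lam φ) (f := fun p : ℂ × ℂ => p.1 + p.2 + m) ((analyticAt_fst.add analyticAt_snd).add analyticAt_const)
  exact h1.mul analyticAt_const

end

/-! ### The four family convolutions -/

section

open Set Filter
open scoped Topology

theorem measurable_norm_cpow {m : ℕ} (α : ℂ) : Measurable fun x : E m => (‖x‖ : ℂ) ^ α :=
  (Complex.measurable_ofReal.comp measurable_norm).pow_const α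

/-- The normalizations of `T*_α` and `T*_β` cancel the two numerator Gammas of the composition
formula, while its denominator `Γ((α+β+2m)/2)` is the normalization of `T*_{α+β+m}`. -/
theorem normT_mul_normT {m : ℕ} {α β : ℂ} (hα : -(m : ℝ) < α.re) (hβ : -(m : ℝ) < β.re) :
    normT m α * normT m β * ((Real.pi : ℂ) ^ ((m : ℂ) / 2) *
      Complex.Gamma (-α / 2 + -β / 2 - m / 2) * Complex.Gamma (m / 2 - -α / 2) *
        Complex.Gamma (m / 2 - -β / 2) /
        (Complex.Gamma (-α / 2) * Complex.Gamma (-β / 2) *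
          Complex.Gamma (m - -α / 2 - -β / 2))) =
      coeffTT m α β * normT m (α + β + m) := by
  have hpi : (Real.pi : ℂ) ≠ 0 := by exact_mod_cast Real.pi_ne_zero
  have h1 : Complex.Gamma ((α + m) / 2) ≠ 0 := Complex.Gamma_ne_zero_of_re_pos (by
    simp; linarith)
  have h2 : Complex.Gamma ((β + m) / 2) ≠ 0 := Complex.Gamma_ne_zero_of_re_pos (by
    simp; linarith)
  rw [normT, normT, normT, coeffTT, show -α / 2 + -β / 2 - (m : ℂ) / 2 = -(α + β + m) / 2 by ring,
    show (m : ℂ) / 2 - -α / 2 = (α + m) / 2 by ring,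
    show (m : ℂ) / 2 - -β / 2 = (β + m) / 2 by ring,
    show (m : ℂ) - -α / 2 - -β / 2 = (α + β + m + m) / 2 by ring,
    show (α + β + m + m) / 2 = (α + m) / 2 + (β + m) / 2 by ring, Complex.cpow_add _ _ hpi]
  field_simp

theorem normU_mul_normT {m : ℕ} {α β : ℂ} (hα : -(m : ℝ) < α.re) (hβ : -(m : ℝ) < β.re) :
    normU m α * normT m β * ((Real.pi : ℂ) ^ ((m : ℂ) / 2) *
      Complex.Gamma ((1 - α) / 2 + -β / 2 - m / 2) * Complex.Gamma (m / 2 - (1 - α) / 2 + 1) *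
        Complex.Gamma (m / 2 - -β / 2) /
        (Complex.Gamma ((1 - α) / 2) * Complex.Gamma (-β / 2) *
          Complex.Gamma (m - (1 - α) / 2 - -β / 2 + 1))) =
      coeffUT m α β * normU m (α + β + m) := by
  have hpi : (Real.pi : ℂ) ≠ 0 := by exact_mod_cast Real.pi_ne_zero
  have h1 : Complex.Gamma ((α + m + 1) / 2) ≠ 0 := Complex.Gamma_ne_zero_of_re_pos (by
    simp; linarith)
  have h2 : Complex.Gamma ((β + m) / 2) ≠ 0 := Complex.Gamma_ne_zero_of_re_pos (by
    simp; linarith)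
  rw [normU, normT, normU, coeffUT,
    show (1 - α) / 2 + -β / 2 - (m : ℂ) / 2 = (1 - (α + β + m)) / 2 by ring,
    show (m : ℂ) / 2 - (1 - α) / 2 + 1 = (α + m + 1) / 2 by ring,
    show (m : ℂ) / 2 - -β / 2 = (β + m) / 2 by ring,
    show (m : ℂ) - (1 - α) / 2 - -β / 2 + 1 = (α + β + m + m + 1) / 2 by ring,
    show (α + β + m + m + 1) / 2 = (α + m + 1) / 2 + (β + m) / 2 by ring, Complex.cpow_add _ _ hpi]
  field_simp

theorem normU_mul_normU {m : ℕ} {α β : ℂ} (hα : -(m : ℝ) < α.re) (hβ : -(m : ℝ) < β.re) :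
    normU m α * normU m β * ((Real.pi : ℂ) ^ ((m : ℂ) / 2) *
      Complex.Gamma ((1 - α) / 2 + (1 - β) / 2 - m / 2 - 1) *
        Complex.Gamma (m / 2 - (1 - α) / 2 + 1) * Complex.Gamma (m / 2 - (1 - β) / 2 + 1) /
        (Complex.Gamma ((1 - α) / 2) * Complex.Gamma ((1 - β) / 2) *
          Complex.Gamma (m + 1 - (1 - α) / 2 - (1 - β) / 2))) =
      coeffUU m α β * normT m (α + β + m) := by
  have hpi : (Real.pi : ℂ) ≠ 0 := by exact_mod_cast Real.pi_ne_zero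
  have h1 : Complex.Gamma ((α + m + 1) / 2) ≠ 0 := Complex.Gamma_ne_zero_of_re_pos (by
    simp; linarith)
  have h2 : Complex.Gamma ((β + m + 1) / 2) ≠ 0 := Complex.Gamma_ne_zero_of_re_pos (by
    simp; linarith)
  have hp : (Real.pi : ℂ) ^ ((α + m + 1) / 2) * (Real.pi : ℂ) ^ ((β + m + 1) / 2) =
      Real.pi * (Real.pi : ℂ) ^ ((α + β + m + m) / 2) := by
    rw [← Complex.cpow_add _ _ hpi, show (α + m + 1) / 2 + (β + m + 1) / 2 =
      1 + (α + β + m + m) / 2 by ring, Complex.cpow_add _ _ hpi, Complex.cpow_one]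
  rw [normU, normU, normT, coeffUU,
    show (1 - α) / 2 + (1 - β) / 2 - (m : ℂ) / 2 - 1 = -(α + β + m) / 2 by ring,
    show (m : ℂ) / 2 - (1 - α) / 2 + 1 = (α + m + 1) / 2 by ring,
    show (m : ℂ) / 2 - (1 - β) / 2 + 1 = (β + m + 1) / 2 by ring,
    show (m : ℂ) + 1 - (1 - α) / 2 - (1 - β) / 2 = (α + β + m + m) / 2 by ring,
    Complex.cpow_add _ _ hpi, Complex.cpow_one]
  generalize Complex.Gamma (-(α + β + m) / 2) = G
  field_simp
  linear_combination G *
    (Complex.Gamma ((1 - α) / 2))⁻¹ * (Complex.Gamma ((1 - β) / 2))⁻¹ *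
    (Complex.Gamma ((α + β + m + m) / 2))⁻¹ * hp

theorem isFamilyConvolution_TT (m : ℕ) [NeZero m] :
    IsFamilyConvolution (TstarFun m) (TstarFun m)
      fun α β => coeffTT m α β • Tstar m (α + β + m) := by
  intro φ L
  constructor
  · intro p hp
    simp only [Pi.smul_apply, map_smul, smul_eq_mul]
    exact (analyticAt_coeffTT hp).mul (analyticAt_Tstar L φ p)
  · intro α β hα hβ hαβ
    rw [Complex.add_re] at hαβ
    simp only [Pi.smul_apply, map_smul, smul_eq_mul, TstarFun_mul_TstarFun]
    have key := integral_convolution hα hβ hαβ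
      (K := fun x y => L 1 * normT m α * normT m β * ((‖x‖ : ℂ) ^ α * (‖y‖ : ℂ) ^ β))
      (by exact (((measurable_norm_cpow α).comp measurable_fst).mul
        ((measurable_norm_cpow β).comp measurable_snd)).const_mul _)
      (C := ‖L 1 * normT m α * normT m β‖)
      (fun x y hx hy => by
        rw [norm_mul, norm_mul ((‖x‖ : ℂ) ^ α),
          Complex.norm_cpow_eq_rpow_re_of_pos (norm_pos_iff.mpr hx),
          Complex.norm_cpow_eq_rpow_re_of_pos (norm_pos_iff.mpr hy)])
      (k := fun z => L 1 * (coeffTT m α β * normT m (α + β + m)) * (‖z‖ : ℂ) ^ (α + β + m))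
      (fun z hz => by
        -- Positivity of the real parts of `-α/2` and `-β/2` is automatic: `Re β > -m` and `Re (α+β)
        -- < -m` force `Re α < 0`, and symmetrically for `β`.
        have h := integral_norm_cpow_mul_norm_sub_cpow (a := -α / 2) (b := -β / 2)
          (by simp; linarith) (by simp; linarith) (by simp; linarith) (by simp; linarith)
          (by simp; linarith) hz
        rw [show -2 * (-α / 2) = α by ring, show -2 * (-β / 2) = β by ring,
          show (m : ℂ) - 2 * (-α / 2 + -β / 2) = α + β + m by ring] at h
        rw [integral_const_mul, h, ← normT_mul_normT hα hβ]
        ring) φ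
    refine ⟨key.1, ?_⟩
    rw [key.2, Tstar_apply, Algebra.algebraMap_eq_smul_one, map_smul, smul_eq_mul,
      tVal_eq_integral (by simp; linarith)]
    simp only [mul_assoc]
    rw [integral_const_mul, integral_const_mul, integral_const_mul]
    simp only [normT]
    ring

theorem isFamilyConvolution_UT (m : ℕ) [NeZero m] :
    IsFamilyConvolution (UstarFun m) (TstarFun m)
      fun α β => coeffUT m α β • Ustar m (α + β + m) := by
  intro φ L
  constructor
  · intro p hp
    simp only [Pi.smul_apply, map_smul, smul_eq_mul]
    exact (analyticAt_coeffUT hp).mul (analyticAt_Ustar L φ p)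
  · intro α β hα hβ hαβ
    rw [Complex.add_re] at hαβ
    simp only [Pi.smul_apply, map_smul, smul_eq_mul, UstarFun_mul_TstarFun]
    obtain ⟨C, hC⟩ := linear_bound (vecForm L)
    have key := integral_convolution hα hβ hαβ
      (K := fun x y => normU m α * normT m β * (((‖x‖ : ℂ) ^ α * ((‖x‖⁻¹ : ℝ) : ℂ)) *
        (vecForm L x * (‖y‖ : ℂ) ^ β)))
      (by exact ((((measurable_norm_cpow α).mul
        (Complex.measurable_ofReal.comp measurable_norm.inv)).comp measurable_fst).mul
          (((measurable_linear _).comp measurable_fst).mul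
        ((measurable_norm_cpow β).comp measurable_snd))).const_mul _)
      (C := ‖normU m α * normT m β‖ * C)
      (fun x y hx hy => by
        have hx' := norm_pos_iff.mpr hx
        rw [norm_mul, norm_mul (_ * _), norm_mul ((‖x‖ : ℂ) ^ α), norm_mul (vecForm L x),
          Complex.norm_cpow_eq_rpow_re_of_pos hx', Complex.norm_real,
          Complex.norm_cpow_eq_rpow_re_of_pos (norm_pos_iff.mpr hy), norm_inv, norm_norm]
        calc _ ≤ ‖normU m α * normT m β‖ * (‖x‖ ^ α.re * ‖x‖⁻¹ * (C * ‖x‖ * ‖y‖ ^ β.re)) := by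
              gcongr
              exact hC x
          _ = _ := by field_simp)
      (k := fun z => coeffUT m α β * normU m (α + β + m) *
        ((‖z‖ : ℂ) ^ (α + β + m - 1) * vecForm L z))
      (fun z hz => by
        -- The kernel of `U*_α` is a multiple of `‖x‖^(α-1)` times the vector `x`, hence the
        -- exponent `a = (1-α)/2` and a linear weight.
        have h := integral_linear_mul_norm_cpow (vecForm L) (a := (1 - α) / 2) (b := -β / 2)
          (by simp; linarith) (by simp; linarith) (by simp; linarith) (by simp; linarith)
          (by simp; linarith) hz
        rw [show -2 * ((1 - α) / 2) = α - 1 by ring, show -2 * (-β / 2) = β by ring,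
          show (m : ℂ) - 2 * ((1 - α) / 2 + -β / 2) = α + β + m - 1 by ring] at h
        rw [integral_const_mul, ← normU_mul_normT hα hβ, mul_assoc (normU m α * _), ← h]
        congr 1
        refine integral_congr_ae ?_
        filter_upwards [ae_ne_ne z] with x hx
        rw [cpow_mul_inv hx.1]
        ring) φ
    refine ⟨key.1, ?_⟩
    rw [key.2, sum_uVal_eq_integral L (by simp; linarith), ← mul_assoc, ← integral_const_mul]
    congr 1; ext z; ring

theorem isFamilyConvolution_UU (m : ℕ) [NeZero m] :
    IsFamilyConvolution (UstarFun m) (UstarFun m)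
      fun α β => coeffUU m α β • Tstar m (α + β + m) := by
  intro φ L
  constructor
  · intro p hp
    simp only [Pi.smul_apply, map_smul, smul_eq_mul]
    exact (analyticAt_coeffUU hp).mul (analyticAt_Tstar L φ p)
  · intro α β hα hβ hαβ
    rw [Complex.add_re] at hαβ
    simp only [Pi.smul_apply, map_smul, smul_eq_mul, UstarFun_mul_UstarFun]
    obtain ⟨C, hC⟩ := bilinear_bound (vecBilin L)
    -- The relation `x² = -‖x‖²` supplies the diagonal hypothesis of the bilinear formula with `κ =
    -- L 1`, so the convolution is a multiple of the unit of the algebra.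
    have hB : ∀ x : E m, vecBilin L x x = -L 1 * (‖x‖ : ℂ) ^ 2 := fun x => by
      change L (vec x * vec x) = _
      rw [vec_mul_self, Algebra.algebraMap_eq_smul_one, map_smul, smul_eq_mul]
      ring
    have key := integral_convolution hα hβ hαβ
      (K := fun x y => normU m α * normU m β * (((‖x‖ : ℂ) ^ α * ((‖x‖⁻¹ : ℝ) : ℂ)) *
        (((‖y‖ : ℂ) ^ β * ((‖y‖⁻¹ : ℝ) : ℂ)) * vecBilin L x y)))
      (by exact ((((measurable_norm_cpow α).mul
        (Complex.measurable_ofReal.comp measurable_norm.inv)).comp measurable_fst).mul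
          ((((measurable_norm_cpow β).mul
        (Complex.measurable_ofReal.comp measurable_norm.inv)).comp measurable_snd).mul
          (measurable_bilinear_uncurry _))).const_mul _)
      (C := ‖normU m α * normU m β‖ * C)
      (fun x y hx hy => by
        have hx' := norm_pos_iff.mpr hx
        have hy' := norm_pos_iff.mpr hy
        rw [norm_mul, norm_mul (_ * _), norm_mul ((‖x‖ : ℂ) ^ α), norm_mul (_ * _) (vecBilin L x y),
          norm_mul ((‖y‖ : ℂ) ^ β), Complex.norm_cpow_eq_rpow_re_of_pos hx', Complex.norm_real,
          Complex.norm_cpow_eq_rpow_re_of_pos hy', norm_inv, norm_norm, Complex.norm_real,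
          norm_inv, norm_norm]
        calc _ ≤ ‖normU m α * normU m β‖ * (‖x‖ ^ α.re * ‖x‖⁻¹ *
              (‖y‖ ^ β.re * ‖y‖⁻¹ * (C * (‖x‖ * ‖y‖)))) := by
              gcongr
              exact hC x y
          _ = _ := by field_simp)
      (k := fun z => L 1 * (coeffUU m α β * normT m (α + β + m)) * (‖z‖ : ℂ) ^ (α + β + m))
      (fun z hz => by
        have h := integral_bilinear_mul_norm_cpow (vecBilin L) hB (a := (1 - α) / 2)
          (b := (1 - β) / 2)
          (by simp; linarith) (by simp; linarith) (by simp; linarith) (by simp; linarith)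
          (by simp; linarith) hz
        rw [show -2 * ((1 - α) / 2) = α - 1 by ring, show -2 * ((1 - β) / 2) = β - 1 by ring,
          show (m : ℂ) + 2 - 2 * ((1 - α) / 2 + (1 - β) / 2) = α + β + m by ring] at h
        have e : ∫ x, (normU m α * normU m β * (((‖x‖ : ℂ) ^ α * ((‖x‖⁻¹ : ℝ) : ℂ)) *
            (((‖z - x‖ : ℂ) ^ β * ((‖z - x‖⁻¹ : ℝ) : ℂ)) * vecBilin L x (z - x)))) =
            normU m α * normU m β * ∫ x, vecBilin L x (z - x) *
              ((‖x‖ : ℂ) ^ (α - 1) * (‖z - x‖ : ℂ) ^ (β - 1)) := by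
          rw [integral_const_mul]
          congr 1
          refine integral_congr_ae ?_
          filter_upwards [ae_ne_ne z] with x hx
          rw [cpow_mul_inv hx.1, cpow_mul_inv hx.2]
          ring
        rw [e, h, ← normU_mul_normU hα hβ]
        ring) φ
    refine ⟨key.1, ?_⟩
    rw [key.2, Tstar_apply, Algebra.algebraMap_eq_smul_one, map_smul, smul_eq_mul,
      tVal_eq_integral (by simp; linarith)]
    simp only [mul_assoc]
    rw [integral_const_mul, integral_const_mul, integral_const_mul]
    simp only [normT]
    ring

/-- `T*` is scalar valued, hence central, so exchanging the two integration variables reduces this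
to the `U* ∗ T*` case with the parameters swapped. -/
theorem isFamilyConvolution_TU (m : ℕ) [NeZero m] :
    IsFamilyConvolution (TstarFun m) (UstarFun m)
      fun α β => coeffUT m β α • Ustar m (α + β + m) := by
  intro φ L
  obtain ⟨h1, h2⟩ := isFamilyConvolution_UT m φ L
  constructor
  · intro p hp
    have h := (h1 (p.2, p.1) (fun n => by simpa [add_comm p.2 p.1] using hp n)).comp_of_eq
      (f := fun q : ℂ × ℂ => (q.2, q.1)) (x := p) (analyticAt_snd.prod analyticAt_fst) rfl
    simpa [Function.comp_def, add_comm] using h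
  · intro α β hα hβ hαβ
    obtain ⟨hi, hv⟩ := h2 β α hβ hα (by rwa [add_comm])
    have e : ∀ z : E m × E m, L (TstarFun m α z.1 * UstarFun m β z.2) * φ (z.1 + z.2) =
        (fun w : E m × E m => L (UstarFun m β w.1 * TstarFun m α w.2) * φ (w.1 + w.2)) z.swap :=
      fun z => by
        simp only [Prod.fst_swap, Prod.snd_swap]
        rw [TstarFun, Algebra.commutes, add_comm z.1]
    simp only [e]
    rw [Measure.volume_eq_prod] at hi hv ⊢
    refine ⟨hi.swap, ?_⟩
    rw [integral_prod_swap (fun w : E m × E m =>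
      L (UstarFun m β w.1 * TstarFun m α w.2) * φ (w.1 + w.2)), ← hv, add_comm α β]

end

/-! ### The coefficient identities -/

section

theorem exp_I_mul_pi_neg_sub_nat (m n : ℕ) :
    Complex.exp (Complex.I * Real.pi * (-m - n)) = (-1) ^ (m + n) := by
  have h : Complex.I * Real.pi * (-m - n) = -(((m + n : ℕ) : ℂ) * (Real.pi * Complex.I)) := by
    push_cast; ring
  rw [h, Complex.exp_neg, Complex.exp_nat_mul, Complex.exp_pi_mul_I, ← inv_pow]
  norm_num

/-- Away from the poles the Gamma function cancels its reciprocal. At a pole `μ = -m-2l` the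
hypothesis forces `m` to be even, so `exp(iπμ) = 1` and both sides vanish: the omitted summand needs
no separate treatment. -/
theorem one_sub_exp_mul_coeffT {m : ℕ} {μ : ℂ} (hodd : Odd m → ∀ n : ℕ, μ ≠ -m - n) :
    (1 - Complex.exp (Complex.I * Real.pi * μ)) * coeffT m μ *
      (Complex.Gamma ((m + μ) / 2))⁻¹ =
    (1 - Complex.exp (Complex.I * Real.pi * μ)) * (2 ^ μ / (Real.pi : ℂ) ^ ((m - μ) / 2)) := by
  by_cases hG : Complex.Gamma ((m + μ) / 2) = 0
  · obtain ⟨l, hl⟩ := (Complex.Gamma_eq_zero_iff _).mp hG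
    have hμ : μ = -m - (2 * l : ℕ) := by push_cast; linear_combination 2 * hl
    have hm : Even m := Nat.not_odd_iff_even.mp fun h => hodd h _ hμ
    have he : Complex.exp (Complex.I * Real.pi * μ) = 1 := by
      rw [hμ, exp_I_mul_pi_neg_sub_nat]
      exact (hm.add (even_two_mul l)).neg_one_pow
    rw [he]; ring
  · rw [coeffT]; field_simp

/-- As for `coeffT`, with poles at `μ = -m-2l-1`; for even `m` the exponential is then `-1`. -/
theorem one_add_exp_mul_coeffU {m : ℕ} {μ : ℂ} (hodd : Odd m → ∀ n : ℕ, μ ≠ -m - n) :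
    (1 + Complex.exp (Complex.I * Real.pi * μ)) * coeffU m μ *
      (Complex.Gamma ((m + μ + 1) / 2))⁻¹ =
    (1 + Complex.exp (Complex.I * Real.pi * μ)) * (2 ^ μ / (Real.pi : ℂ) ^ ((m - μ + 1) / 2)) := by
  by_cases hG : Complex.Gamma ((m + μ + 1) / 2) = 0
  · obtain ⟨l, hl⟩ := (Complex.Gamma_eq_zero_iff _).mp hG
    have hμ : μ = -m - (2 * l + 1 : ℕ) := by push_cast; linear_combination 2 * hl
    have hm : Even m := Nat.not_odd_iff_even.mp fun h => hodd h _ hμ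
    have he : Complex.exp (Complex.I * Real.pi * μ) = -1 := by
      rw [hμ, exp_I_mul_pi_neg_sub_nat]
      exact (hm.add_odd (odd_two_mul_add_one l)).neg_one_pow
    rw [he]; ring
  · rw [coeffU]; field_simp

theorem pi_cpow_ne_zero (z : ℂ) : (Real.pi : ℂ) ^ z ≠ 0 := by
  rw [Complex.cpow_def_of_ne_zero (by exact_mod_cast Real.pi_ne_zero)]
  exact Complex.exp_ne_zero _

theorem pi_cpow_add (y z : ℂ) :
    (Real.pi : ℂ) ^ (y + z) = (Real.pi : ℂ) ^ y * (Real.pi : ℂ) ^ z :=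
  Complex.cpow_add _ _ (by exact_mod_cast Real.pi_ne_zero)

/-- The coefficient of `T*` in the kernel of the product `∂^μ H ∗ ∂^ν H`. -/
theorem coeff_scalar {m : ℕ} {μ ν : ℂ} (hμ : Odd m → ∀ n : ℕ, μ ≠ -m - n)
    (hν : Odd m → ∀ n : ℕ, ν ≠ -m - n) :
    ((1 - Complex.exp (Complex.I * Real.pi * μ)) / 2 * coeffT m μ) *
        ((1 - Complex.exp (Complex.I * Real.pi * ν)) / 2 * coeffT m ν) *
        coeffTT m (-m - μ) (-m - ν) +
      (-((1 + Complex.exp (Complex.I * Real.pi * μ)) / 2 * coeffU m μ)) *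
        (-((1 + Complex.exp (Complex.I * Real.pi * ν)) / 2 * coeffU m ν)) *
        coeffUU m (-m - μ) (-m - ν) =
      (1 + Complex.exp (Complex.I * Real.pi * (μ + ν))) / 2 * coeffT m (μ + ν) := by
  have h1 := one_sub_exp_mul_coeffT hμ
  have h2 := one_sub_exp_mul_coeffT hν
  have h3 := one_add_exp_mul_coeffU hμ
  have h4 := one_add_exp_mul_coeffU hν
  have hpT : (Real.pi : ℂ) ^ ((m : ℂ) / 2) / ((Real.pi : ℂ) ^ ((m - μ) / 2) *
      (Real.pi : ℂ) ^ ((m - ν) / 2)) = ((Real.pi : ℂ) ^ ((m - (μ + ν)) / 2))⁻¹ := by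
    rw [div_eq_iff (mul_ne_zero (pi_cpow_ne_zero _) (pi_cpow_ne_zero _)),
      eq_inv_mul_iff_mul_eq₀ (pi_cpow_ne_zero _), ← pi_cpow_add, ← pi_cpow_add]
    congr 1; ring
  have hpU : (Real.pi : ℂ) ^ ((m : ℂ) / 2 + 1) / ((Real.pi : ℂ) ^ ((m - μ + 1) / 2) *
      (Real.pi : ℂ) ^ ((m - ν + 1) / 2)) = ((Real.pi : ℂ) ^ ((m - (μ + ν)) / 2))⁻¹ := by
    rw [div_eq_iff (mul_ne_zero (pi_cpow_ne_zero _) (pi_cpow_ne_zero _)),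
      eq_inv_mul_iff_mul_eq₀ (pi_cpow_ne_zero _), ← pi_cpow_add, ← pi_cpow_add]
    congr 1; ring
  rw [mul_add (Complex.I * Real.pi), Complex.exp_add]
  simp only [coeffTT, coeffUU, coeffT.eq_1 m (μ + ν)]
  rw [show -(-(m : ℂ) - μ + (-m - ν) + m) / 2 = (m + (μ + ν)) / 2 by ring,
    show -(-(m : ℂ) - μ) / 2 = (m + μ) / 2 by ring, show -(-(m : ℂ) - ν) / 2 = (m + ν) / 2 by ring,
    show (1 - (-(m : ℂ) - μ)) / 2 = (m + μ + 1) / 2 by ring,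
    show (1 - (-(m : ℂ) - ν)) / 2 = (m + ν + 1) / 2 by ring,
    Complex.cpow_add _ _ two_ne_zero]
  generalize Complex.exp (Complex.I * Real.pi * μ) = e at *
  generalize Complex.exp (Complex.I * Real.pi * ν) = f at *
  generalize Complex.Gamma ((m + (μ + ν)) / 2) = G
  -- Each kernel coefficient is paired with the reciprocal Gamma supplied by the convolution
  -- coefficient, so that poles in `μ` or `ν` are handled by the two preceding lemmas.
  calc _ = (Real.pi : ℂ) ^ ((m : ℂ) / 2) * G / 4 *
          (((1 - e) * coeffT m μ * (Complex.Gamma ((m + μ) / 2))⁻¹) *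
            ((1 - f) * coeffT m ν * (Complex.Gamma ((m + ν) / 2))⁻¹)) +
        (Real.pi : ℂ) ^ ((m : ℂ) / 2 + 1) * G / 4 *
          (((1 + e) * coeffU m μ * (Complex.Gamma ((m + μ + 1) / 2))⁻¹) *
            ((1 + f) * coeffU m ν * (Complex.Gamma ((m + ν + 1) / 2))⁻¹)) := by ring
    _ = G / 4 * (2 ^ μ * 2 ^ ν) * ((1 - e) * (1 - f) * ((Real.pi : ℂ) ^ ((m : ℂ) / 2) /
          ((Real.pi : ℂ) ^ ((m - μ) / 2) * (Real.pi : ℂ) ^ ((m - ν) / 2))) +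
        (1 + e) * (1 + f) * ((Real.pi : ℂ) ^ ((m : ℂ) / 2 + 1) /
          ((Real.pi : ℂ) ^ ((m - μ + 1) / 2) * (Real.pi : ℂ) ^ ((m - ν + 1) / 2)))) := by
        rw [h1, h2, h3, h4]; ring
    -- Both powers of `π` are now equal, and `(1-e)(1-f) + (1+e)(1+f) = 2(1+ef)`.
    _ = _ := by rw [hpT, hpU]; ring

/-- The coefficient of `U*` in the kernel of the product `∂^μ H ∗ ∂^ν H`. -/
theorem coeff_vector {m : ℕ} {μ ν : ℂ} (hμ : Odd m → ∀ n : ℕ, μ ≠ -m - n)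
    (hν : Odd m → ∀ n : ℕ, ν ≠ -m - n) :
    ((1 - Complex.exp (Complex.I * Real.pi * μ)) / 2 * coeffT m μ) *
        (-((1 + Complex.exp (Complex.I * Real.pi * ν)) / 2 * coeffU m ν)) *
        coeffUT m (-m - ν) (-m - μ) +
      (-((1 + Complex.exp (Complex.I * Real.pi * μ)) / 2 * coeffU m μ)) *
        ((1 - Complex.exp (Complex.I * Real.pi * ν)) / 2 * coeffT m ν) *
        coeffUT m (-m - μ) (-m - ν) =
      -((1 - Complex.exp (Complex.I * Real.pi * (μ + ν))) / 2 * coeffU m (μ + ν)) := by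
  have h1 := one_sub_exp_mul_coeffT hμ
  have h2 := one_sub_exp_mul_coeffT hν
  have h3 := one_add_exp_mul_coeffU hμ
  have h4 := one_add_exp_mul_coeffU hν
  have hp : ∀ μ ν : ℂ, (Real.pi : ℂ) ^ ((m : ℂ) / 2) / ((Real.pi : ℂ) ^ ((m - μ) / 2) *
      (Real.pi : ℂ) ^ ((m - ν + 1) / 2)) = ((Real.pi : ℂ) ^ ((m - (μ + ν) + 1) / 2))⁻¹ := by
    intro μ ν
    rw [div_eq_iff (mul_ne_zero (pi_cpow_ne_zero _) (pi_cpow_ne_zero _)),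
      eq_inv_mul_iff_mul_eq₀ (pi_cpow_ne_zero _), ← pi_cpow_add, ← pi_cpow_add]
    congr 1; ring
  have hpT := hp μ ν
  have hpU := hp ν μ
  rw [add_comm ν μ] at hpU
  rw [mul_add (Complex.I * Real.pi), Complex.exp_add]
  simp only [coeffUT, coeffU.eq_1 m (μ + ν)]
  rw [show (1 - (-(m : ℂ) - ν + (-m - μ) + m)) / 2 = (m + (μ + ν) + 1) / 2 by ring,
    show (1 - (-(m : ℂ) - μ + (-m - ν) + m)) / 2 = (m + (μ + ν) + 1) / 2 by ring,
    show -(-(m : ℂ) - μ) / 2 = (m + μ) / 2 by ring, show -(-(m : ℂ) - ν) / 2 = (m + ν) / 2 by ring,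
    show (1 - (-(m : ℂ) - μ)) / 2 = (m + μ + 1) / 2 by ring,
    show (1 - (-(m : ℂ) - ν)) / 2 = (m + ν + 1) / 2 by ring,
    Complex.cpow_add _ _ two_ne_zero]
  generalize Complex.exp (Complex.I * Real.pi * μ) = e at *
  generalize Complex.exp (Complex.I * Real.pi * ν) = f at *
  generalize Complex.Gamma ((m + (μ + ν) + 1) / 2) = G
  calc _ = -((Real.pi : ℂ) ^ ((m : ℂ) / 2) * G / 4 *
          (((1 - e) * coeffT m μ * (Complex.Gamma ((m + μ) / 2))⁻¹) *
            ((1 + f) * coeffU m ν * (Complex.Gamma ((m + ν + 1) / 2))⁻¹) +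
          ((1 - f) * coeffT m ν * (Complex.Gamma ((m + ν) / 2))⁻¹) *
            ((1 + e) * coeffU m μ * (Complex.Gamma ((m + μ + 1) / 2))⁻¹))) := by ring
    _ = -(G / 4 * (2 ^ μ * 2 ^ ν) * ((1 - e) * (1 + f) * ((Real.pi : ℂ) ^ ((m : ℂ) / 2) /
          ((Real.pi : ℂ) ^ ((m - μ) / 2) * (Real.pi : ℂ) ^ ((m - ν + 1) / 2))) +
        (1 - f) * (1 + e) * ((Real.pi : ℂ) ^ ((m : ℂ) / 2) /
          ((Real.pi : ℂ) ^ ((m - ν) / 2) * (Real.pi : ℂ) ^ ((m - μ + 1) / 2))))) := by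
        rw [h1, h2, h3, h4]; ring
    -- Here the identity is `(1-e)(1+f) + (1-f)(1+e) = 2(1-ef)`.
    _ = _ := by rw [hpT, hpU]; ring

end

end CliffordKernels

theorem proposition5p1 (m : ℕ) (hm : 1 ≤ m) (μ ν : ℂ)
    (hodd : Odd m → ∀ n : ℕ, μ ≠ -m - n ∧ ν ≠ -m - n)
    (hsum : ∀ n : ℕ, μ + ν ≠ -m - n) :
    CliffordKernels.HasConvolution (CliffordKernels.hilbertKernel m μ)
      (CliffordKernels.hilbertKernel m ν) (CliffordKernels.diracKernel m (μ + ν)) := by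
  have : NeZero m := ⟨by omega⟩
  have hμ : Odd m → ∀ n : ℕ, μ ≠ -m - n := fun h n => (hodd h n).1
  have hν : Odd m → ∀ n : ℕ, ν ≠ -m - n := fun h n => (hodd h n).2
  -- The condition `α+β+m ∉ ℕ` is exactly `hsum`. The `U*` coefficients are the negated ones, since
  -- the kernels carry a minus sign before `U*`.
  refine ⟨-m - μ, -m - ν, _, _, _, _, _, _, _, _, fun n hn => hsum n ?_,
    (sub_eq_add_neg _ _).trans (congrArg _ (neg_smul _ _).symm),
    (sub_eq_add_neg _ _).trans (congrArg _ (neg_smul _ _).symm),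
    CliffordKernels.isFamilyConvolution_TT m, CliffordKernels.isFamilyConvolution_TU m,
    CliffordKernels.isFamilyConvolution_UT m, CliffordKernels.isFamilyConvolution_UU m, ?_⟩
  · linear_combination -hn
  · have e : -(m : ℂ) - μ + (-m - ν) + m = -m - (μ + ν) := by ring
    simp only [e, smul_smul]
    rw [CliffordKernels.diracKernel, ← CliffordKernels.coeff_scalar hμ hν, sub_eq_add_neg,
      ← neg_smul, ← CliffordKernels.coeff_vector hμ hν, add_smul, add_smul]
    abel
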